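/- Let $R$ be a commutative semiring and $\Sigma$ a set. Let $\mathrm{Cob}_{\Sigma,\mathsf I}$ be the symmetric monoidal category whose objects are finite sequences of signs $+,-$ (oriented $0$-manifolds), whose morphisms are compact oriented one-dimensional cobordisms, up to homeomorphism rel boundary, which may have inner (floating) endpoints and finitely many defect points labelled by elements of $\Sigma$ in the interior, away from the endpoints; composition is gluing, and the tensor product is concatenation of sequences and disjoint union. Let $R\text{-mod}$ be the symmetric monoidal category of $R$-(semi)modules under $\otimes_R$. An $R$-module $P$ is called finitely generated projective if it is a retract of a free module of finite rank: there are $k$ and $R$-linear maps $P\xrightarrow{\iota}R^k\xrightarrow{p}P$ with $p\iota=\mathrm{id}_P$. Then there is a bijection between isomorphism classes (under monoidal natural isomorphism) of symmetric (strong) monoidal functors $$\mathcal F:\mathrm{Cob}_{\Sigma,\mathsf I}\longrightarrow R\text{-mod}$$ and isomorphism classes of tuples $(P,v_0,\widetilde v_0,(m_a)_{a\in\Sigma})$ consisting of a finitely generated projective $R$-module $P$, a vector $v_0\in P$, a covector $\widetilde v_0\in P^*=\mathrm{Hom}_R(P,R)$ and endomorphisms $m_a\in\mathrm{End}_R(P)$,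 $a\in\Sigma$ (an isomorphism of tuples being an isomorphism of modules that matches the vectors, the covectors and the endomorphisms). The class of $\mathcal F$ corresponds to the class of $(P,v_0,\widetilde v_0,(m_a))$ if and only if there are isomorphisms $\mathcal F(+)\cong P$ and $\mathcal F(-)\cong P^*$ under which, using the structure isomorphisms of $\mathcal F$, - the cap cobordism $(-,+)\to\emptyset$ goes to the evaluation $P^*\otimes P\to R$, $f\otimes x\mapsto f(x)$; - the cup cobordism $\emptyset\to(+,-)$ goes to the coevaluation $R\to P\otimes P^*$, $1\mapsto\sum_{i=1}^k p(e_i)\otimes(e^i\circ\iota)$, for every choice of $k,\iota,p$ as above, where $e_i$ is the standard basis of $R^k$ and $e^i$ its dual basis; - the half-interval $\emptyset\to(+)$ goes to $R\to P$, $1\mapsto v_0$, and the half-interval $(+)\to\emptyset$ goes to $\widetilde v_0:P\to R$; - for every $a\in\Sigma$ the upward-oriented interval $(+)\to(+)$ with one dot labelled $a$ goes to $m_a:P\to P$. -/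

import Mathlib

universe u v

namespace OneCob

open CategoryTheory MonoidalCategory

/-- Orientation of a point. -/
inductive Sgn : Type
  | pos
  | neg

/-- A closed oriented `0`-manifold: a finite set of points, each with a sign. -/
structure ZeroMfd where
  pts : Type
  [fin : Finite pts]
  sign : pts → Sgn

attribute [instance] ZeroMfd.fin

/-- The kinds of vertices in the interior of a cobordism: an unmarked subdivision point, a defect
labelled by an element of `S`, an inner endpoint at which an oriented interval begins, and an
inner endpoint at which an oriented interval ends. -/
inductive Kind (S : Type v) : Type v
  | plain
  | defect (a : S)
  | source
  | sink

/-- Whether a vertex has an outgoing edge. -/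
def Kind.Emits {S : Type v} : Kind S → Prop
  | .sink => False
  | _ => True

/-- Whether a vertex has an incoming edge. -/
def Kind.Absorbs {S : Type v} : Kind S → Prop
  | .source => False
  | _ => True

/-- The vertices of a cobordism with interior vertices `V`, bottom boundary `X` and top
boundary `Y`. -/
inductive Node (V X Y : Type) : Type
  | inner (v : V)
  | bot (x : X)
  | top (y : Y)

/-- A sign-preserving bijection of closed oriented `0`-manifolds. -/
structure SEquiv (X Y : ZeroMfd) where
  equiv : X.pts ≃ Y.pts
  sign_eq : ∀ x, Y.sign (equiv x) = X.sign x

namespace SEquiv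

variable {X Y Z X' Y' : ZeroMfd}

def refl (X : ZeroMfd) : SEquiv X X := ⟨Equiv.refl _, fun _ => rfl⟩

def symm (f : SEquiv X Y) : SEquiv Y X :=
  ⟨f.equiv.symm, fun y => by rw [← f.sign_eq, Equiv.apply_symm_apply]⟩

def trans (f : SEquiv X Y) (g : SEquiv Y Z) : SEquiv X Z :=
  ⟨f.equiv.trans g.equiv, fun x => by simp [g.sign_eq, f.sign_eq]⟩

@[ext] theorem ext {f g : SEquiv X Y} (h : ∀ x, f.equiv x = g.equiv x) : f = g := by
  rcases f with ⟨f, hf⟩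
  rcases g with ⟨g, hg⟩
  obtain rfl : f = g := Equiv.ext h
  rfl

end SEquiv

namespace Node

/-- Apply maps to the three classes of vertices. -/
def map {V X Y V' X' Y' : Type} (f : V → V') (g : X → X') (h : Y → Y') :
    Node V X Y → Node V' X' Y'
  | inner v => inner (f v)
  | bot x => bot (g x)
  | top y => top (h y)

@[simp] theorem map_inner {V X Y V' X' Y' : Type} (f : V → V') (g : X → X') (h : Y → Y') (v : V) :
    (inner v : Node V X Y).map f g h = inner (f v) := rfl
@[simp] theorem map_bot {V X Y V' X' Y' : Type} (f : V → V') (g : X → X') (h : Y → Y') (x : X) :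
    (bot x : Node V X Y).map f g h = bot (g x) := rfl
@[simp] theorem map_top {V X Y V' X' Y' : Type} (f : V → V') (g : X → X') (h : Y → Y') (y : Y) :
    (top y : Node V X Y).map f g h = top (h y) := rfl

@[simp] theorem map_map {V X Y V' X' Y' V'' X'' Y'' : Type} (f : V → V') (g : X → X') (h : Y → Y')
    (f' : V' → V'') (g' : X' → X'') (h' : Y' → Y'') (n : Node V X Y) :
    (n.map f g h).map f' g' h' = n.map (f' ∘ f) (g' ∘ g) (h' ∘ h) := by
  cases n <;> rfl

@[simp] theorem map_id {V X Y : Type} (n : Node V X Y) : n.map id id id = n := by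
  cases n <;> rfl

@[simp] theorem map_eq_inner {V X Y V' X' Y' : Type} (f : V → V') (g : X → X') (h : Y → Y')
    (n : Node V X Y) (v : V') : n.map f g h = inner v ↔ ∃ w, n = inner w ∧ f w = v := by
  cases n <;> simp
@[simp] theorem map_eq_bot {V X Y V' X' Y' : Type} (f : V → V') (g : X → X') (h : Y → Y')
    (n : Node V X Y) (v : X') : n.map f g h = bot v ↔ ∃ w, n = bot w ∧ g w = v := by
  cases n <;> simp
@[simp] theorem map_eq_top {V X Y V' X' Y' : Type} (f : V → V') (g : X → X') (h : Y → Y')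
    (n : Node V X Y) (v : Y') : n.map f g h = top v ↔ ∃ w, n = top w ∧ h w = v := by
  cases n <;> simp

theorem map_injective {V X Y V' X' Y' : Type} {f : V → V'} {g : X → X'} {h : Y → Y'}
    (hf : Function.Injective f) (hg : Function.Injective g) (hh : Function.Injective h) :
    Function.Injective (map f g h) := by
  rintro (_ | _ | _) (_ | _ | _) e <;> simp_all [hf.eq_iff, hg.eq_iff, hh.eq_iff]

/-- A vertex emits an edge if an oriented strand leaves it. At the bottom boundary this happens at
the positive points, at the top boundary at the negative points. -/
def Emits {S : Type v} {V : Type} {X Y : ZeroMfd} (kind : V → Kind S) :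
    Node V X.pts Y.pts → Prop
  | inner v => (kind v).Emits
  | bot x => X.sign x = Sgn.pos
  | top y => Y.sign y = Sgn.neg

/-- A vertex absorbs an edge if an oriented strand arrives at it. At the bottom boundary this
happens at the negative points, at the top boundary at the positive points. -/
def Absorbs {S : Type v} {V : Type} {X Y : ZeroMfd} (kind : V → Kind S) :
    Node V X.pts Y.pts → Prop
  | inner v => (kind v).Absorbs
  | bot x => X.sign x = Sgn.neg
  | top y => Y.sign y = Sgn.pos

section
variable {S : Type v} {V : Type} {X Y : ZeroMfd} (kind : V → Kind S)

@[simp] theorem emits_inner (v : V) :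
    Emits (X := X) (Y := Y) kind (inner v) ↔ (kind v).Emits := Iff.rfl
@[simp] theorem emits_bot (x : X.pts) :
    Emits (X := X) (Y := Y) kind (bot x) ↔ X.sign x = Sgn.pos := Iff.rfl
@[simp] theorem emits_top (y : Y.pts) :
    Emits (X := X) (Y := Y) kind (top y) ↔ Y.sign y = Sgn.neg := Iff.rfl
@[simp] theorem absorbs_inner (v : V) :
    Absorbs (X := X) (Y := Y) kind (inner v) ↔ (kind v).Absorbs := Iff.rfl
@[simp] theorem absorbs_bot (x : X.pts) :
    Absorbs (X := X) (Y := Y) kind (bot x) ↔ X.sign x = Sgn.neg := Iff.rfl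
@[simp] theorem absorbs_top (y : Y.pts) :
    Absorbs (X := X) (Y := Y) kind (top y) ↔ Y.sign y = Sgn.pos := Iff.rfl

end

/-- The initial vertex of a vertical strand from `x` to `y`: it is oriented upwards when the sign
is positive and downwards when the sign is negative. -/
def strandSrc {V X Y : Type} (s : Sgn) (x : X) (y : Y) : Node V X Y :=
  match s with
  | .pos => bot x
  | .neg => top y

/-- The terminal vertex of a vertical strand from `x` to `y`. -/
def strandTgt {V X Y : Type} (s : Sgn) (x : X) (y : Y) : Node V X Y :=
  match s with
  | .pos => top y
  | .neg => bot x

end Node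

/-- A compact oriented `1`-manifold with `S`-labelled defects and inner endpoints, bounding `X`
at the bottom and `Y` at the top, given by a finite oriented cell decomposition: finite sets `V`
of interior vertices and `E` of oriented edges, such that every vertex is the initial vertex of
exactly one edge or of none, and the terminal vertex of exactly one edge or of none, as its kind
and its sign prescribe. -/
structure Pre (S : Type v) (X Y : ZeroMfd) : Type (max 1 v) where
  V : Type
  E : Type
  [finV : Finite V]
  [finE : Finite E]
  kind : V → Kind S
  src : E → Node V X.pts Y.pts
  tgt : E → Node V X.pts Y.pts
  src_inj : Function.Injective src
  tgt_inj : Function.Injective tgt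
  src_iff : ∀ p, (∃ e, src e = p) ↔ p.Emits kind
  tgt_iff : ∀ p, (∃ e, tgt e = p) ↔ p.Absorbs kind

attribute [instance] Pre.finV Pre.finE

namespace Pre

variable {S : Type v} {X Y Z W X' Y' Z' : ZeroMfd}

/-- Isomorphism of cell decompositions, relative to the boundary. -/
def Iso (c d : Pre S X Y) : Prop :=
  ∃ (φ : c.V ≃ d.V) (ψ : c.E ≃ d.E), (∀ v, d.kind (φ v) = c.kind v) ∧
    (∀ e, d.src (ψ e) = (c.src e).map φ id id) ∧ (∀ e, d.tgt (ψ e) = (c.tgt e).map φ id id)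

open Classical in
/-- Subdivide the edge `e₀` by an unmarked vertex in its interior. The old edge keeps its
beginning and now ends at the new vertex; the new edge runs from the new vertex to the old end. -/
noncomputable def subdivide (c : Pre S X Y) (e₀ : c.E) : Pre S X Y where
  V := Option c.V
  E := Option c.E
  kind v := v.elim Kind.plain c.kind
  src e := e.elim (Node.inner none) fun e => (c.src e).map some id id
  tgt e := e.elim ((c.tgt e₀).map some id id) fun e =>
    if e = e₀ then Node.inner none else (c.tgt e).map some id id
  src_inj := by
    have h : Function.Injective (Node.map (X := X.pts) (Y := Y.pts) (some : c.V → _) id id) :=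
      Node.map_injective (Option.some_injective _) Function.injective_id Function.injective_id
    rintro (_ | e) (_ | e') H
    · rfl
    · simp [eq_comm (a := Node.inner _)] at H
    · simp at H
    · exact congrArg some (c.src_inj (h H))
  tgt_inj := by
    have h : Function.Injective (Node.map (X := X.pts) (Y := Y.pts) (some : c.V → _) id id) :=
      Node.map_injective (Option.some_injective _) Function.injective_id Function.injective_id
    rintro (_ | e) (_ | e') H
    · rfl
    · by_cases he : e' = e₀
      · simp [he] at H
      · simp only [Option.elim, he, if_false] at H
        exact absurd (c.tgt_inj (h H)).symm he
    · by_cases he : e = e₀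
      · simp [he, eq_comm (a := Node.inner _)] at H
      · simp only [Option.elim, he, if_false] at H
        exact absurd (c.tgt_inj (h H)) he
    · by_cases he : e = e₀ <;> by_cases he' : e' = e₀
      · rw [he, he']
      · simp [he, he', eq_comm (a := Node.inner _)] at H
      · simp [he, he'] at H
      · simp only [Option.elim, he, he', if_false] at H
        exact congrArg some (c.tgt_inj (h H))
  src_iff := by
    have h := c.src_iff
    rintro ((_ | v) | x | y)
    · simp [Option.exists, Kind.Emits]
    · simpa [Option.exists] using h (.inner v)
    · simpa [Option.exists] using h (.bot x)
    · simpa [Option.exists] using h (.top y)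
  tgt_iff := by
    have h := c.tgt_iff
    have key : ∀ q : Node (Option c.V) X.pts Y.pts, q ≠ Node.inner none →
        ((∃ e : Option c.E, (e.elim ((c.tgt e₀).map some id id) fun e =>
          if e = e₀ then Node.inner none else (c.tgt e).map some id id) = q) ↔
          ∃ e, (c.tgt e).map some id id = q) := by
      intro q hq
      constructor
      · rintro ⟨_ | e, he⟩
        · exact ⟨e₀, he⟩
        · by_cases h0 : e = e₀
          · simp only [Option.elim, h0, if_true] at he
            exact absurd he.symm hq
          · simp only [Option.elim, h0, if_false] at he
            exact ⟨e, he⟩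
      · rintro ⟨e, he⟩
        by_cases h0 : e = e₀
        · exact ⟨none, by simpa [← h0] using he⟩
        · exact ⟨some e, by simpa [h0] using he⟩
    rintro ((_ | v) | x | y)
    · simp only [Node.absorbs_inner, Option.elim, Kind.Absorbs, iff_true]
      exact ⟨some e₀, by simp⟩
    · rw [key _ (by simp)]
      simpa using h (.inner v)
    · rw [key _ (by simp)]
      simpa using h (.bot x)
    · rw [key _ (by simp)]
      simpa using h (.top y)

/-- Two cell decompositions present the same cobordism when they are related by isomorphisms and
subdivisions. -/
inductive Rel : Pre S X Y → Pre S X Y → Prop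
  | iso {c d : Pre S X Y} : Iso c d → Rel c d
  | subdivide (c : Pre S X Y) (e : c.E) : Rel (c.subdivide e) c

/-- The vertices of the lower cobordism, inside a composite. -/
def lower {V V' X Y Z : Type} : Node V X Y → Node (V ⊕ V' ⊕ Y) X Z
  | .inner v => .inner (.inl v)
  | .bot x => .bot x
  | .top y => .inner (.inr (.inr y))

/-- The vertices of the upper cobordism, inside a composite. -/
def upper {V V' X Y Z : Type} : Node V' Y Z → Node (V ⊕ V' ⊕ Y) X Z
  | .inner v => .inner (.inr (.inl v))
  | .bot y => .inner (.inr (.inr y))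
  | .top z => .top z

section
variable {A A' B C D : Type}

@[simp] theorem lower_inner (v : A) :
    (lower (.inner v) : Node (A ⊕ A' ⊕ C) B D) = .inner (.inl v) := rfl
@[simp] theorem lower_bot (x : B) : (lower (.bot x) : Node (A ⊕ A' ⊕ C) B D) = .bot x := rfl
@[simp] theorem lower_top (y : C) :
    (lower (.top y) : Node (A ⊕ A' ⊕ C) B D) = .inner (.inr (.inr y)) := rfl
@[simp] theorem upper_inner (v : A') :
    (upper (.inner v) : Node (A ⊕ A' ⊕ C) B D) = .inner (.inr (.inl v)) := rfl
@[simp] theorem upper_bot (y : C) :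
    (upper (.bot y) : Node (A ⊕ A' ⊕ C) B D) = .inner (.inr (.inr y)) := rfl
@[simp] theorem upper_top (z : D) : (upper (.top z) : Node (A ⊕ A' ⊕ C) B D) = .top z := rfl

theorem lower_injective :
    Function.Injective (lower : Node A B C → Node (A ⊕ A' ⊕ C) B D) := by
  rintro (_ | _ | _) (_ | _ | _) h <;> simp_all [lower]

theorem upper_injective :
    Function.Injective (upper : Node A' C D → Node (A ⊕ A' ⊕ C) B D) := by
  rintro (_ | _ | _) (_ | _ | _) h <;> simp_all [upper]

theorem lower_eq_upper {n : Node A B C} {m : Node A' C D}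
    (h : (lower n : Node (A ⊕ A' ⊕ C) B D) = upper m) : ∃ y, n = .top y ∧ m = .bot y := by
  rcases n with _ | _ | y <;> rcases m with _ | y' | _ <;> simp_all

@[simp] theorem lower_eq_inl (n : Node A B C) (v : A) :
    (lower n : Node (A ⊕ A' ⊕ C) B D) = .inner (.inl v) ↔ n = .inner v := by
  cases n <;> simp
@[simp] theorem lower_eq_inr_inl (n : Node A B C) (v : A') :
    (lower n : Node (A ⊕ A' ⊕ C) B D) = .inner (.inr (.inl v)) ↔ False := by
  cases n <;> simp
@[simp] theorem lower_eq_inr_inr (n : Node A B C) (y : C) :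
    (lower n : Node (A ⊕ A' ⊕ C) B D) = .inner (.inr (.inr y)) ↔ n = .top y := by
  cases n <;> simp
@[simp] theorem lower_eq_bot (n : Node A B C) (x : B) :
    (lower n : Node (A ⊕ A' ⊕ C) B D) = .bot x ↔ n = .bot x := by
  cases n <;> simp
@[simp] theorem lower_eq_top (n : Node A B C) (z : D) :
    (lower n : Node (A ⊕ A' ⊕ C) B D) = .top z ↔ False := by
  cases n <;> simp
@[simp] theorem upper_eq_inl (n : Node A' C D) (v : A) :
    (upper n : Node (A ⊕ A' ⊕ C) B D) = .inner (.inl v) ↔ False := by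
  cases n <;> simp
@[simp] theorem upper_eq_inr_inl (n : Node A' C D) (v : A') :
    (upper n : Node (A ⊕ A' ⊕ C) B D) = .inner (.inr (.inl v)) ↔ n = .inner v := by
  cases n <;> simp
@[simp] theorem upper_eq_inr_inr (n : Node A' C D) (y : C) :
    (upper n : Node (A ⊕ A' ⊕ C) B D) = .inner (.inr (.inr y)) ↔ n = .bot y := by
  cases n <;> simp
@[simp] theorem upper_eq_bot (n : Node A' C D) (x : B) :
    (upper n : Node (A ⊕ A' ⊕ C) B D) = .bot x ↔ False := by
  cases n <;> simp
@[simp] theorem upper_eq_top (n : Node A' C D) (z : D) :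
    (upper n : Node (A ⊕ A' ⊕ C) B D) = .top z ↔ n = .top z := by
  cases n <;> simp

end

/-- Composition: glue the top boundary of `c` to the bottom boundary of `d`; the points that were
glued become unmarked interior vertices. -/
def comp (c : Pre S X Y) (d : Pre S Y Z) : Pre S X Z where
  V := c.V ⊕ d.V ⊕ Y.pts
  E := c.E ⊕ d.E
  kind := Sum.elim c.kind (Sum.elim d.kind fun _ => Kind.plain)
  src := Sum.elim (fun e => lower (c.src e)) fun e => upper (d.src e)
  tgt := Sum.elim (fun e => lower (c.tgt e)) fun e => upper (d.tgt e)
  src_inj := by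
    rintro (e | e) (e' | e') H
    · exact congrArg Sum.inl (c.src_inj (lower_injective H))
    · obtain ⟨y, h1, h2⟩ := lower_eq_upper H
      have h3 := (c.src_iff _).1 ⟨e, h1⟩
      have h4 := (d.src_iff _).1 ⟨e', h2⟩
      simp_all
    · obtain ⟨y, h1, h2⟩ := lower_eq_upper H.symm
      have h3 := (c.src_iff _).1 ⟨e', h1⟩
      have h4 := (d.src_iff _).1 ⟨e, h2⟩
      simp_all
    · exact congrArg Sum.inr (d.src_inj (upper_injective H))
  tgt_inj := by
    rintro (e | e) (e' | e') H
    · exact congrArg Sum.inl (c.tgt_inj (lower_injective H))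
    · obtain ⟨y, h1, h2⟩ := lower_eq_upper H
      have h3 := (c.tgt_iff _).1 ⟨e, h1⟩
      have h4 := (d.tgt_iff _).1 ⟨e', h2⟩
      simp_all
    · obtain ⟨y, h1, h2⟩ := lower_eq_upper H.symm
      have h3 := (c.tgt_iff _).1 ⟨e', h1⟩
      have h4 := (d.tgt_iff _).1 ⟨e, h2⟩
      simp_all
    · exact congrArg Sum.inr (d.tgt_inj (upper_injective H))
  src_iff := by
    have h := c.src_iff
    have h' := d.src_iff
    rintro ((v | v | y) | x | z)
    · simpa using h (.inner v)
    · simpa using h' (.inner v)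
    · have h1 := h (.top y)
      have h2 := h' (.bot y)
      cases hs : Y.sign y <;> simp_all [Kind.Emits]
    · simpa using h (.bot x)
    · simpa using h' (.top z)
  tgt_iff := by
    have h := c.tgt_iff
    have h' := d.tgt_iff
    rintro ((v | v | y) | x | z)
    · simpa using h (.inner v)
    · simpa using h' (.inner v)
    · have h1 := h (.top y)
      have h2 := h' (.bot y)
      cases hs : Y.sign y <;> simp_all [Kind.Absorbs]
    · simpa using h (.bot x)
    · simpa using h' (.top z)


/-- Transport the boundary of a cobordism along sign-preserving bijections. -/
def relabel (c : Pre S X Y) (f : SEquiv X X') (g : SEquiv Y Y') : Pre S X' Y' where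
  V := c.V
  E := c.E
  kind := c.kind
  src e := (c.src e).map id f.equiv g.equiv
  tgt e := (c.tgt e).map id f.equiv g.equiv
  src_inj := (Node.map_injective Function.injective_id f.equiv.injective
    g.equiv.injective).comp c.src_inj
  tgt_inj := (Node.map_injective Function.injective_id f.equiv.injective
    g.equiv.injective).comp c.tgt_inj
  src_iff := by
    have h := c.src_iff
    rintro (v | x | y)
    · simpa using h (.inner v)
    · obtain ⟨x, rfl⟩ := f.equiv.surjective x
      simpa [f.sign_eq] using h (.bot x)
    · obtain ⟨y, rfl⟩ := g.equiv.surjective y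
      simpa [g.sign_eq] using h (.top y)
  tgt_iff := by
    have h := c.tgt_iff
    rintro (v | x | y)
    · simpa using h (.inner v)
    · obtain ⟨x, rfl⟩ := f.equiv.surjective x
      simpa [f.sign_eq] using h (.bot x)
    · obtain ⟨y, rfl⟩ := g.equiv.surjective y
      simpa [g.sign_eq] using h (.top y)

/-- The permutation cobordism of a sign-preserving bijection: vertical strands from `x` at the
bottom to `f x` at the top. -/
def perm (S : Type v) (f : SEquiv X Y) : Pre S X Y where
  V := Empty
  E := X.pts
  kind v := v.elim
  src x := Node.strandSrc (X.sign x) x (f.equiv x)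
  tgt x := Node.strandTgt (X.sign x) x (f.equiv x)
  src_inj := by
    intro x x' H
    cases h : X.sign x <;> cases h' : X.sign x' <;> simp_all [Node.strandSrc]
  tgt_inj := by
    intro x x' H
    cases h : X.sign x <;> cases h' : X.sign x' <;> simp_all [Node.strandTgt]
  src_iff := by
    rintro (v | x | y)
    · exact v.elim
    · constructor
      · rintro ⟨x', H⟩
        cases h : X.sign x' <;> simp_all [Node.strandSrc]
      · intro H
        exact ⟨x, by simp_all [Node.strandSrc]⟩
    · obtain ⟨y, rfl⟩ := f.equiv.surjective y
      constructor
      · rintro ⟨x', H⟩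
        cases h : X.sign x' <;> simp_all [Node.strandSrc, f.sign_eq]
      · intro H
        exact ⟨y, by simp_all [Node.strandSrc, f.sign_eq]⟩
  tgt_iff := by
    rintro (v | x | y)
    · exact v.elim
    · constructor
      · rintro ⟨x', H⟩
        cases h : X.sign x' <;> simp_all [Node.strandTgt]
      · intro H
        exact ⟨x, by simp_all [Node.strandTgt]⟩
    · obtain ⟨y, rfl⟩ := f.equiv.surjective y
      constructor
      · rintro ⟨x', H⟩
        cases h : X.sign x' <;> simp_all [Node.strandTgt, f.sign_eq]
      · intro H
        exact ⟨y, by simp_all [Node.strandTgt, f.sign_eq]⟩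

end Pre

/-- Disjoint union of `0`-manifolds. -/
abbrev ZeroMfd.sum (X Y : ZeroMfd) : ZeroMfd := ⟨X.pts ⊕ Y.pts, Sum.elim X.sign Y.sign⟩

/-- The empty `0`-manifold. -/
abbrev ZeroMfd.empty : ZeroMfd := ⟨Empty, fun e => e.elim⟩

namespace SEquiv

variable (X Y Z : ZeroMfd) {X₁ X₂ Y₁ Y₂ : ZeroMfd}

def sum (f : SEquiv X₁ Y₁) (g : SEquiv X₂ Y₂) : SEquiv (X₁.sum X₂) (Y₁.sum Y₂) :=
  ⟨Equiv.sumCongr f.equiv g.equiv, by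
    rintro (x | x)
    · exact f.sign_eq x
    · exact g.sign_eq x⟩

def assoc : SEquiv ((X.sum Y).sum Z) (X.sum (Y.sum Z)) :=
  ⟨Equiv.sumAssoc _ _ _, by rintro ((_ | _) | _) <;> rfl⟩

def emptySum : SEquiv (ZeroMfd.empty.sum X) X :=
  ⟨Equiv.emptySum Empty _, by rintro (x | _) <;> [exact x.elim; rfl]⟩

def sumEmpty : SEquiv (X.sum ZeroMfd.empty) X :=
  ⟨Equiv.sumEmpty _ Empty, by rintro (_ | x) <;> [rfl; exact x.elim]⟩

def swap : SEquiv (X.sum Y) (Y.sum X) :=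
  ⟨Equiv.sumComm _ _, by rintro (_ | _) <;> rfl⟩

end SEquiv

namespace Pre

variable {S : Type v} {X Y Z W X' Y' Z' : ZeroMfd}

/-- Disjoint union of cobordisms. -/
def tensor (c : Pre S X Y) (d : Pre S X' Y') : Pre S (X.sum X') (Y.sum Y') where
  V := c.V ⊕ d.V
  E := c.E ⊕ d.E
  kind := Sum.elim c.kind d.kind
  src := Sum.elim (fun e => (c.src e).map .inl .inl .inl) fun e => (d.src e).map .inr .inr .inr
  tgt := Sum.elim (fun e => (c.tgt e).map .inl .inl .inl) fun e => (d.tgt e).map .inr .inr .inr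
  src_inj := by
    rintro (e | e) (e' | e') H
    · exact congrArg Sum.inl (c.src_inj
        (Node.map_injective Sum.inl_injective Sum.inl_injective Sum.inl_injective H))
    · revert H
      simp only [Sum.elim_inl, Sum.elim_inr]
      cases c.src e <;> cases d.src e' <;> simp
    · revert H
      simp only [Sum.elim_inl, Sum.elim_inr]
      cases d.src e <;> cases c.src e' <;> simp
    · exact congrArg Sum.inr (d.src_inj
        (Node.map_injective Sum.inr_injective Sum.inr_injective Sum.inr_injective H))
  tgt_inj := by
    rintro (e | e) (e' | e') H
    · exact congrArg Sum.inl (c.tgt_inj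
        (Node.map_injective Sum.inl_injective Sum.inl_injective Sum.inl_injective H))
    · revert H
      simp only [Sum.elim_inl, Sum.elim_inr]
      cases c.tgt e <;> cases d.tgt e' <;> simp
    · revert H
      simp only [Sum.elim_inl, Sum.elim_inr]
      cases d.tgt e <;> cases c.tgt e' <;> simp
    · exact congrArg Sum.inr (d.tgt_inj
        (Node.map_injective Sum.inr_injective Sum.inr_injective Sum.inr_injective H))
  src_iff := by
    have h := c.src_iff
    have h' := d.src_iff
    rintro ((v | v) | (x | x) | (y | y))
    · exact Iff.trans (by simp) (h (.inner v))
    · exact Iff.trans (by simp) (h' (.inner v))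
    · exact Iff.trans (by simp) (h (.bot x))
    · exact Iff.trans (by simp) (h' (.bot x))
    · exact Iff.trans (by simp) (h (.top y))
    · exact Iff.trans (by simp) (h' (.top y))
  tgt_iff := by
    have h := c.tgt_iff
    have h' := d.tgt_iff
    rintro ((v | v) | (x | x) | (y | y))
    · exact Iff.trans (by simp) (h (.inner v))
    · exact Iff.trans (by simp) (h' (.inner v))
    · exact Iff.trans (by simp) (h (.bot x))
    · exact Iff.trans (by simp) (h' (.bot x))
    · exact Iff.trans (by simp) (h (.top y))
    · exact Iff.trans (by simp) (h' (.top y))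

end Pre

/-- Cobordisms from `X` to `Y`: compact oriented `1`-manifolds with defects and inner endpoints, up
to homeomorphism relative to the boundary, that is, cell decompositions up to isomorphism and
subdivision. -/
def Hom (S : Type v) (X Y : ZeroMfd) : Type (max 1 v) :=
  Quot (Pre.Rel (S := S) (X := X) (Y := Y))

/-- The added element of the left summand, as an element added to the sum. -/
def optSumLeft (A B : Type) : Option A ⊕ B ≃ Option (A ⊕ B) where
  toFun
    | .inl none => none
    | .inl (some a) => some (.inl a)
    | .inr b => some (.inr b)
  invFun
    | none => .inl none
    | some (.inl a) => .inl (some a)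
    | some (.inr b) => .inr b
  left_inv := by rintro ((_ | _) | _) <;> rfl
  right_inv := by rintro (_ | (_ | _)) <;> rfl

/-- The added element of the right summand, as an element added to the sum. -/
def optSumRight (A B : Type) : A ⊕ Option B ≃ Option (A ⊕ B) where
  toFun
    | .inl a => some (.inl a)
    | .inr none => none
    | .inr (some b) => some (.inr b)
  invFun
    | none => .inr none
    | some (.inl a) => .inl a
    | some (.inr b) => .inr (some b)
  left_inv := by rintro (_ | (_ | _)) <;> rfl
  right_inv := by rintro (_ | (_ | _)) <;> rfl

namespace Pre

variable {S : Type v} {X Y Z W X' Y' Z' : ZeroMfd}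

/-- The cobordism presented by a cell decomposition. -/
def toHom (c : Pre S X Y) : Hom S X Y := Quot.mk _ c

theorem Iso.toHom_eq {c d : Pre S X Y} (h : Iso c d) : c.toHom = d.toHom :=
  Quot.sound (.iso h)

theorem subdivide_toHom (c : Pre S X Y) (e : c.E) : (c.subdivide e).toHom = c.toHom :=
  Quot.sound (.subdivide c e)

theorem subdivide_tgt_self (c : Pre S X Y) (e : c.E) :
    (c.subdivide e).tgt (some e) = Node.inner none := if_pos rfl

theorem subdivide_tgt_of_ne (c : Pre S X Y) {e e₀ : c.E} (h : e ≠ e₀) :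
    (c.subdivide e₀).tgt (some e) = (c.tgt e).map some id id := if_neg h

theorem Iso.refl (c : Pre S X Y) : Iso c c :=
  ⟨Equiv.refl _, Equiv.refl _, fun _ => rfl, fun e => by cases h : c.src e <;> simp [h],
    fun e => by cases h : c.tgt e <;> simp [h]⟩

theorem lower_map {A A' B C D A₁ A₁' : Type} (f : A → A₁) (f' : A' → A₁') (n : Node A B C) :
    (lower (n.map f id id) : Node (A₁ ⊕ A₁' ⊕ C) B D) =
      (lower n : Node (A ⊕ A' ⊕ C) B D).map (Sum.map f (Sum.map f' id)) id id := by
  cases n <;> rfl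

theorem upper_map {A A' B C D A₁ A₁' : Type} (f : A → A₁) (f' : A' → A₁') (n : Node A' C D) :
    (upper (n.map f' id id) : Node (A₁ ⊕ A₁' ⊕ C) B D) =
      (upper n : Node (A ⊕ A' ⊕ C) B D).map (Sum.map f (Sum.map f' id)) id id := by
  cases n <;> rfl

theorem comp_iso {c c' : Pre S X Y} {d d' : Pre S Y Z} (h : Iso c c') (h' : Iso d d') :
    Iso (c.comp d) (c'.comp d') := by
  obtain ⟨φ, ψ, hk, hs, ht⟩ := h
  obtain ⟨φ', ψ', hk', hs', ht'⟩ := h'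
  refine ⟨Equiv.sumCongr φ (Equiv.sumCongr φ' (Equiv.refl _)), Equiv.sumCongr ψ ψ', ?_, ?_, ?_⟩
  · rintro (v | v | y)
    · exact hk v
    · exact hk' v
    · rfl
  · rintro (e | e)
    · exact (congrArg lower (hs e)).trans (lower_map φ φ' _)
    · exact (congrArg upper (hs' e)).trans (upper_map φ φ' _)
  · rintro (e | e)
    · exact (congrArg lower (ht e)).trans (lower_map φ φ' _)
    · exact (congrArg upper (ht' e)).trans (upper_map φ φ' _)

theorem comp_subdivide_left (c : Pre S X Y) (e₀ : c.E) (d : Pre S Y Z) :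
    Iso ((c.subdivide e₀).comp d) ((c.comp d).subdivide (.inl e₀)) := by
  let φ := optSumLeft c.V (d.V ⊕ Y.pts)
  have k₁ : ∀ n : Node c.V X.pts Y.pts, (lower n : Node (c.V ⊕ d.V ⊕ Y.pts) X.pts Z.pts).map some id id =
      (lower (n.map some id id) : Node (Option c.V ⊕ d.V ⊕ Y.pts) X.pts Z.pts).map φ id id := by
    rintro (_ | _ | _) <;> rfl
  have k₂ : ∀ n : Node d.V Y.pts Z.pts, (upper n : Node (c.V ⊕ d.V ⊕ Y.pts) X.pts Z.pts).map some id id =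
      (upper n : Node (Option c.V ⊕ d.V ⊕ Y.pts) X.pts Z.pts).map φ id id := by
    rintro (_ | _ | _) <;> rfl
  refine ⟨φ, optSumLeft _ _, ?_, ?_, ?_⟩
  · rintro ((_ | v) | v | y) <;> rfl
  · rintro ((_ | e) | e)
    · rfl
    · exact k₁ (c.src e)
    · exact k₂ (d.src e)
  · rintro ((_ | e) | e)
    · exact k₁ (c.tgt e₀)
    · by_cases h : e = e₀
      · subst h
        exact (subdivide_tgt_self (c.comp d) (.inl e)).trans
          (congrArg (fun n => (lower n : Node (Option c.V ⊕ d.V ⊕ Y.pts) X.pts Z.pts).map φ id id)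
            (subdivide_tgt_self c e)).symm
      · exact (subdivide_tgt_of_ne (c.comp d) (fun H => h (Sum.inl_injective H))).trans
          ((k₁ (c.tgt e)).trans (congrArg (fun n => (lower n : Node (Option c.V ⊕ d.V ⊕ Y.pts) X.pts Z.pts).map φ id id)
            (subdivide_tgt_of_ne c h)).symm)
    · exact (subdivide_tgt_of_ne (c.comp d) Sum.inr_ne_inl).trans (k₂ (d.tgt e))

theorem comp_subdivide_right (c : Pre S X Y) (d : Pre S Y Z) (e₀ : d.E) :
    Iso (c.comp (d.subdivide e₀)) ((c.comp d).subdivide (.inr e₀)) := by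
  let φ := (Equiv.sumCongr (Equiv.refl c.V) (optSumLeft d.V Y.pts)).trans
    (optSumRight c.V (d.V ⊕ Y.pts))
  have k₁ : ∀ n : Node d.V Y.pts Z.pts, (upper n : Node (c.V ⊕ d.V ⊕ Y.pts) X.pts Z.pts).map some id id =
      (upper (n.map some id id) : Node (c.V ⊕ Option d.V ⊕ Y.pts) X.pts Z.pts).map φ id id := by
    rintro (_ | _ | _) <;> rfl
  have k₂ : ∀ n : Node c.V X.pts Y.pts, (lower n : Node (c.V ⊕ d.V ⊕ Y.pts) X.pts Z.pts).map some id id =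
      (lower n : Node (c.V ⊕ Option d.V ⊕ Y.pts) X.pts Z.pts).map φ id id := by
    rintro (_ | _ | _) <;> rfl
  refine ⟨φ, optSumRight _ _, ?_, ?_, ?_⟩
  · rintro (v | (_ | v) | y) <;> rfl
  · rintro (e | (_ | e))
    · exact k₂ (c.src e)
    · rfl
    · exact k₁ (d.src e)
  · rintro (e | (_ | e))
    · exact (subdivide_tgt_of_ne (c.comp d) Sum.inl_ne_inr).trans (k₂ (c.tgt e))
    · exact k₁ (d.tgt e₀)
    · by_cases h : e = e₀
      · subst h
        exact (subdivide_tgt_self (c.comp d) (.inr e)).trans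
          (congrArg (fun n => (upper n : Node (c.V ⊕ Option d.V ⊕ Y.pts) X.pts Z.pts).map φ id id)
            (subdivide_tgt_self d e)).symm
      · exact (subdivide_tgt_of_ne (c.comp d) (fun H => h (Sum.inr_injective H))).trans
          ((k₁ (d.tgt e)).trans (congrArg (fun n => (upper n : Node (c.V ⊕ Option d.V ⊕ Y.pts) X.pts Z.pts).map φ id id)
            (subdivide_tgt_of_ne d h)).symm)

theorem comp_congr_left {c c' : Pre S X Y} (h : Rel c c') (d : Pre S Y Z) :
    (c.comp d).toHom = (c'.comp d).toHom := by
  cases h with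
  | iso h => exact (comp_iso h (Iso.refl d)).toHom_eq
  | subdivide _ e => exact (comp_subdivide_left _ e d).toHom_eq.trans (subdivide_toHom _ _)

theorem comp_congr_right (c : Pre S X Y) {d d' : Pre S Y Z} (h : Rel d d') :
    (c.comp d).toHom = (c.comp d').toHom := by
  cases h with
  | iso h => exact (comp_iso (Iso.refl c) h).toHom_eq
  | subdivide _ e => exact (comp_subdivide_right c _ e).toHom_eq.trans (subdivide_toHom _ _)

theorem relabel_congr {c c' : Pre S X Y} (h : Rel c c') (f : SEquiv X X') (g : SEquiv Y Y') :
    (c.relabel f g).toHom = (c'.relabel f g).toHom := by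
  cases h with
  | iso h =>
    obtain ⟨φ, ψ, hk, hs, ht⟩ := h
    have k : ∀ n : Node c.V X.pts Y.pts, (n.map φ id id).map id f.equiv g.equiv =
        (n.map id f.equiv g.equiv).map φ id id := by
      rintro (_ | _ | _) <;> rfl
    exact Iso.toHom_eq ⟨φ, ψ, hk,
      fun e => (congrArg (Node.map id f.equiv g.equiv) (hs e)).trans (k _),
      fun e => (congrArg (Node.map id f.equiv g.equiv) (ht e)).trans (k _)⟩
  | subdivide _ e₀ =>
    have k : ∀ n : Node c'.V X.pts Y.pts, (n.map id f.equiv g.equiv).map some id id =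
        ((n.map some id id).map id f.equiv g.equiv).map (Equiv.refl _) id id := by
      rintro (_ | _ | _) <;> rfl
    suffices key : Iso ((c'.subdivide e₀).relabel f g) ((c'.relabel f g).subdivide e₀) from
      key.toHom_eq.trans (subdivide_toHom (c'.relabel f g) e₀)
    refine ⟨Equiv.refl _, Equiv.refl _, ?_, ?_, ?_⟩
    · rintro (_ | v) <;> rfl
    · rintro (_ | e)
      · rfl
      · exact k (c'.src e)
    · rintro (_ | e)
      · exact k (c'.tgt e₀)
      · by_cases h : e = e₀
        · subst h
          exact (subdivide_tgt_self (c'.relabel f g) e).trans (congrArg (fun n =>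
            (Node.map id f.equiv g.equiv n).map (Equiv.refl _) id id)
              (subdivide_tgt_self c' e)).symm
        · exact (subdivide_tgt_of_ne (c'.relabel f g) h).trans ((k (c'.tgt e)).trans
            (congrArg (fun n => (Node.map id f.equiv g.equiv n).map (Equiv.refl _) id id)
              (subdivide_tgt_of_ne c' h)).symm)

theorem tensor_iso {c c' : Pre S X Y} {d d' : Pre S X' Y'} (h : Iso c c') (h' : Iso d d') :
    Iso (c.tensor d) (c'.tensor d') := by
  obtain ⟨φ, ψ, hk, hs, ht⟩ := h
  obtain ⟨φ', ψ', hk', hs', ht'⟩ := h'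
  have k : ∀ n : Node c.V X.pts Y.pts,
      ((n.map φ id id).map .inl .inl .inl :
        Node (c'.V ⊕ d'.V) (X.pts ⊕ X'.pts) (Y.pts ⊕ Y'.pts)) =
      (n.map .inl .inl .inl : Node (c.V ⊕ d.V) (X.pts ⊕ X'.pts) (Y.pts ⊕ Y'.pts)).map
        (Equiv.sumCongr φ φ') id id := by
    rintro (_ | _ | _) <;> rfl
  have k' : ∀ n : Node d.V X'.pts Y'.pts,
      ((n.map φ' id id).map .inr .inr .inr :
        Node (c'.V ⊕ d'.V) (X.pts ⊕ X'.pts) (Y.pts ⊕ Y'.pts)) =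
      (n.map .inr .inr .inr : Node (c.V ⊕ d.V) (X.pts ⊕ X'.pts) (Y.pts ⊕ Y'.pts)).map
        (Equiv.sumCongr φ φ') id id := by
    rintro (_ | _ | _) <;> rfl
  refine ⟨Equiv.sumCongr φ φ', Equiv.sumCongr ψ ψ', ?_, ?_, ?_⟩
  · rintro (v | v)
    · exact hk v
    · exact hk' v
  · rintro (e | e)
    · exact (congrArg (Node.map Sum.inl Sum.inl Sum.inl) (hs e)).trans (k _)
    · exact (congrArg (Node.map Sum.inr Sum.inr Sum.inr) (hs' e)).trans (k' _)
  · rintro (e | e)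
    · exact (congrArg (Node.map Sum.inl Sum.inl Sum.inl) (ht e)).trans (k _)
    · exact (congrArg (Node.map Sum.inr Sum.inr Sum.inr) (ht' e)).trans (k' _)

theorem tensor_subdivide_left (c : Pre S X Y) (e₀ : c.E) (d : Pre S X' Y') :
    Iso ((c.subdivide e₀).tensor d) ((c.tensor d).subdivide (.inl e₀)) := by
  let φ := optSumLeft c.V d.V
  have k₁ : ∀ n : Node c.V X.pts Y.pts, (Node.map .inl .inl .inl n : Node (c.V ⊕ d.V) (X.pts ⊕ X'.pts) (Y.pts ⊕ Y'.pts)).map some id id =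
      (Node.map .inl .inl .inl (n.map some id id) :
      Node (Option c.V ⊕ d.V) (X.pts ⊕ X'.pts) (Y.pts ⊕ Y'.pts)).map φ id id := by
    rintro (_ | _ | _) <;> rfl
  have k₂ : ∀ n : Node d.V X'.pts Y'.pts, (Node.map .inr .inr .inr n : Node (c.V ⊕ d.V) (X.pts ⊕ X'.pts) (Y.pts ⊕ Y'.pts)).map some id id =
      (Node.map .inr .inr .inr n :
      Node (Option c.V ⊕ d.V) (X.pts ⊕ X'.pts) (Y.pts ⊕ Y'.pts)).map φ id id := by
    rintro (_ | _ | _) <;> rfl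
  refine ⟨φ, optSumLeft _ _, ?_, ?_, ?_⟩
  · rintro ((_ | v) | v) <;> rfl
  · rintro ((_ | e) | e)
    · rfl
    · exact k₁ (c.src e)
    · exact k₂ (d.src e)
  · rintro ((_ | e) | e)
    · exact k₁ (c.tgt e₀)
    · by_cases h : e = e₀
      · subst h
        exact (subdivide_tgt_self (c.tensor d) (.inl e)).trans
          (congrArg (fun n => (Node.map .inl .inl .inl n :
      Node (Option c.V ⊕ d.V) (X.pts ⊕ X'.pts) (Y.pts ⊕ Y'.pts)).map φ id id)
            (subdivide_tgt_self c e)).symm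
      · exact (subdivide_tgt_of_ne (c.tensor d) (fun H => h (Sum.inl_injective H))).trans
          ((k₁ (c.tgt e)).trans (congrArg (fun n => (Node.map .inl .inl .inl n :
      Node (Option c.V ⊕ d.V) (X.pts ⊕ X'.pts) (Y.pts ⊕ Y'.pts)).map φ id id)
            (subdivide_tgt_of_ne c h)).symm)
    · exact (subdivide_tgt_of_ne (c.tensor d) Sum.inr_ne_inl).trans (k₂ (d.tgt e))

theorem tensor_subdivide_right (c : Pre S X Y) (d : Pre S X' Y') (e₀ : d.E) :
    Iso (c.tensor (d.subdivide e₀)) ((c.tensor d).subdivide (.inr e₀)) := by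
  let φ := optSumRight c.V d.V
  have k₁ : ∀ n : Node d.V X'.pts Y'.pts, (Node.map .inr .inr .inr n : Node (c.V ⊕ d.V) (X.pts ⊕ X'.pts) (Y.pts ⊕ Y'.pts)).map some id id =
      (Node.map .inr .inr .inr (n.map some id id) :
      Node (c.V ⊕ Option d.V) (X.pts ⊕ X'.pts) (Y.pts ⊕ Y'.pts)).map φ id id := by
    rintro (_ | _ | _) <;> rfl
  have k₂ : ∀ n : Node c.V X.pts Y.pts, (Node.map .inl .inl .inl n : Node (c.V ⊕ d.V) (X.pts ⊕ X'.pts) (Y.pts ⊕ Y'.pts)).map some id id =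
      (Node.map .inl .inl .inl n :
      Node (c.V ⊕ Option d.V) (X.pts ⊕ X'.pts) (Y.pts ⊕ Y'.pts)).map φ id id := by
    rintro (_ | _ | _) <;> rfl
  refine ⟨φ, optSumRight _ _, ?_, ?_, ?_⟩
  · rintro (v | (_ | v)) <;> rfl
  · rintro (e | (_ | e))
    · exact k₂ (c.src e)
    · rfl
    · exact k₁ (d.src e)
  · rintro (e | (_ | e))
    · exact (subdivide_tgt_of_ne (c.tensor d) Sum.inl_ne_inr).trans (k₂ (c.tgt e))
    · exact k₁ (d.tgt e₀)
    · by_cases h : e = e₀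
      · subst h
        exact (subdivide_tgt_self (c.tensor d) (.inr e)).trans
          (congrArg (fun n => (Node.map .inr .inr .inr n :
      Node (c.V ⊕ Option d.V) (X.pts ⊕ X'.pts) (Y.pts ⊕ Y'.pts)).map φ id id)
            (subdivide_tgt_self d e)).symm
      · exact (subdivide_tgt_of_ne (c.tensor d) (fun H => h (Sum.inr_injective H))).trans
          ((k₁ (d.tgt e)).trans (congrArg (fun n => (Node.map .inr .inr .inr n :
      Node (c.V ⊕ Option d.V) (X.pts ⊕ X'.pts) (Y.pts ⊕ Y'.pts)).map φ id id)
            (subdivide_tgt_of_ne d h)).symm)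

theorem tensor_congr_left {c c' : Pre S X Y} (h : Rel c c') (d : Pre S X' Y') :
    (c.tensor d).toHom = (c'.tensor d).toHom := by
  cases h with
  | iso h => exact (tensor_iso h (Iso.refl d)).toHom_eq
  | subdivide _ e => exact (tensor_subdivide_left _ e d).toHom_eq.trans (subdivide_toHom _ _)

theorem tensor_congr_right (c : Pre S X Y) {d d' : Pre S X' Y'} (h : Rel d d') :
    (c.tensor d).toHom = (c.tensor d').toHom := by
  cases h with
  | iso h => exact (tensor_iso (Iso.refl c) h).toHom_eq
  | subdivide _ e => exact (tensor_subdivide_right c _ e).toHom_eq.trans (subdivide_toHom _ _)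

theorem comp_assoc (c : Pre S X Y) (d : Pre S Y Z) (e : Pre S Z W) :
    Iso ((c.comp d).comp e) (c.comp (d.comp e)) := by
  let φ : (c.V ⊕ d.V ⊕ Y.pts) ⊕ e.V ⊕ Z.pts ≃ c.V ⊕ (d.V ⊕ e.V ⊕ Z.pts) ⊕ Y.pts :=
    { toFun
        | .inl (.inl v) => .inl v
        | .inl (.inr (.inl v)) => .inr (.inl (.inl v))
        | .inl (.inr (.inr y)) => .inr (.inr y)
        | .inr v => .inr (.inl (.inr v))
      invFun
        | .inl v => .inl (.inl v)
        | .inr (.inl (.inl v)) => .inl (.inr (.inl v))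
        | .inr (.inr y) => .inl (.inr (.inr y))
        | .inr (.inl (.inr v)) => .inr v
      left_inv := by rintro ((_ | _ | _) | _) <;> rfl
      right_inv := by rintro (_ | (_ | _) | _) <;> rfl }
  have k₁ : ∀ n : Node c.V X.pts Y.pts,
      (lower n : Node (c.V ⊕ (d.V ⊕ e.V ⊕ Z.pts) ⊕ Y.pts) X.pts W.pts) =
        (lower (lower n : Node (c.V ⊕ d.V ⊕ Y.pts) X.pts Z.pts) :
          Node ((c.V ⊕ d.V ⊕ Y.pts) ⊕ e.V ⊕ Z.pts) X.pts W.pts).map φ id id := by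
    rintro (_ | _ | _) <;> rfl
  have k₂ : ∀ n : Node d.V Y.pts Z.pts,
      (upper (lower n : Node (d.V ⊕ e.V ⊕ Z.pts) Y.pts W.pts) :
          Node (c.V ⊕ (d.V ⊕ e.V ⊕ Z.pts) ⊕ Y.pts) X.pts W.pts) =
        (lower (upper n : Node (c.V ⊕ d.V ⊕ Y.pts) X.pts Z.pts) :
          Node ((c.V ⊕ d.V ⊕ Y.pts) ⊕ e.V ⊕ Z.pts) X.pts W.pts).map φ id id := by
    rintro (_ | _ | _) <;> rfl
  have k₃ : ∀ n : Node e.V Z.pts W.pts,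
      (upper (upper n : Node (d.V ⊕ e.V ⊕ Z.pts) Y.pts W.pts) :
          Node (c.V ⊕ (d.V ⊕ e.V ⊕ Z.pts) ⊕ Y.pts) X.pts W.pts) =
        (upper n : Node ((c.V ⊕ d.V ⊕ Y.pts) ⊕ e.V ⊕ Z.pts) X.pts W.pts).map φ id id := by
    rintro (_ | _ | _) <;> rfl
  refine ⟨φ, Equiv.sumAssoc _ _ _, ?_, ?_, ?_⟩
  · rintro ((_ | _ | _) | _ | _) <;> rfl
  · rintro ((a | a) | a)
    · exact k₁ (c.src a)
    · exact k₂ (d.src a)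
    · exact k₃ (e.src a)
  · rintro ((a | a) | a)
    · exact k₁ (c.tgt a)
    · exact k₂ (d.tgt a)
    · exact k₃ (e.tgt a)

/-- A boundary point as a vertex. -/
def bd {V A B : Type} : A ⊕ B → Node V A B
  | .inl x => .bot x
  | .inr y => .top y

theorem bd_injective {V A B : Type} : Function.Injective (bd : A ⊕ B → Node V A B) := by
  rintro (_ | _) (_ | _) h <;> simp_all [bd]

@[simp] theorem bd_map {V V' A B : Type} (f : V → V') (p : A ⊕ B) :
    (bd p : Node V A B).map f id id = bd p := by
  cases p <;> rfl

theorem map_eq_bd {V V' A B : Type} (f : V → V') (n : Node V A B) (p : A ⊕ B) :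
    n.map f id id = bd p ↔ n = bd p := by
  cases p <;> cases n <;> simp [bd]

theorem inner_ne_bd {V A B : Type} (v : V) (p : A ⊕ B) : (Node.inner v : Node V A B) ≠ bd p := by
  cases p <;> simp [bd]

/-- Move the added element from the left summand to the right one. -/
def optSumOpt (A B : Type) : Option A ⊕ B ≃ A ⊕ Option B where
  toFun
    | .inl none => .inr none
    | .inl (some a) => .inl a
    | .inr b => .inr (some b)
  invFun
    | .inr none => .inl none
    | .inl a => .inl (some a)
    | .inr (some b) => .inr b
  left_inv := by rintro ((_ | _) | _) <;> rfl
  right_inv := by rintro (_ | (_ | _)) <;> rfl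

/-- `Collar W c c'`: the decomposition `c'` is obtained from `c` by attaching a collar at the
boundary points `ρ w`, `w : W`. -/
structure Collar (W : Type) (c c' : Pre S X Y) where
  φ : c.V ⊕ W ≃ c'.V
  ψ : c.E ⊕ W ≃ c'.E
  ρ : W → X.pts ⊕ Y.pts
  hρ : Function.Injective ρ
  hk : ∀ v, c'.kind (φ (.inl v)) = c.kind v
  hw : ∀ w, c'.kind (φ (.inr w)) = Kind.plain
  hs : ∀ e, (∀ w, c.src e ≠ bd (ρ w)) →
    c'.src (ψ (.inl e)) = (c.src e).map (fun v => φ (.inl v)) id id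
  hs' : ∀ e w, c.src e = bd (ρ w) → c'.src (ψ (.inl e)) = .inner (φ (.inr w))
  ht : ∀ e, (∀ w, c.tgt e ≠ bd (ρ w)) →
    c'.tgt (ψ (.inl e)) = (c.tgt e).map (fun v => φ (.inl v)) id id
  ht' : ∀ e w, c.tgt e = bd (ρ w) → c'.tgt (ψ (.inl e)) = .inner (φ (.inr w))
  hout : ∀ w, (∃ e, c.src e = bd (ρ w)) →
    c'.src (ψ (.inr w)) = bd (ρ w) ∧ c'.tgt (ψ (.inr w)) = .inner (φ (.inr w))
  hin : ∀ w, (∃ e, c.tgt e = bd (ρ w)) →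
    c'.src (ψ (.inr w)) = .inner (φ (.inr w)) ∧ c'.tgt (ψ (.inr w)) = bd (ρ w)

theorem bd_or (c : Pre S X Y) (p : X.pts ⊕ Y.pts) :
    ((∃ e, c.src e = bd p) ∧ ¬ ∃ e, c.tgt e = bd p) ∨
      ((∃ e, c.tgt e = bd p) ∧ ¬ ∃ e, c.src e = bd p) := by
  rcases p with x | y
  · simp only [bd, c.src_iff, c.tgt_iff, Node.emits_bot, Node.absorbs_bot]
    cases X.sign x <;> simp
  · simp only [bd, c.src_iff, c.tgt_iff, Node.emits_top, Node.absorbs_top]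
    cases Y.sign y <;> simp

theorem subdivide_src_some (c : Pre S X Y) (e₀ e : c.E) :
    (c.subdivide e₀).src (some e) = (c.src e).map some id id := rfl

theorem subdivide_src_none (c : Pre S X Y) (e₀ : c.E) :
    (c.subdivide e₀).src none = .inner none := rfl

theorem subdivide_tgt_none (c : Pre S X Y) (e₀ : c.E) :
    (c.subdivide e₀).tgt none = (c.tgt e₀).map some id id := rfl

theorem exists_src_subdivide (c : Pre S X Y) (e₀ : c.E) (p : X.pts ⊕ Y.pts) :
    (∃ e, (c.subdivide e₀).src e = bd p) ↔ ∃ e, c.src e = bd p := by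
  rw [src_iff, src_iff]
  cases p <;> rfl

theorem exists_tgt_subdivide (c : Pre S X Y) (e₀ : c.E) (p : X.pts ⊕ Y.pts) :
    (∃ e, (c.subdivide e₀).tgt e = bd p) ↔ ∃ e, c.tgt e = bd p := by
  rw [tgt_iff, tgt_iff]
  cases p <;> rfl

theorem collar_step {W : Type} {c c' : Pre S X Y} (h : Collar (Option W) c c') :
    ∃ e₀, Nonempty (Collar W (c.subdivide e₀) c') := by
  classical
  obtain ⟨φ, ψ, ρ, hρ, hk, hw, hs, hs', ht, ht', hout, hin⟩ := h
  have hne : ∀ w : W, ρ (some w) ≠ ρ none := fun w H => by simpa using hρ H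
  let F : Node (Option c.V) X.pts Y.pts → Node c'.V X.pts Y.pts :=
    Node.map (fun v => φ (optSumOpt _ _ (.inl v))) id id
  have hF : ∀ n : Node c.V X.pts Y.pts,
      n.map (fun v => φ (.inl v)) id id = F (n.map some id id) := by
    rintro (_ | _ | _) <;> rfl
  have hm : ∀ (n : Node c.V X.pts Y.pts) (p : X.pts ⊕ Y.pts), n = bd p →
      (n.map some id id : Node (Option c.V) X.pts Y.pts) = bd p := fun n p => (map_eq_bd _ _ _).2
  have hm' : ∀ (n : Node c.V X.pts Y.pts) (p : X.pts ⊕ Y.pts),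
      (n.map some id id : Node (Option c.V) X.pts Y.pts) = bd p → n = bd p :=
    fun n p => (map_eq_bd _ _ _).1
  rcases bd_or c (ρ none) with ⟨⟨e₀, h₀⟩, hno⟩ | ⟨⟨e₀, h₀⟩, hno⟩
  · refine ⟨e₀, ⟨?_⟩⟩
    have ho := hout none ⟨e₀, h₀⟩
    let ψ₁ : Option c.E ⊕ W ≃ c'.E :=
      (optSumOpt c.E W).trans ((Equiv.swap (.inr none) (.inl e₀)).trans ψ)
    have f1 : ψ₁ (.inl none) = ψ (.inl e₀) := congrArg ψ (Equiv.swap_apply_left _ _)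
    have f2 : ψ₁ (.inl (some e₀)) = ψ (.inr none) := congrArg ψ (Equiv.swap_apply_right _ _)
    have f3 : ∀ e, e ≠ e₀ → ψ₁ (.inl (some e)) = ψ (.inl e) := fun e he =>
      congrArg ψ (Equiv.swap_apply_of_ne_of_ne Sum.inl_ne_inr (Sum.inl_injective.ne he))
    have f4 : ∀ w, ψ₁ (.inr w) = ψ (.inr (some w)) := fun w =>
      congrArg ψ (Equiv.swap_apply_of_ne_of_ne
        (Sum.inr_injective.ne (Option.some_ne_none w)) Sum.inr_ne_inl)
    refine ⟨(optSumOpt c.V W).trans φ, ψ₁, fun w => ρ (some w),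
      fun a b H => Option.some_injective _ (hρ H), ?_, fun w => hw (some w), ?_, ?_, ?_, ?_, ?_, ?_⟩
    · rintro (_ | v)
      · exact hw none
      · exact hk v
    · rintro (_ | e) H
      · exact (congrArg c'.src f1).trans (hs' e₀ none h₀)
      · by_cases he : e = e₀
        · subst he
          refine (congrArg c'.src f2).trans (ho.1.trans ?_)
          exact (bd_map _ _).symm.trans (congrArg F (hm _ _ h₀)).symm
        · refine (congrArg c'.src (f3 e he)).trans ((hs e ?_).trans (hF _))
          rintro (_ | w) H'
          · exact he (c.src_inj (H'.trans h₀.symm))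
          · exact H w (hm _ _ H')
    · rintro (_ | e) w H
      · exact absurd H (inner_ne_bd _ _)
      · have H₁ := hm' _ _ H
        have he : e ≠ e₀ := by
          rintro rfl
          exact hne w (bd_injective (H₁.symm.trans h₀))
        exact (congrArg c'.src (f3 e he)).trans (hs' e (some w) H₁)
    · rintro (_ | e) H
      · refine (congrArg c'.tgt f1).trans ((ht e₀ ?_).trans (hF _))
        rintro (_ | w) H'
        · exact hno ⟨_, H'⟩
        · exact H w (hm _ _ H')
      · by_cases he : e = e₀
        · subst he
          exact (congrArg c'.tgt f2).trans
            (ho.2.trans (congrArg F (subdivide_tgt_self c e)).symm)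
        · have E1 := subdivide_tgt_of_ne c he
          refine (congrArg c'.tgt (f3 e he)).trans ((ht e ?_).trans
            ((hF _).trans (congrArg F E1.symm)))
          rintro (_ | w) H'
          · exact hno ⟨_, H'⟩
          · exact H w (E1.trans (hm _ _ H'))
    · rintro (_ | e) w H
      · exact (congrArg c'.tgt f1).trans (ht' e₀ (some w) (hm' _ _ H))
      · by_cases he : e = e₀
        · subst he
          exact absurd ((subdivide_tgt_self c e).symm.trans H) (inner_ne_bd _ _)
        · have E1 := subdivide_tgt_of_ne c he
          exact (congrArg c'.tgt (f3 e he)).trans (ht' e (some w) (hm' _ _ (E1.symm.trans H)))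
    · intro w H
      have := hout (some w) ((exists_src_subdivide c e₀ _).1 H)
      rw [← f4] at this
      exact this
    · intro w H
      have := hin (some w) ((exists_tgt_subdivide c e₀ _).1 H)
      rw [← f4] at this
      exact this
  · refine ⟨e₀, ⟨?_⟩⟩
    have hi := hin none ⟨e₀, h₀⟩
    refine ⟨(optSumOpt c.V W).trans φ, (optSumOpt c.E W).trans ψ, fun w => ρ (some w),
      fun a b H => Option.some_injective _ (hρ H), ?_, fun w => hw (some w), ?_, ?_, ?_, ?_, ?_, ?_⟩
    · rintro (_ | v)
      · exact hw none
      · exact hk v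
    · rintro (_ | e) H
      · exact hi.1
      · refine (hs e ?_).trans (hF _)
        rintro (_ | w) H'
        · exact hno ⟨_, H'⟩
        · exact H w (hm _ _ H')
    · rintro (_ | e) w H
      · exact absurd H (inner_ne_bd _ _)
      · exact hs' e (some w) (hm' _ _ H)
    · rintro (_ | e) H
      · exact hi.2.trans ((bd_map _ _).symm.trans (congrArg F (hm _ _ h₀)).symm)
      · by_cases he : e = e₀
        · subst he
          exact (ht' e none h₀).trans (congrArg F (subdivide_tgt_self c e)).symm
        · have E1 := subdivide_tgt_of_ne c he
          refine (ht e ?_).trans ((hF _).trans (congrArg F E1.symm))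
          rintro (_ | w) H'
          · exact he (c.tgt_inj (H'.trans h₀.symm))
          · exact H w (E1.trans (hm _ _ H'))
    · rintro (_ | e) w H
      · exact absurd (bd_injective ((hm' _ _ H).symm.trans h₀)) (hne w)
      · by_cases he : e = e₀
        · subst he
          exact absurd ((subdivide_tgt_self c e).symm.trans H) (inner_ne_bd _ _)
        · have E1 := subdivide_tgt_of_ne c he
          exact ht' e (some w) (hm' _ _ (E1.symm.trans H))
    · intro w H
      exact hout (some w) ((exists_src_subdivide c e₀ _).1 H)
    · intro w H
      exact hin (some w) ((exists_tgt_subdivide c e₀ _).1 H)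

/-- Attaching a collar does not change a cobordism. -/
theorem Collar.toHom_eq {W : Type} [Finite W] {c c' : Pre S X Y} (h : Collar W c c') :
    c'.toHom = c.toHom := by
  suffices H : ∀ c : Pre S X Y, Collar W c c' → c'.toHom = c.toHom from H c h
  clear h c
  refine Finite.induction_empty_option
    (P := fun W => ∀ c : Pre S X Y, Collar W c c' → c'.toHom = c.toHom) ?_ ?_ ?_ W
  · intro A B e ih c h
    refine ih c ?_
    exact
      { φ := (Equiv.sumCongr (Equiv.refl _) e).trans h.φ
        ψ := (Equiv.sumCongr (Equiv.refl _) e).trans h.ψ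
        ρ := fun w => h.ρ (e w)
        hρ := h.hρ.comp e.injective
        hk := h.hk
        hw := fun w => h.hw (e w)
        hs := fun a H => h.hs a fun w => by
          obtain ⟨w, rfl⟩ := e.surjective w
          exact H w
        hs' := fun a w H => h.hs' a (e w) H
        ht := fun a H => h.ht a fun w => by
          obtain ⟨w, rfl⟩ := e.surjective w
          exact H w
        ht' := fun a w H => h.ht' a (e w) H
        hout := fun w H => h.hout (e w) H
        hin := fun w H => h.hin (e w) H }
  · intro c h
    refine (Iso.toHom_eq ⟨(Equiv.sumEmpty _ _).symm.trans h.φ, (Equiv.sumEmpty _ _).symm.trans h.ψ,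
      h.hk, fun e => h.hs e fun w => w.elim, fun e => h.ht e fun w => w.elim⟩).symm
  · intro A _ ih c h
    obtain ⟨e₀, ⟨h'⟩⟩ := collar_step h
    exact (ih _ h').trans (subdivide_toHom _ _)

/-- Precomposition with a permutation cobordism relabels the bottom boundary. -/
theorem perm_comp (f : SEquiv X' X) (c : Pre S X Y) :
    ((perm S f).comp c).toHom = (c.relabel f.symm (SEquiv.refl Y)).toHom := by
  have k : ∀ n : Node c.V X.pts Y.pts,
      (∀ w, n.map id f.symm.equiv id ≠ bd (.inl (f.equiv.symm w))) →
      (upper n : Node (Empty ⊕ c.V ⊕ X.pts) X'.pts Y.pts) =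
        (n.map id f.symm.equiv id).map (fun v => .inr (.inl v)) id id := by
    rintro (v | x | y) H
    · rfl
    · exact absurd rfl (H x)
    · rfl
  have k' : ∀ (n : Node c.V X.pts Y.pts) (w : X.pts),
      n.map id f.symm.equiv id = bd (.inl (f.equiv.symm w)) →
      (upper n : Node (Empty ⊕ c.V ⊕ X.pts) X'.pts Y.pts) = .inner (.inr (.inr w)) := by
    rintro (v | x | y) w H
    · exact absurd H (by simp [bd])
    · have : x = w := by simpa [bd, SEquiv.symm] using H
      rw [this, upper_bot]
    · exact absurd H (by simp [bd])
  refine Collar.toHom_eq (W := X.pts)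
    { φ := (Equiv.emptySum Empty (c.V ⊕ X.pts)).symm
      ψ := (Equiv.sumComm c.E X.pts).trans (Equiv.sumCongr f.equiv.symm (Equiv.refl c.E))
      ρ := fun x => .inl (f.equiv.symm x)
      hρ := Sum.inl_injective.comp f.equiv.symm.injective
      hk := fun v => rfl
      hw := fun w => rfl
      hs := fun e H => k (c.src e) H
      hs' := fun e w H => k' (c.src e) w H
      ht := fun e H => k (c.tgt e) H
      ht' := fun e w H => k' (c.tgt e) w H
      hout := ?_
      hin := ?_ }
  · intro w H
    have hsg : X'.sign (f.equiv.symm w) = Sgn.pos :=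
      ((c.relabel f.symm (SEquiv.refl Y)).src_iff (.bot (f.equiv.symm w))).1 H
    have h1 : Node.strandSrc (V := Empty) (X'.sign (f.equiv.symm w)) (f.equiv.symm w)
        (f.equiv (f.equiv.symm w)) = .bot (f.equiv.symm w) := by
      rw [hsg]
      rfl
    have h2 : Node.strandTgt (V := Empty) (X'.sign (f.equiv.symm w)) (f.equiv.symm w)
        (f.equiv (f.equiv.symm w)) = .top w := by
      rw [hsg, f.equiv.apply_symm_apply]
      rfl
    exact ⟨congrArg lower h1, congrArg lower h2⟩
  · intro w H
    have hsg : X'.sign (f.equiv.symm w) = Sgn.neg :=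
      ((c.relabel f.symm (SEquiv.refl Y)).tgt_iff (.bot (f.equiv.symm w))).1 H
    have h1 : Node.strandSrc (V := Empty) (X'.sign (f.equiv.symm w)) (f.equiv.symm w)
        (f.equiv (f.equiv.symm w)) = .top w := by
      rw [hsg, f.equiv.apply_symm_apply]
      rfl
    have h2 : Node.strandTgt (V := Empty) (X'.sign (f.equiv.symm w)) (f.equiv.symm w)
        (f.equiv (f.equiv.symm w)) = .bot (f.equiv.symm w) := by
      rw [hsg]
      rfl
    exact ⟨congrArg lower h1, congrArg lower h2⟩

/-- Postcomposition with a permutation cobordism relabels the top boundary. -/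
theorem comp_perm (c : Pre S X Y) (g : SEquiv Y Y') :
    (c.comp (perm S g)).toHom = (c.relabel (SEquiv.refl X) g).toHom := by
  have k : ∀ n : Node c.V X.pts Y.pts, (∀ w, n.map id id g.equiv ≠ bd (.inr (g.equiv w))) →
      (lower n : Node (c.V ⊕ Empty ⊕ Y.pts) X.pts Y'.pts) =
        (n.map id id g.equiv).map (fun v => .inl v) id id := by
    rintro (v | x | y) H
    · rfl
    · rfl
    · exact absurd rfl (H y)
  have k' : ∀ (n : Node c.V X.pts Y.pts) (w : Y.pts),
      n.map id id g.equiv = bd (.inr (g.equiv w)) →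
      (lower n : Node (c.V ⊕ Empty ⊕ Y.pts) X.pts Y'.pts) = .inner (.inr (.inr w)) := by
    rintro (v | x | y) w H
    · exact absurd H (by simp [bd])
    · exact absurd H (by simp [bd])
    · have : y = w := by simpa [bd] using H
      rw [this, lower_top]
  refine Collar.toHom_eq (W := Y.pts)
    { φ := Equiv.sumCongr (Equiv.refl c.V) (Equiv.emptySum Empty Y.pts).symm
      ψ := Equiv.refl (c.E ⊕ Y.pts)
      ρ := fun y => .inr (g.equiv y)
      hρ := Sum.inr_injective.comp g.equiv.injective
      hk := fun v => rfl
      hw := fun w => rfl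
      hs := fun e H => k (c.src e) H
      hs' := fun e w H => k' (c.src e) w H
      ht := fun e H => k (c.tgt e) H
      ht' := fun e w H => k' (c.tgt e) w H
      hout := ?_
      hin := ?_ }
  · intro w H
    have hsg : Y.sign w = Sgn.neg := (g.sign_eq w).symm.trans
      (((c.relabel (SEquiv.refl X) g).src_iff (.top (g.equiv w))).1 H)
    have h1 : Node.strandSrc (V := Empty) (Y.sign w) w (g.equiv w) = .top (g.equiv w) := by
      rw [hsg]
      rfl
    have h2 : Node.strandTgt (V := Empty) (Y.sign w) w (g.equiv w) = .bot w := by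
      rw [hsg]
      rfl
    exact ⟨congrArg upper h1, congrArg upper h2⟩
  · intro w H
    have hsg : Y.sign w = Sgn.pos := (g.sign_eq w).symm.trans
      (((c.relabel (SEquiv.refl X) g).tgt_iff (.top (g.equiv w))).1 H)
    have h1 : Node.strandSrc (V := Empty) (Y.sign w) w (g.equiv w) = .bot w := by
      rw [hsg]
      rfl
    have h2 : Node.strandTgt (V := Empty) (Y.sign w) w (g.equiv w) = .top (g.equiv w) := by
      rw [hsg]
      rfl
    exact ⟨congrArg upper h1, congrArg upper h2⟩

theorem relabel_refl (c : Pre S X Y) :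
    Iso (c.relabel (SEquiv.refl X) (SEquiv.refl Y)) c := by
  have k : ∀ n : Node c.V X.pts Y.pts,
      n = (n.map id (SEquiv.refl X).equiv (SEquiv.refl Y).equiv).map (Equiv.refl _) id id := by
    rintro (_ | _ | _) <;> rfl
  exact ⟨Equiv.refl _, Equiv.refl _, fun _ => rfl, fun e => k (c.src e), fun e => k (c.tgt e)⟩

theorem perm_relabel (f : SEquiv X Y) (g : SEquiv Y Z) :
    Iso ((perm S f).relabel (SEquiv.refl X) g) (perm S (f.trans g)) := by
  have k : ∀ x, ((Node.strandSrc (X.sign x) x (f.equiv x) :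
      Node Empty X.pts Y.pts).map id id g.equiv).map id id id =
        Node.strandSrc (X.sign x) x (g.equiv (f.equiv x)) := by
    intro x
    cases X.sign x <;> rfl
  have k' : ∀ x, ((Node.strandTgt (X.sign x) x (f.equiv x) :
      Node Empty X.pts Y.pts).map id id g.equiv).map id id id =
        Node.strandTgt (X.sign x) x (g.equiv (f.equiv x)) := by
    intro x
    cases X.sign x <;> rfl
  exact ⟨Equiv.refl _, Equiv.refl _, fun v => v.elim, fun e => (k e).symm, fun e => (k' e).symm⟩

theorem perm_comp_perm (f : SEquiv X Y) (g : SEquiv Y Z) :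
    ((perm S f).comp (perm S g)).toHom = (perm S (f.trans g)).toHom :=
  (comp_perm _ _).trans (perm_relabel f g).toHom_eq

theorem id_comp (c : Pre S X Y) : ((perm S (SEquiv.refl X)).comp c).toHom = c.toHom :=
  (perm_comp _ _).trans (relabel_refl c).toHom_eq

theorem comp_id (c : Pre S X Y) : (c.comp (perm S (SEquiv.refl Y))).toHom = c.toHom :=
  (comp_perm _ _).trans (relabel_refl c).toHom_eq

theorem tensor_perm (f : SEquiv X Y) (g : SEquiv X' Y') :
    Iso ((perm S f).tensor (perm S g)) (perm S (f.sum g)) := by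
  refine ⟨Equiv.emptySum Empty Empty, Equiv.refl _, ?_, ?_, ?_⟩
  · rintro (v | v) <;> exact v.elim
  · rintro (x | x)
    · have k : ∀ s, (Node.strandSrc s (Sum.inl x) (Sum.inl (f.equiv x)) :
          Node Empty (X.pts ⊕ X'.pts) (Y.pts ⊕ Y'.pts)) =
          ((Node.strandSrc s x (f.equiv x) : Node Empty X.pts Y.pts).map
            (Sum.inl (β := Empty)) Sum.inl Sum.inl).map (Equiv.emptySum Empty Empty) id id := by
        rintro (_ | _) <;> rfl
      exact k (X.sign x)
    · have k : ∀ s, (Node.strandSrc s (Sum.inr x) (Sum.inr (g.equiv x)) :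
          Node Empty (X.pts ⊕ X'.pts) (Y.pts ⊕ Y'.pts)) =
          ((Node.strandSrc s x (g.equiv x) : Node Empty X'.pts Y'.pts).map
            (Sum.inr (α := Empty)) Sum.inr Sum.inr).map (Equiv.emptySum Empty Empty) id id := by
        rintro (_ | _) <;> rfl
      exact k (X'.sign x)
  · rintro (x | x)
    · have k : ∀ s, (Node.strandTgt s (Sum.inl x) (Sum.inl (f.equiv x)) :
          Node Empty (X.pts ⊕ X'.pts) (Y.pts ⊕ Y'.pts)) =
          ((Node.strandTgt s x (f.equiv x) : Node Empty X.pts Y.pts).map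
            (Sum.inl (β := Empty)) Sum.inl Sum.inl).map (Equiv.emptySum Empty Empty) id id := by
        rintro (_ | _) <;> rfl
      exact k (X.sign x)
    · have k : ∀ s, (Node.strandTgt s (Sum.inr x) (Sum.inr (g.equiv x)) :
          Node Empty (X.pts ⊕ X'.pts) (Y.pts ⊕ Y'.pts)) =
          ((Node.strandTgt s x (g.equiv x) : Node Empty X'.pts Y'.pts).map
            (Sum.inr (α := Empty)) Sum.inr Sum.inr).map (Equiv.emptySum Empty Empty) id id := by
        rintro (_ | _) <;> rfl
      exact k (X'.sign x)

theorem tensor_comp (c : Pre S X Y) (c' : Pre S X' Y') (d : Pre S Y Z) (d' : Pre S Y' Z') :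
    Iso ((c.tensor c').comp (d.tensor d')) ((c.comp d).tensor (c'.comp d')) := by
  let φ : (c.V ⊕ c'.V) ⊕ (d.V ⊕ d'.V) ⊕ (Y.pts ⊕ Y'.pts) ≃
      (c.V ⊕ d.V ⊕ Y.pts) ⊕ (c'.V ⊕ d'.V ⊕ Y'.pts) :=
    { toFun
        | .inl (.inl v) => .inl (.inl v)
        | .inl (.inr v) => .inr (.inl v)
        | .inr (.inl (.inl v)) => .inl (.inr (.inl v))
        | .inr (.inl (.inr v)) => .inr (.inr (.inl v))
        | .inr (.inr (.inl y)) => .inl (.inr (.inr y))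
        | .inr (.inr (.inr y)) => .inr (.inr (.inr y))
      invFun
        | .inl (.inl v) => .inl (.inl v)
        | .inr (.inl v) => .inl (.inr v)
        | .inl (.inr (.inl v)) => .inr (.inl (.inl v))
        | .inr (.inr (.inl v)) => .inr (.inl (.inr v))
        | .inl (.inr (.inr y)) => .inr (.inr (.inl y))
        | .inr (.inr (.inr y)) => .inr (.inr (.inr y))
      left_inv := by rintro ((_ | _) | (_ | _) | (_ | _)) <;> rfl
      right_inv := by rintro ((_ | _ | _) | (_ | _ | _)) <;> rfl }
  have k₁ : ∀ n : Node c.V X.pts Y.pts,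
      (Node.map .inl .inl .inl (lower n : Node (c.V ⊕ d.V ⊕ Y.pts) X.pts Z.pts) :
        Node ((c.V ⊕ d.V ⊕ Y.pts) ⊕ (c'.V ⊕ d'.V ⊕ Y'.pts)) (X.pts ⊕ X'.pts) (Z.pts ⊕ Z'.pts)) =
      (lower (n.map .inl .inl .inl : Node (c.V ⊕ c'.V) (X.pts ⊕ X'.pts) (Y.pts ⊕ Y'.pts)) :
        Node ((c.V ⊕ c'.V) ⊕ (d.V ⊕ d'.V) ⊕ (Y.pts ⊕ Y'.pts)) _ (Z.pts ⊕ Z'.pts)).map φ id id := by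
    rintro (_ | _ | _) <;> rfl
  have k₂ : ∀ n : Node c'.V X'.pts Y'.pts,
      (Node.map .inr .inr .inr (lower n : Node (c'.V ⊕ d'.V ⊕ Y'.pts) X'.pts Z'.pts) :
        Node ((c.V ⊕ d.V ⊕ Y.pts) ⊕ (c'.V ⊕ d'.V ⊕ Y'.pts)) (X.pts ⊕ X'.pts) (Z.pts ⊕ Z'.pts)) =
      (lower (n.map .inr .inr .inr : Node (c.V ⊕ c'.V) (X.pts ⊕ X'.pts) (Y.pts ⊕ Y'.pts)) :
        Node ((c.V ⊕ c'.V) ⊕ (d.V ⊕ d'.V) ⊕ (Y.pts ⊕ Y'.pts)) _ (Z.pts ⊕ Z'.pts)).map φ id id := by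
    rintro (_ | _ | _) <;> rfl
  have k₃ : ∀ n : Node d.V Y.pts Z.pts,
      (Node.map .inl .inl .inl (upper n : Node (c.V ⊕ d.V ⊕ Y.pts) X.pts Z.pts) :
        Node ((c.V ⊕ d.V ⊕ Y.pts) ⊕ (c'.V ⊕ d'.V ⊕ Y'.pts)) (X.pts ⊕ X'.pts) (Z.pts ⊕ Z'.pts)) =
      (upper (n.map .inl .inl .inl : Node (d.V ⊕ d'.V) (Y.pts ⊕ Y'.pts) (Z.pts ⊕ Z'.pts)) :
        Node ((c.V ⊕ c'.V) ⊕ (d.V ⊕ d'.V) ⊕ (Y.pts ⊕ Y'.pts)) (X.pts ⊕ X'.pts) _).map φ id id := by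
    rintro (_ | _ | _) <;> rfl
  have k₄ : ∀ n : Node d'.V Y'.pts Z'.pts,
      (Node.map .inr .inr .inr (upper n : Node (c'.V ⊕ d'.V ⊕ Y'.pts) X'.pts Z'.pts) :
        Node ((c.V ⊕ d.V ⊕ Y.pts) ⊕ (c'.V ⊕ d'.V ⊕ Y'.pts)) (X.pts ⊕ X'.pts) (Z.pts ⊕ Z'.pts)) =
      (upper (n.map .inr .inr .inr : Node (d.V ⊕ d'.V) (Y.pts ⊕ Y'.pts) (Z.pts ⊕ Z'.pts)) :
        Node ((c.V ⊕ c'.V) ⊕ (d.V ⊕ d'.V) ⊕ (Y.pts ⊕ Y'.pts)) (X.pts ⊕ X'.pts) _).map φ id id := by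
    rintro (_ | _ | _) <;> rfl
  refine ⟨φ, Equiv.sumSumSumComm _ _ _ _, ?_, ?_, ?_⟩
  · rintro ((_ | _) | (_ | _) | (_ | _)) <;> rfl
  · rintro ((e | e) | (e | e))
    · exact k₁ (c.src e)
    · exact k₂ (c'.src e)
    · exact k₃ (d.src e)
    · exact k₄ (d'.src e)
  · rintro ((e | e) | (e | e))
    · exact k₁ (c.tgt e)
    · exact k₂ (c'.tgt e)
    · exact k₃ (d.tgt e)
    · exact k₄ (d'.tgt e)

/-- If two decompositions become isomorphic after relabelling, the corresponding square with
permutation cobordisms commutes. -/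
theorem square {c : Pre S X Y} {d : Pre S X' Y'} (f : SEquiv X X') (g : SEquiv Y Y')
    (φ : c.V ≃ d.V) (ψ : c.E ≃ d.E) (hk : ∀ v, d.kind (φ v) = c.kind v)
    (hs : ∀ e, d.src (ψ e) = (c.src e).map φ f.equiv g.equiv)
    (ht : ∀ e, d.tgt (ψ e) = (c.tgt e).map φ f.equiv g.equiv) :
    (c.comp (perm S g)).toHom = ((perm S f).comp d).toHom := by
  have k : ∀ n : Node c.V X.pts Y.pts,
      ((n.map φ f.equiv g.equiv).map id f.symm.equiv (SEquiv.refl Y').equiv) =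
        (n.map id (SEquiv.refl X).equiv g.equiv).map φ id id := by
    rintro (v | x | y)
    · rfl
    · exact congrArg Node.bot (f.equiv.symm_apply_apply x)
    · rfl
  rw [comp_perm, perm_comp]
  exact Iso.toHom_eq ⟨φ, ψ, hk, fun e => (congrArg (Node.map _ _ _) (hs e)).trans (k _),
    fun e => (congrArg (Node.map _ _ _) (ht e)).trans (k _)⟩

theorem assoc_natural {X₁ X₂ X₃ Y₁ Y₂ Y₃ : ZeroMfd} (c₁ : Pre S X₁ Y₁) (c₂ : Pre S X₂ Y₂)
    (c₃ : Pre S X₃ Y₃) :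
    (((c₁.tensor c₂).tensor c₃).comp (perm S (SEquiv.assoc Y₁ Y₂ Y₃))).toHom =
      ((perm S (SEquiv.assoc X₁ X₂ X₃)).comp (c₁.tensor (c₂.tensor c₃))).toHom := by
  refine square _ _ (Equiv.sumAssoc _ _ _) (Equiv.sumAssoc _ _ _) ?_ ?_ ?_
  · rintro ((_ | _) | _) <;> rfl
  · rintro ((e | e) | e)
    · change Node.map _ _ _ (c₁.src e) = Node.map _ _ _ (Node.map _ _ _ (Node.map _ _ _ (c₁.src e)))
      rcases c₁.src e with _ | _ | _ <;> rfl
    · change Node.map _ _ _ (Node.map _ _ _ (c₂.src e)) =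
        Node.map _ _ _ (Node.map _ _ _ (Node.map _ _ _ (c₂.src e)))
      rcases c₂.src e with _ | _ | _ <;> rfl
    · change Node.map _ _ _ (Node.map _ _ _ (c₃.src e)) = Node.map _ _ _ (Node.map _ _ _ (c₃.src e))
      rcases c₃.src e with _ | _ | _ <;> rfl
  · rintro ((e | e) | e)
    · change Node.map _ _ _ (c₁.tgt e) = Node.map _ _ _ (Node.map _ _ _ (Node.map _ _ _ (c₁.tgt e)))
      rcases c₁.tgt e with _ | _ | _ <;> rfl
    · change Node.map _ _ _ (Node.map _ _ _ (c₂.tgt e)) =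
        Node.map _ _ _ (Node.map _ _ _ (Node.map _ _ _ (c₂.tgt e)))
      rcases c₂.tgt e with _ | _ | _ <;> rfl
    · change Node.map _ _ _ (Node.map _ _ _ (c₃.tgt e)) = Node.map _ _ _ (Node.map _ _ _ (c₃.tgt e))
      rcases c₃.tgt e with _ | _ | _ <;> rfl

theorem left_unit_natural (c : Pre S X Y) :
    (((perm S (SEquiv.refl ZeroMfd.empty)).tensor c).comp (perm S (SEquiv.emptySum Y))).toHom =
      ((perm S (SEquiv.emptySum X)).comp c).toHom := by
  refine square _ _ (Equiv.emptySum Empty _) (Equiv.emptySum Empty _) ?_ ?_ ?_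
  · rintro (v | _)
    · exact v.elim
    · rfl
  · rintro (v | e)
    · exact v.elim
    · change c.src e = Node.map _ _ _ (Node.map _ _ _ (c.src e))
      rcases c.src e with _ | _ | _ <;> rfl
  · rintro (v | e)
    · exact v.elim
    · change c.tgt e = Node.map _ _ _ (Node.map _ _ _ (c.tgt e))
      rcases c.tgt e with _ | _ | _ <;> rfl

theorem right_unit_natural (c : Pre S X Y) :
    ((c.tensor (perm S (SEquiv.refl ZeroMfd.empty))).comp (perm S (SEquiv.sumEmpty Y))).toHom =
      ((perm S (SEquiv.sumEmpty X)).comp c).toHom := by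
  refine square _ _ (Equiv.sumEmpty _ Empty) (Equiv.sumEmpty _ Empty) ?_ ?_ ?_
  · rintro (_ | v)
    · rfl
    · exact v.elim
  · rintro (e | v)
    · change c.src e = Node.map _ _ _ (Node.map _ _ _ (c.src e))
      rcases c.src e with _ | _ | _ <;> rfl
    · exact v.elim
  · rintro (e | v)
    · change c.tgt e = Node.map _ _ _ (Node.map _ _ _ (c.tgt e))
      rcases c.tgt e with _ | _ | _ <;> rfl
    · exact v.elim

theorem swap_natural (c : Pre S X Y) (d : Pre S X' Y') :
    ((c.tensor d).comp (perm S (SEquiv.swap Y Y'))).toHom =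
      ((perm S (SEquiv.swap X X')).comp (d.tensor c)).toHom := by
  refine square _ _ (Equiv.sumComm _ _) (Equiv.sumComm _ _) ?_ ?_ ?_
  · rintro (_ | _) <;> rfl
  · rintro (e | e)
    · change Node.map _ _ _ (c.src e) = Node.map _ _ _ (Node.map _ _ _ (c.src e))
      rcases c.src e with _ | _ | _ <;> rfl
    · change Node.map _ _ _ (d.src e) = Node.map _ _ _ (Node.map _ _ _ (d.src e))
      rcases d.src e with _ | _ | _ <;> rfl
  · rintro (e | e)
    · change Node.map _ _ _ (c.tgt e) = Node.map _ _ _ (Node.map _ _ _ (c.tgt e))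
      rcases c.tgt e with _ | _ | _ <;> rfl
    · change Node.map _ _ _ (d.tgt e) = Node.map _ _ _ (Node.map _ _ _ (d.tgt e))
      rcases d.tgt e with _ | _ | _ <;> rfl

end Pre

namespace Hom

variable {S : Type v} {X Y Z W X' Y' Z' : ZeroMfd}

/-- The permutation cobordism of a sign-preserving bijection. -/
def perm (S : Type v) (f : SEquiv X Y) : Hom S X Y := (Pre.perm S f).toHom

/-- Composition (gluing) of cobordisms. -/
def comp (f : Hom S X Y) (g : Hom S Y Z) : Hom S X Z :=
  Quot.lift₂ (fun c d => (Pre.comp c d).toHom) (fun c _ _ h => Pre.comp_congr_right c h)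
    (fun _ _ d h => Pre.comp_congr_left h d) f g

/-- Disjoint union of cobordisms. -/
def tensor (f : Hom S X Y) (g : Hom S X' Y') : Hom S (X.sum X') (Y.sum Y') :=
  Quot.lift₂ (fun c d => (Pre.tensor c d).toHom) (fun c _ _ h => Pre.tensor_congr_right c h)
    (fun _ _ d h => Pre.tensor_congr_left h d) f g

end Hom

/-- The category of closed oriented `0`-manifolds and cobordisms with `S`-labelled defects and
inner endpoints. -/
structure Bord (S : Type v) where
  mfd : ZeroMfd

namespace Bord

variable {S : Type v}

instance : Category (Bord S) where
  Hom X Y := Hom S X.mfd Y.mfd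
  id X := Hom.perm S (SEquiv.refl X.mfd)
  comp f g := Hom.comp f g
  id_comp := by
    rintro X Y ⟨f⟩
    exact Pre.id_comp f
  comp_id := by
    rintro X Y ⟨f⟩
    exact Pre.comp_id f
  assoc := by
    rintro X Y Z W ⟨f⟩ ⟨g⟩ ⟨h⟩
    exact (Pre.comp_assoc f g h).toHom_eq

/-- The permutation cobordism as a morphism. -/
def perm {X Y : Bord S} (f : SEquiv X.mfd Y.mfd) : X ⟶ Y := Hom.perm S f

theorem perm_comp_perm {X Y Z : Bord S} (f : SEquiv X.mfd Y.mfd) (g : SEquiv Y.mfd Z.mfd) :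
    (perm f : X ⟶ Y) ≫ perm g = perm (f.trans g) :=
  Pre.perm_comp_perm f g

theorem perm_refl (X : Bord S) : (perm (SEquiv.refl X.mfd) : X ⟶ X) = 𝟙 X := rfl

/-- The isomorphism given by a sign-preserving bijection. -/
def permIso {X Y : Bord S} (f : SEquiv X.mfd Y.mfd) : X ≅ Y where
  hom := perm f
  inv := perm f.symm
  hom_inv_id := by
    rw [perm_comp_perm, ← perm_refl]
    congr 1
    ext x
    exact f.equiv.symm_apply_apply x
  inv_hom_id := by
    rw [perm_comp_perm, ← perm_refl]
    congr 1
    ext x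
    exact f.equiv.apply_symm_apply x

instance : MonoidalCategoryStruct (Bord S) where
  tensorObj X Y := ⟨X.mfd.sum Y.mfd⟩
  tensorUnit := ⟨ZeroMfd.empty⟩
  tensorHom f g := Hom.tensor f g
  whiskerLeft X _ _ f := Hom.tensor (𝟙 X) f
  whiskerRight f Y := Hom.tensor f (𝟙 Y)
  associator X Y Z := permIso (SEquiv.assoc X.mfd Y.mfd Z.mfd)
  leftUnitor X := permIso (SEquiv.emptySum X.mfd)
  rightUnitor X := permIso (SEquiv.sumEmpty X.mfd)

theorem perm_tensor_perm {X Y X' Y' : Bord S} (f : SEquiv X.mfd Y.mfd) (g : SEquiv X'.mfd Y'.mfd) :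
    ((perm f : X ⟶ Y) ⊗ₘ (perm g : X' ⟶ Y')) = perm (f.sum g) :=
  (Pre.tensor_perm f g).toHom_eq

theorem refl_sum_refl (X Y : ZeroMfd) :
    (SEquiv.refl X).sum (SEquiv.refl Y) = SEquiv.refl (X.sum Y) := by
  ext (x | x) <;> rfl

instance : MonoidalCategory (Bord S) := MonoidalCategory.ofTensorHom
  (id_tensorHom_id := fun X Y => (perm_tensor_perm _ _).trans
    (congrArg (fun f => perm f) (refl_sum_refl X.mfd Y.mfd)))
  (id_tensorHom := fun _ _ _ _ => rfl)
  (tensorHom_id := fun _ _ => rfl)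
  (tensorHom_comp_tensorHom := by
    rintro X₁ Y₁ Z₁ X₂ Y₂ Z₂ ⟨f₁⟩ ⟨f₂⟩ ⟨g₁⟩ ⟨g₂⟩
    exact (Pre.tensor_comp f₁ f₂ g₁ g₂).toHom_eq)
  (associator_naturality := by
    rintro X₁ X₂ X₃ Y₁ Y₂ Y₃ ⟨f₁⟩ ⟨f₂⟩ ⟨f₃⟩
    exact Pre.assoc_natural f₁ f₂ f₃)
  (leftUnitor_naturality := by
    rintro X Y ⟨f⟩
    exact Pre.left_unit_natural f)
  (rightUnitor_naturality := by
    rintro X Y ⟨f⟩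
    exact Pre.right_unit_natural f)
  (pentagon := by
    intro W X Y Z
    change ((perm _ ⊗ₘ perm _) ≫ perm _ ≫ (perm _ ⊗ₘ perm _) : _ ⟶ _) = perm _ ≫ perm _
    simp only [perm_tensor_perm, perm_comp_perm]
    congr 1
    ext (((_ | _) | _) | _) <;> rfl)
  (triangle := by
    intro X Y
    change (perm _ ≫ (perm _ ⊗ₘ perm _) : _ ⟶ _) = (perm _ ⊗ₘ perm _)
    simp only [perm_tensor_perm, perm_comp_perm]
    congr 1
    ext ((_ | x) | _)
    · rfl
    · exact x.elim
    · rfl)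

instance : SymmetricCategory (Bord S) where
  braiding X Y := permIso (SEquiv.swap X.mfd Y.mfd)
  braiding_naturality_right X Y Z := by
    rintro ⟨f⟩
    exact Pre.swap_natural _ f
  braiding_naturality_left := by
    rintro X Y ⟨f⟩ Z
    exact Pre.swap_natural f _
  hexagon_forward X Y Z := by
    change (perm _ ≫ perm _ ≫ perm _ : _ ⟶ _) = (perm _ ⊗ₘ perm _) ≫ perm _ ≫ (perm _ ⊗ₘ perm _)
    simp only [perm_tensor_perm, perm_comp_perm]
    congr 1
    ext ((_ | _) | _) <;> rfl
  hexagon_reverse X Y Z := by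
    change (perm _ ≫ perm _ ≫ perm _ : _ ⟶ _) = (perm _ ⊗ₘ perm _) ≫ perm _ ≫ (perm _ ⊗ₘ perm _)
    simp only [perm_tensor_perm, perm_comp_perm]
    congr 1
    ext (_ | (_ | _)) <;> rfl
  symmetry X Y := (permIso (SEquiv.swap X.mfd Y.mfd)).hom_inv_id

end Bord


/-- The oriented `0`-manifold of a sign sequence. -/
abbrev ZeroMfd.ofSeq (l : List Sgn) : ZeroMfd := ⟨Fin l.length, l.get⟩

namespace SEquiv

/-- The identity strands between equal sign sequences. -/
def ofEq {l l' : List Sgn} (h : l = l') : SEquiv (ZeroMfd.ofSeq l) (ZeroMfd.ofSeq l') :=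
  ⟨finCongr (congrArg List.length h), fun x => by subst h; rfl⟩

/-- The points of a concatenation of sign sequences, the points of the first sequence coming
first. -/
def append (l l' : List Sgn) :
    SEquiv ((ZeroMfd.ofSeq l).sum (ZeroMfd.ofSeq l')) (ZeroMfd.ofSeq (l ++ l')) :=
  ⟨finSumFinEquiv.trans (finCongr List.length_append.symm), by
    rintro (x | x)
    · simp [List.getElem_append_left]
    · simp [List.getElem_append_right]⟩

/-- The empty sign sequence has no points. -/
def nil : SEquiv ZeroMfd.empty (ZeroMfd.ofSeq []) :=
  ⟨Equiv.equivOfIsEmpty Empty (Fin 0), fun x => x.elim⟩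

theorem append_assoc_apply (l₁ l₂ l₃ : List Sgn) (x : Fin ((l₁ ++ l₂) ++ l₃).length) :
    (ofEq (List.append_assoc l₁ l₂ l₃)).equiv x =
      ((((append (l₁ ++ l₂) l₃).symm.trans ((append l₁ l₂).symm.sum (refl _))).trans
        ((assoc _ _ _).trans (((refl _).sum (append l₂ l₃)).trans
          (append l₁ (l₂ ++ l₃)))))).equiv x := by
  obtain ⟨x, rfl⟩ := (append (l₁ ++ l₂) l₃).equiv.surjective x
  rcases x with x | x
  · obtain ⟨x, rfl⟩ := (append l₁ l₂).equiv.surjective x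
    rcases x with x | x <;> apply Fin.ext <;>
      simp [append, trans, symm, sum, refl, assoc, ofEq]
  · apply Fin.ext
    simp [append, trans, symm, sum, refl, assoc, ofEq, Nat.add_assoc]

theorem nil_append_apply (l : List Sgn) (x : Fin ([] ++ l).length) :
    (ofEq (List.nil_append l)).equiv x =
      (((append [] l).symm.trans (nil.symm.sum (refl _))).trans (emptySum _)).equiv x := by
  obtain ⟨x, rfl⟩ := (append [] l).equiv.surjective x
  rcases x with x | x
  · exact x.elim0
  · change _ = Equiv.emptySum Empty _
      (Sum.map _ _ ((append [] l).equiv.symm ((append [] l).equiv (.inr x))))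
    rw [Equiv.symm_apply_apply]
    apply Fin.ext
    simp [append, refl, ofEq]

theorem append_nil_apply (l : List Sgn) (x : Fin (l ++ []).length) :
    (ofEq (List.append_nil l)).equiv x =
      (((append l []).symm.trans ((refl _).sum nil.symm)).trans (sumEmpty _)).equiv x := by
  obtain ⟨x, rfl⟩ := (append l []).equiv.surjective x
  rcases x with x | x
  · change _ = Equiv.sumEmpty _ Empty
      (Sum.map _ _ ((append l []).equiv.symm ((append l []).equiv (.inl x))))
    rw [Equiv.symm_apply_apply]
    apply Fin.ext
    exact congrArg Fin.val (finSumFinEquiv_apply_left (n := 0) x)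
  · exact x.elim0

end SEquiv

/-- The category of oriented one-dimensional cobordisms with `S`-labelled defects and inner
endpoints: objects are sign sequences, morphisms are cobordisms between them. -/
structure Cob (S : Type v) where
  seq : List Sgn

namespace Cob

variable {S : Type v}

/-- The `0`-manifold of a sign sequence. -/
abbrev toBord (X : Cob S) : Bord S := ⟨ZeroMfd.ofSeq X.seq⟩

instance : Category (Cob S) where
  Hom X Y := Hom S (ZeroMfd.ofSeq X.seq) (ZeroMfd.ofSeq Y.seq)
  id X := 𝟙 X.toBord
  comp {X Y Z} f g := (show X.toBord ⟶ Y.toBord from f) ≫ (show Y.toBord ⟶ Z.toBord from g)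
  id_comp {X Y} f := Category.id_comp (X := X.toBord) (Y := Y.toBord) f
  comp_id {X Y} f := Category.comp_id (X := X.toBord) (Y := Y.toBord) f
  assoc {W X Y Z} f g h :=
    Category.assoc (W := W.toBord) (X := X.toBord) (Y := Y.toBord) (Z := Z.toBord) f g h

/-- The inclusion of sign sequences into all oriented `0`-manifolds. -/
def incl (S : Type v) : Cob S ⥤ Bord S where
  obj X := X.toBord
  map f := f

instance : (incl S).Faithful where
  map_injective h := h

/-- A morphism of `Cob` from a cobordism between the corresponding `0`-manifolds. -/
def ofBord {X Y : Cob S} (f : X.toBord ⟶ Y.toBord) : X ⟶ Y := f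

/-- The isomorphism of sign sequences given by a sign-preserving bijection. -/
def permIso {X Y : Cob S} (f : SEquiv (ZeroMfd.ofSeq X.seq) (ZeroMfd.ofSeq Y.seq)) : X ≅ Y where
  hom := ofBord (Bord.permIso f).hom
  inv := ofBord (Bord.permIso f).inv
  hom_inv_id := (Bord.permIso f).hom_inv_id
  inv_hom_id := (Bord.permIso f).inv_hom_id

/-- Disjoint union, as a comparison in `Bord`. -/
def μIso (X Y : Cob S) : X.toBord ⊗ Y.toBord ≅ (⟨X.seq ++ Y.seq⟩ : Cob S).toBord :=
  Bord.permIso (SEquiv.append X.seq Y.seq)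

/-- The tensor product is concatenation of sign sequences and disjoint union of cobordisms. -/
instance : MonoidalCategoryStruct (Cob S) where
  tensorObj X Y := ⟨X.seq ++ Y.seq⟩
  tensorUnit := ⟨[]⟩
  tensorHom {X₁ Y₁ X₂ Y₂} f g := ofBord
    ((μIso X₁ X₂).inv ≫ ((incl S).map f ⊗ₘ (incl S).map g) ≫ (μIso Y₁ Y₂).hom)
  whiskerLeft X {Y₁ Y₂} f := ofBord
    ((μIso X Y₁).inv ≫ (X.toBord ◁ (incl S).map f) ≫ (μIso X Y₂).hom)
  whiskerRight {X₁ X₂} f Y := ofBord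
    ((μIso X₁ Y).inv ≫ ((incl S).map f ▷ Y.toBord) ≫ (μIso X₂ Y).hom)
  associator X Y Z := permIso (SEquiv.ofEq (List.append_assoc X.seq Y.seq Z.seq))
  leftUnitor X := permIso (SEquiv.ofEq (List.nil_append X.seq))
  rightUnitor X := permIso (SEquiv.ofEq (List.append_nil X.seq))

/-- Comparison data between the tensor products. -/
def inclData (S : Type v) : Monoidal.InducingFunctorData (incl S) where
  μIso X Y := μIso X Y
  whiskerLeft_eq _ _ _ _ := rfl
  whiskerRight_eq _ _ := rfl
  tensorHom_eq _ _ := rfl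
  εIso := Bord.permIso SEquiv.nil
  associator_eq X Y Z := by
    change Bord.perm (SEquiv.ofEq _) = (Bord.perm (SEquiv.append _ _).symm ≫
      (Bord.perm (SEquiv.append _ _).symm ⊗ₘ Bord.perm (SEquiv.refl _))) ≫
        Bord.perm (SEquiv.assoc _ _ _) ≫
          (Bord.perm (SEquiv.refl _) ⊗ₘ Bord.perm (SEquiv.append _ _)) ≫
            Bord.perm (SEquiv.append _ _)
    simp only [Bord.perm_tensor_perm, Bord.perm_comp_perm]
    exact congrArg Bord.perm (SEquiv.ext (SEquiv.append_assoc_apply X.seq Y.seq Z.seq))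
  leftUnitor_eq X := by
    change Bord.perm (SEquiv.ofEq _) = (Bord.perm (SEquiv.append _ _).symm ≫
      (Bord.perm SEquiv.nil.symm ⊗ₘ Bord.perm (SEquiv.refl _))) ≫ Bord.perm (SEquiv.emptySum _)
    simp only [Bord.perm_tensor_perm, Bord.perm_comp_perm]
    exact congrArg Bord.perm (SEquiv.ext (SEquiv.nil_append_apply X.seq))
  rightUnitor_eq X := by
    change Bord.perm (SEquiv.ofEq _) = (Bord.perm (SEquiv.append _ _).symm ≫
      (Bord.perm (SEquiv.refl _) ⊗ₘ Bord.perm SEquiv.nil.symm)) ≫ Bord.perm (SEquiv.sumEmpty _)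
    simp only [Bord.perm_tensor_perm, Bord.perm_comp_perm]
    exact congrArg Bord.perm (SEquiv.ext (SEquiv.append_nil_apply X.seq))

instance : MonoidalCategory (Cob S) := Monoidal.induced (incl S) (inclData S)

instance : (incl S).Monoidal := Monoidal.fromInducedMonoidal (incl S) (inclData S)

/-- The exchange of two sign sequences by crossing strands. -/
def swapIso (X Y : Cob S) : X ⊗ Y ≅ Y ⊗ X :=
  permIso (((SEquiv.append X.seq Y.seq).symm.trans (SEquiv.swap _ _)).trans
    (SEquiv.append Y.seq X.seq))

theorem μ_swap (X Y : Cob S) :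
    Functor.LaxMonoidal.μ (incl S) X Y ≫ (incl S).map (swapIso X Y).hom =
      (β_ ((incl S).obj X) ((incl S).obj Y)).hom ≫ Functor.LaxMonoidal.μ (incl S) Y X := by
  change Bord.perm (SEquiv.append _ _) ≫ Bord.perm _ =
    Bord.perm (SEquiv.swap _ _) ≫ Bord.perm (SEquiv.append _ _)
  simp only [Bord.perm_comp_perm]
  congr 1
  ext x
  simp [SEquiv.trans, SEquiv.symm]

instance : BraidedCategory (Cob S) := BraidedCategory.ofFaithful (incl S) swapIso μ_swap

instance : (incl S).Braided where
  braided X Y := μ_swap X Y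

instance : SymmetricCategory (Cob S) := SymmetricCategory.ofFaithful (incl S)

/-- The positively oriented point. -/
def plus (S : Type v) : Cob S := ⟨[Sgn.pos]⟩

/-- The negatively oriented point. -/
def minus (S : Type v) : Cob S := ⟨[Sgn.neg]⟩

/-- The cup from the empty manifold to `(+, -)`: one strand, from `-` to `+`. -/
def cupPre (S : Type v) :
    Pre S (ZeroMfd.ofSeq []) (ZeroMfd.ofSeq ([Sgn.pos] ++ [Sgn.neg])) where
  V := Empty
  E := Unit
  kind v := v.elim
  src _ := .top ⟨1, by decide⟩
  tgt _ := .top ⟨0, by decide⟩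
  src_inj _ _ _ := rfl
  tgt_inj _ _ _ := rfl
  src_iff := by
    rintro (v | x | ⟨_ | _ | n, hn⟩)
    · exact v.elim
    · exact x.elim0
    · exact iff_of_false (by simp) fun h : Sgn.pos = Sgn.neg => nomatch h
    · exact iff_of_true ⟨(), rfl⟩ rfl
    · exact absurd hn (by simp)
  tgt_iff := by
    rintro (v | x | ⟨_ | _ | n, hn⟩)
    · exact v.elim
    · exact x.elim0
    · exact iff_of_true ⟨(), rfl⟩ rfl
    · exact iff_of_false (by simp) fun h : Sgn.neg = Sgn.pos => nomatch h
    · exact absurd hn (by simp)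

/-- The cap from `(-, +)` to the empty manifold: one strand, from `+` to `-`. -/
def capPre (S : Type v) :
    Pre S (ZeroMfd.ofSeq ([Sgn.neg] ++ [Sgn.pos])) (ZeroMfd.ofSeq []) where
  V := Empty
  E := Unit
  kind v := v.elim
  src _ := .bot ⟨1, by decide⟩
  tgt _ := .bot ⟨0, by decide⟩
  src_inj _ _ _ := rfl
  tgt_inj _ _ _ := rfl
  src_iff := by
    rintro (v | ⟨_ | _ | n, hn⟩ | y)
    · exact v.elim
    · exact iff_of_false (by simp) fun h : Sgn.neg = Sgn.pos => nomatch h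
    · exact iff_of_true ⟨(), rfl⟩ rfl
    · exact absurd hn (by simp)
    · exact y.elim0
  tgt_iff := by
    rintro (v | ⟨_ | _ | n, hn⟩ | y)
    · exact v.elim
    · exact iff_of_true ⟨(), rfl⟩ rfl
    · exact iff_of_false (by simp) fun h : Sgn.pos = Sgn.neg => nomatch h
    · exact absurd hn (by simp)
    · exact y.elim0

/-- The half-interval that begins at an inner endpoint and ends at `+` at the top. -/
def halfInPre (S : Type v) : Pre S (ZeroMfd.ofSeq []) (ZeroMfd.ofSeq [Sgn.pos]) where
  V := Unit
  E := Unit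
  kind _ := Kind.source
  src _ := .inner ()
  tgt _ := .top ⟨0, by decide⟩
  src_inj _ _ _ := rfl
  tgt_inj _ _ _ := rfl
  src_iff := by
    rintro (v | x | ⟨_ | n, hn⟩)
    · exact iff_of_true ⟨(), rfl⟩ trivial
    · exact x.elim0
    · exact iff_of_false (by simp) fun h : Sgn.pos = Sgn.neg => nomatch h
    · exact absurd hn (by simp)
  tgt_iff := by
    rintro (v | x | ⟨_ | n, hn⟩)
    · exact iff_of_false (by simp) id
    · exact x.elim0
    · exact iff_of_true ⟨(), rfl⟩ rfl
    · exact absurd hn (by simp)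

/-- The half-interval that begins at `+` at the bottom and ends at an inner endpoint. -/
def halfOutPre (S : Type v) : Pre S (ZeroMfd.ofSeq [Sgn.pos]) (ZeroMfd.ofSeq []) where
  V := Unit
  E := Unit
  kind _ := Kind.sink
  src _ := .bot ⟨0, by decide⟩
  tgt _ := .inner ()
  src_inj _ _ _ := rfl
  tgt_inj _ _ _ := rfl
  src_iff := by
    rintro (v | ⟨_ | n, hn⟩ | y)
    · exact iff_of_false (by simp) id
    · exact iff_of_true ⟨(), rfl⟩ rfl
    · exact absurd hn (by simp)
    · exact y.elim0
  tgt_iff := by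
    rintro (v | ⟨_ | n, hn⟩ | y)
    · exact iff_of_true ⟨(), rfl⟩ trivial
    · exact iff_of_false (by simp) fun h : Sgn.pos = Sgn.neg => nomatch h
    · exact absurd hn (by simp)
    · exact y.elim0

/-- The upward-oriented interval with one defect, labelled `a`; the edge `false` runs from the
bottom to the defect, the edge `true` from the defect to the top. -/
def dotPre {S : Type v} (a : S) : Pre S (ZeroMfd.ofSeq [Sgn.pos]) (ZeroMfd.ofSeq [Sgn.pos]) where
  V := Unit
  E := Bool
  kind _ := Kind.defect a
  src e := bif e then .inner () else .bot ⟨0, by decide⟩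
  tgt e := bif e then .top ⟨0, by decide⟩ else .inner ()
  src_inj := by rintro (_ | _) (_ | _) h <;> simp_all
  tgt_inj := by rintro (_ | _) (_ | _) h <;> simp_all
  src_iff := by
    rintro (v | ⟨_ | n, hn⟩ | ⟨_ | n, hn⟩)
    · exact iff_of_true ⟨true, rfl⟩ trivial
    · exact iff_of_true ⟨false, rfl⟩ rfl
    · exact absurd hn (by simp)
    · exact iff_of_false (by simp) fun h : Sgn.pos = Sgn.neg => nomatch h
    · exact absurd hn (by simp)
  tgt_iff := by
    rintro (v | ⟨_ | n, hn⟩ | ⟨_ | n, hn⟩)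
    · exact iff_of_true ⟨false, rfl⟩ trivial
    · exact iff_of_false (by simp) fun h : Sgn.pos = Sgn.neg => nomatch h
    · exact absurd hn (by simp)
    · exact iff_of_true ⟨true, rfl⟩ rfl
    · exact absurd hn (by simp)

/-- The cup cobordism. -/
def cup (S : Type v) : 𝟙_ (Cob S) ⟶ plus S ⊗ minus S := (cupPre S).toHom

/-- The cap cobordism. -/
def cap (S : Type v) : minus S ⊗ plus S ⟶ 𝟙_ (Cob S) := (capPre S).toHom

/-- The half-interval ending at `+`. -/
def halfIn (S : Type v) : 𝟙_ (Cob S) ⟶ plus S := (halfInPre S).toHom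

/-- The half-interval beginning at `+`. -/
def halfOut (S : Type v) : plus S ⟶ 𝟙_ (Cob S) := (halfOutPre S).toHom

/-- The upward-oriented interval with a defect. -/
def dot {S : Type v} (a : S) : plus S ⟶ plus S := (dotPre a).toHom

end Cob

open scoped TensorProduct

/-- A one-dimensional oriented TQFT with inner endpoints and `S`-labelled defects over a
commutative semiring `R`: a symmetric (strong) monoidal functor to `R`-modules. -/
structure TQFT (R : Type u) [CommSemiring R] (S : Type v) where
  F : Cob S ⥤ SemimoduleCat.{u} R
  [braided : F.Braided]

attribute [instance] TQFT.braided

/-- Finitely generated projective modules over a semiring: retracts of free modules of finite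
rank. -/
def IsFGProjective (R : Type u) [CommSemiring R] (P : Type u) [AddCommMonoid P] [Module R P] :
    Prop :=
  ∃ (k : ℕ) (ι : P →ₗ[R] (Fin k → R)) (p : (Fin k → R) →ₗ[R] P), p ∘ₗ ι = LinearMap.id

/-- A finitely generated projective module with a vector, a covector, and an endomorphism for each
label. -/
structure Datum (R : Type u) [CommSemiring R] (S : Type v) where
  P : Type u
  [addCommMonoid : AddCommMonoid P]
  [module : Module R P]
  fgProjective : IsFGProjective R P
  vec : P
  covec : Module.Dual R P
  op : S → Module.End R P

attribute [instance] Datum.addCommMonoid Datum.module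

section Classification

variable {R : Type u} [CommSemiring R] {S : Type v}

/-- TQFTs up to monoidal natural isomorphism. -/
instance TQFT.setoid (R : Type u) [CommSemiring R] (S : Type v) : Setoid (TQFT R S) where
  r F G := ∃ e : F.F ≅ G.F, NatTrans.IsMonoidal e.hom
  iseqv :=
    { refl := fun F => ⟨Iso.refl F.F, inferInstanceAs (NatTrans.IsMonoidal (𝟙 F.F))⟩
      symm := by
        rintro F G ⟨e, he⟩
        exact ⟨e.symm, inferInstanceAs (NatTrans.IsMonoidal e.inv)⟩
      trans := by
        rintro F G H ⟨e, he⟩ ⟨e', he'⟩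
        exact ⟨e ≪≫ e', inferInstanceAs (NatTrans.IsMonoidal (e.hom ≫ e'.hom))⟩ }

/-- Data up to isomorphism: module isomorphisms that match the vectors, the covectors and the
endomorphisms. -/
instance Datum.setoid (R : Type u) [CommSemiring R] (S : Type v) : Setoid (Datum R S) where
  r D D' := ∃ f : D.P ≃ₗ[R] D'.P, f D.vec = D'.vec ∧ (∀ x, D'.covec (f x) = D.covec x) ∧
    ∀ a x, f (D.op a x) = D'.op a (f x)
  iseqv :=
    { refl := fun D => ⟨LinearEquiv.refl R D.P, rfl, fun _ => rfl, fun _ _ => rfl⟩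
      symm := by
        rintro D D' ⟨f, hv, hc, hm⟩
        refine ⟨f.symm, ?_, fun x => ?_, fun a x => ?_⟩
        · rw [← hv, f.symm_apply_apply]
        · rw [← hc, f.apply_symm_apply]
        · rw [f.symm_apply_eq, hm, f.apply_symm_apply]
      trans := by
        rintro D D' D'' ⟨f, hv, hc, hm⟩ ⟨f', hv', hc', hm'⟩
        refine ⟨f.trans f', ?_, fun x => ?_, fun a x => ?_⟩
        · simp [hv, hv']
        · simp [hc, hc']
        · simp [hm, hm'] }

/-- The coevaluation map `1 ↦ ∑ i, p (eᵢ) ⊗ ι* (eⁱ)` of a retract `P` of a free module. -/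
noncomputable def coev {P : Type u} [AddCommMonoid P] [Module R P] {k : ℕ}
    (ι : P →ₗ[R] (Fin k → R)) (p : (Fin k → R) →ₗ[R] P) : R →ₗ[R] P ⊗[R] Module.Dual R P :=
  LinearMap.toSpanSingleton R _ (∑ i, p (Pi.single i 1) ⊗ₜ[R] (LinearMap.proj i ∘ₗ ι))

open Functor.LaxMonoidal Functor.OplaxMonoidal in
/-- The TQFT `F` is given by the datum `D`: up to identifications of `F(+)` with `P` and of `F(-)`
with the dual of `P`, the cap goes to the evaluation, the cup to the coevaluation, the half-intervals
go to the vector and the covector, and a dot labelled `a` goes to the endomorphism of label `a`. -/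
def Realizes (F : TQFT R S) (D : Datum R S) : Prop :=
  ∃ (α : F.F.obj (Cob.plus S) ≅ SemimoduleCat.of R D.P)
    (β : F.F.obj (Cob.minus S) ≅ SemimoduleCat.of R (Module.Dual R D.P)),
    ((β.inv ⊗ₘ α.inv) ≫ μ F.F _ _ ≫ F.F.map (Cob.cap S) ≫ η F.F =
      SemimoduleCat.ofHom (contractLeft R D.P)) ∧
    (∀ (k : ℕ) (ι : D.P →ₗ[R] (Fin k → R)) (p : (Fin k → R) →ₗ[R] D.P),
      p ∘ₗ ι = LinearMap.id →
      ε F.F ≫ F.F.map (Cob.cup S) ≫ δ F.F _ _ ≫ (α.hom ⊗ₘ β.hom) =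
        SemimoduleCat.ofHom (coev ι p)) ∧
    (ε F.F ≫ F.F.map (Cob.halfIn S) ≫ α.hom =
      SemimoduleCat.ofHom (LinearMap.toSpanSingleton R D.P D.vec)) ∧
    (α.inv ≫ F.F.map (Cob.halfOut S) ≫ η F.F = SemimoduleCat.ofHom D.covec) ∧
    ∀ a : S, α.inv ≫ F.F.map (Cob.dot a) ≫ α.hom = SemimoduleCat.ofHom (D.op a)

end Classification

end OneCob

/-! A functor and a datum are matched by `Realizes`. The theorem holds because this relation is
invariant under isomorphism on both sides (`Realizes.of_equiv_left`, `Realizes.of_equiv_right`),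
every functor realizes a datum, every datum is realized, and each of the two determines the other up
to isomorphism (`Realizes.datum_equiv`, `Realizes.equiv`).

From a functor to a datum: a zigzag of a cup and a cap straightens to a strand, so the negative
point is dual to the positive one (`Cob.exactPairing`), and strong monoidal functors preserve duals.
If a semimodule `P` has a categorical dual `N`, the coevaluation sends `1` to a finite sum `∑ xᵢ ⊗
nᵢ`, and the zigzag identities say that `xᵢ` and `nᵢ` are dual families (`exists_dual_family`).
Hence `P` is a retract of a free module of finite rank, `N` is its linear dual, and the coevaluation
has the standard form for every choice of retraction (`coev_one_eq_sum`).

From a datum to a functor: a state sum avoids any presentation by generators and relations. Write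
`P` as a retract of `R^K` and colour the edge ends of a cell decomposition by `K`. An edge is
weighted by the idempotent matrix of `ι ∘ p`, an unmarked vertex by the identity matrix, a defect by
the matrix of `ι ∘ m_a ∘ p`, and an endpoint by the vector or the covector. Idempotence gives
invariance under subdivision; gluing becomes the matrix product and disjoint union the exterior
product. The state sum of an identity cobordism is only an idempotent, so the state space of a
`0`-manifold consists of the row vectors that this idempotent fixes. For `+` this space is `P`, for
`-` it is the dual of `P` (`Presentation.realizes`).

Uniqueness: crossings, cup, cap, half-intervals and dotted intervals generate all cobordisms
(`Cob.Generating.all`). An interior vertex can be cut out, which writes the cobordism as a simpler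
one glued to a neighbourhood of the vertex; without interior vertices only arcs between boundary
points remain. Circles need no case of their own, since a closed component of a cell decomposition
contains a vertex. Isomorphisms on the two points extend to a monoidal family on sign sequences, and
the cobordisms for which this family is natural are closed under gluing and disjoint union, so it is
enough to check the generators. -/

namespace OneCob
noncomputable section
open CategoryTheory MonoidalCategory

/-! ### State sums of coloured cell decompositions -/

/-- The colour of a vertex, given colours of the interior vertices and of the boundary. -/
def Node.colour {V X Y K : Type} (f : V → K) (b : X → K) (t : Y → K) : Node V X Y → K
  | .inner v => f v
  | .bot x => b x
  | .top y => t y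

namespace Node

variable {V X Y V' X' Y' K : Type}

@[simp] theorem colour_inner (f : V → K) (b : X → K) (t : Y → K) (v : V) :
    (inner v : Node V X Y).colour f b t = f v := rfl
@[simp] theorem colour_bot (f : V → K) (b : X → K) (t : Y → K) (x : X) :
    (bot x : Node V X Y).colour f b t = b x := rfl
@[simp] theorem colour_top (f : V → K) (b : X → K) (t : Y → K) (y : Y) :
    (top y : Node V X Y).colour f b t = t y := rfl

theorem colour_map (f : V' → K) (b : X' → K) (t : Y' → K) (φ : V → V') (g : X → X') (h : Y → Y')
    (n : Node V X Y) :
    (n.map φ g h).colour f b t = n.colour (f ∘ φ) (b ∘ g) (t ∘ h) := by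
  cases n <;> rfl

end Node

/-- Local weights of a state sum with colours `K`: a weight `prop i j` of an oriented edge with
initial colour `i` and terminal colour `j`, and a weight of each kind of interior vertex, depending
on the colours of the incoming and of the outgoing edge. -/
structure Weights (R : Type u) [CommSemiring R] (S : Type v) (K : Type) [Fintype K]
    [DecidableEq K] where
  prop : K → K → R
  vert : Kind S → K → K → R
  prop_prop : ∀ i l, ∑ j, prop i j * prop j l = prop i l
  vert_plain : ∀ i j, vert .plain i j = if i = j then 1 else 0

section StateSum

variable {R : Type u} [CommSemiring R] {S : Type v} {K : Type} [Fintype K] [DecidableEq K]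
variable (w : Weights R S K) {X Y Z X' Y' : ZeroMfd}

/-- The weight of a coloured cell decomposition. -/
noncomputable def Pre.weight (c : Pre S X Y) [Fintype c.V] [Fintype c.E] (b : X.pts → K)
    (t : Y.pts → K) (f : c.V → K × K) : R :=
  (∏ e, w.prop ((c.src e).colour (fun v => (f v).2) b t)
    ((c.tgt e).colour (fun v => (f v).1) b t)) * ∏ v, w.vert (c.kind v) (f v).1 (f v).2

/-- The state sum of a cell decomposition, as a matrix indexed by the boundary colourings. -/
noncomputable def Pre.stateSum (c : Pre S X Y) : Matrix (X.pts → K) (Y.pts → K) R := fun b t =>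
  letI := Fintype.ofFinite c.V
  letI := Fintype.ofFinite c.E
  letI := Fintype.ofFinite (c.V → K × K)
  ∑ f : c.V → K × K, c.weight w b t f

/-- The value does not depend on the chosen enumerations, so the sums and products can be taken over
the concrete `Option` and `Sum` types from which cell decompositions are built. -/
theorem Pre.stateSum_apply (c : Pre S X Y) [Fintype c.V] [Fintype c.E] [Fintype (c.V → K × K)]
    (b : X.pts → K) (t : Y.pts → K) :
    c.stateSum w b t = ∑ f : c.V → K × K, c.weight w b t f := by
  unfold stateSum
  congr!

theorem Pre.stateSum_iso {c d : Pre S X Y} (h : Pre.Iso c d) : c.stateSum w = d.stateSum w := by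
  classical
  obtain ⟨φ, ψ, hk, hs, ht⟩ := h
  have := Fintype.ofFinite c.V
  have := Fintype.ofFinite c.E
  have := Fintype.ofFinite d.V
  have := Fintype.ofFinite d.E
  ext b t
  rw [stateSum_apply, stateSum_apply]
  refine Fintype.sum_equiv (φ.arrowCongr (Equiv.refl _)) _ _ fun f => ?_
  unfold weight
  congr 1
  · refine Fintype.prod_equiv ψ _ _ fun e => ?_
    rw [hs, ht, Node.colour_map, Node.colour_map]
    congr 2 <;> ext v <;> simp
  · refine Fintype.prod_equiv φ _ _ fun v => ?_
    rw [hk]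
    simp

/-- The new vertex is unmarked, so its weight forces equal incoming and outgoing colours. The sum
over this common colour joins the weights of the two half-edges to the weight of `e₀`, by
`prop_prop`. -/
theorem Pre.stateSum_subdivide (c : Pre S X Y) (e₀ : c.E) :
    (c.subdivide e₀).stateSum w = c.stateSum w := by
  classical
  have := Fintype.ofFinite c.V
  have := Fintype.ofFinite c.E
  let _ : Fintype (c.subdivide e₀).V := inferInstanceAs (Fintype (Option c.V))
  let _ : Fintype (c.subdivide e₀).E := inferInstanceAs (Fintype (Option c.E))
  ext b t
  let _ : Fintype ((c.subdivide e₀).V → K × K) :=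
    inferInstanceAs (Fintype (Option c.V → K × K))
  rw [stateSum_apply, stateSum_apply]
  -- The image of `i` consists of the colourings whose two colours at the new vertex agree; all
  -- other colourings have weight zero.
  let i : (c.V → K × K) × K → (Option c.V → K × K) :=
    fun p o => o.elim (p.2, p.2) p.1
  have hi : Function.Injective i := by
    rintro ⟨f, k⟩ ⟨f', k'⟩ h
    have h₁ := congrFun h none
    have h₂ : ∀ v, f v = f' v := fun v => congrFun h (some v)
    simp [i] at h₁
    simp [h₁, funext h₂]
  -- The factors of the two halves of `e₀` are isolated: `none` is the half that leaves the new
  -- vertex, `some e₀` the half that arrives at it.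
  have hweight : ∀ F : Option c.V → K × K, (c.subdivide e₀).weight w b t F =
      (w.prop (F none).2 ((c.tgt e₀).colour (fun v => (F (some v)).1) b t) *
        (w.prop ((c.src e₀).colour (fun v => (F (some v)).2) b t) (F none).1 *
          ∏ e ∈ Finset.univ.erase e₀, w.prop ((c.src e).colour (fun v => (F (some v)).2) b t)
            ((c.tgt e).colour (fun v => (F (some v)).1) b t))) *
        (w.vert .plain (F none).1 (F none).2 *
          ∏ v, w.vert (c.kind v) (F (some v)).1 (F (some v)).2) := by
    intro F
    unfold weight
    congr 1
    · refine (Fintype.prod_option _).trans (congrArg₂ _ ?_ ?_)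
      · exact congrArg _ (Node.colour_map _ _ _ _ _ _ _)
      · rw [← Finset.mul_prod_erase _ _ (Finset.mem_univ e₀), subdivide_tgt_self,
          subdivide_src_some]
        refine congrArg₂ _ (congrArg₂ _ (Node.colour_map _ _ _ _ _ _ _) rfl)
          (Finset.prod_congr rfl fun e he => ?_)
        rw [subdivide_tgt_of_ne c (Finset.ne_of_mem_erase he), subdivide_src_some]
        exact congrArg₂ _ (Node.colour_map _ _ _ _ _ _ _) (Node.colour_map _ _ _ _ _ _ _)
    · exact Fintype.prod_option _
  have hsum := Fintype.sum_of_injective i hi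
    (fun p => (c.subdivide e₀).weight w b t (i p)) (fun F => (c.subdivide e₀).weight w b t F)
    (by
      intro F hF
      rw [hweight, w.vert_plain, if_neg, zero_mul, mul_zero]
      intro h
      refine hF ⟨(fun v => F (some v), (F none).1), funext ?_⟩
      rintro (_ | v)
      · exact Prod.ext rfl h
      · rfl)
    fun _ => rfl
  refine hsum.symm.trans ((Fintype.sum_prod_type _).trans (Finset.sum_congr rfl fun f _ => ?_))
  simp only [hweight, i, Option.elim, w.vert_plain, if_true, one_mul]
  unfold weight
  rw [← Finset.sum_mul, ← Finset.mul_prod_erase _ _ (Finset.mem_univ e₀), ← w.prop_prop,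
    Finset.sum_mul, Finset.sum_mul, Finset.sum_mul]
  refine Finset.sum_congr rfl fun k _ => ?_
  ring

theorem Pre.stateSum_rel {c d : Pre S X Y} (h : Pre.Rel c d) : c.stateSum w = d.stateSum w := by
  cases h with
  | iso h => exact stateSum_iso w h
  | subdivide _ e => exact stateSum_subdivide w _ e

/-- The glued points are unmarked vertices, so only colourings with one colour at each of them
contribute. These common colours form a colouring of `Y`, which is the index summed over in the
matrix product. -/
theorem Pre.stateSum_comp [Fintype (Y.pts → K)] (c : Pre S X Y) (d : Pre S Y Z) :
    (c.comp d).stateSum w = c.stateSum w * d.stateSum w := by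
  classical
  have := Fintype.ofFinite c.V
  have := Fintype.ofFinite c.E
  have := Fintype.ofFinite d.V
  have := Fintype.ofFinite d.E
  have := Fintype.ofFinite Y.pts
  let _ : Fintype (c.comp d).V := inferInstanceAs (Fintype (c.V ⊕ d.V ⊕ Y.pts))
  let _ : Fintype (c.comp d).E := inferInstanceAs (Fintype (c.E ⊕ d.E))
  let _ : Fintype ((c.comp d).V → K × K) :=
    inferInstanceAs (Fintype (c.V ⊕ d.V ⊕ Y.pts → K × K))
  ext b t
  rw [Matrix.mul_apply, stateSum_apply]
  -- A colouring `m` of the seam, together with colourings of the two pieces, gives a colouring of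
  -- the composite that takes the same colour on both sides of each seam point.
  let i : (Y.pts → K) × (c.V → K × K) × (d.V → K × K) → (c.V ⊕ d.V ⊕ Y.pts → K × K) :=
    fun p => Sum.elim p.2.1 (Sum.elim p.2.2 fun y => (p.1 y, p.1 y))
  have hi : Function.Injective i := by
    rintro ⟨m, f, g⟩ ⟨m', f', g'⟩ h
    have h₁ : ∀ v, f v = f' v := fun v => congrFun h (.inl v)
    have h₂ : ∀ v, g v = g' v := fun v => congrFun h (.inr (.inl v))
    have h₃ : ∀ y, m y = m' y := fun y => congrArg Prod.fst (congrFun h (.inr (.inr y)))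
    rw [funext h₁, funext h₂, funext h₃]
  have hweight : ∀ F : c.V ⊕ d.V ⊕ Y.pts → K × K, (c.comp d).weight w b t F =
      ((∏ e, w.prop ((c.src e).colour (fun v => (F (.inl v)).2) b fun y => (F (.inr (.inr y))).2)
          ((c.tgt e).colour (fun v => (F (.inl v)).1) b fun y => (F (.inr (.inr y))).1)) *
        (∏ e, w.prop
          ((d.src e).colour (fun v => (F (.inr (.inl v))).2) (fun y => (F (.inr (.inr y))).2) t)
          ((d.tgt e).colour (fun v => (F (.inr (.inl v))).1) (fun y => (F (.inr (.inr y))).1) t))) *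
      ((∏ v, w.vert (c.kind v) (F (.inl v)).1 (F (.inl v)).2) *
        ((∏ v, w.vert (d.kind v) (F (.inr (.inl v))).1 (F (.inr (.inl v))).2) *
          ∏ y, w.vert .plain (F (.inr (.inr y))).1 (F (.inr (.inr y))).2)) := by
    intro F
    have hl : ∀ (G : c.V ⊕ d.V ⊕ Y.pts → K) (n : Node c.V X.pts Y.pts),
        (lower n : Node (c.V ⊕ d.V ⊕ Y.pts) X.pts Z.pts).colour G b t =
          n.colour (fun v => G (.inl v)) b fun y => G (.inr (.inr y)) := by
      rintro G (_ | _ | _) <;> rfl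
    have hu : ∀ (G : c.V ⊕ d.V ⊕ Y.pts → K) (n : Node d.V Y.pts Z.pts),
        (upper n : Node (c.V ⊕ d.V ⊕ Y.pts) X.pts Z.pts).colour G b t =
          n.colour (fun v => G (.inr (.inl v))) (fun y => G (.inr (.inr y))) t := by
      rintro G (_ | _ | _) <;> rfl
    unfold weight
    congr 1
    · refine (Fintype.prod_sum_type _).trans (congrArg₂ _ ?_ ?_)
      · refine Finset.prod_congr rfl fun e _ => ?_
        exact congrArg₂ _ (hl _ _) (hl _ _)
      · refine Finset.prod_congr rfl fun e _ => ?_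
        exact congrArg₂ _ (hu _ _) (hu _ _)
    · refine (Fintype.prod_sum_type _).trans (congrArg₂ _ rfl ?_)
      exact Fintype.prod_sum_type _
  have hsum := Fintype.sum_of_injective i hi
    (fun p => (c.comp d).weight w b t (i p)) (fun F => (c.comp d).weight w b t F)
    (by
      intro F hF
      rw [hweight]
      -- Outside the image some seam point has two different colours, and its factor kills the whole
      -- weight.
      have : ∃ y, (F (.inr (.inr y))).1 ≠ (F (.inr (.inr y))).2 := by
        by_contra! h
        refine hF ⟨(fun y => (F (.inr (.inr y))).1, fun v => F (.inl v),
          fun v => F (.inr (.inl v))), funext ?_⟩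
        rintro (v | v | y)
        · rfl
        · rfl
        · exact Prod.ext rfl (h y)
      obtain ⟨y, hy⟩ := this
      rw [Finset.prod_eq_zero (Finset.mem_univ y) (by rw [w.vert_plain, if_neg hy])]
      simp only [mul_zero])
    fun _ => rfl
  refine hsum.symm.trans ((Fintype.sum_prod_type _).trans ?_)
  refine Fintype.sum_congr _ _ fun m => ?_
  rw [stateSum_apply, stateSum_apply, Fintype.sum_mul_sum, Fintype.sum_prod_type]
  refine Fintype.sum_congr _ _ fun f => Fintype.sum_congr _ _ fun g => ?_
  rw [hweight]
  simp only [i, Sum.elim_inl, Sum.elim_inr, w.vert_plain, if_true, Finset.prod_const_one, mul_one]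
  unfold weight
  ring

/-- A colouring of a disjoint union is a pair of colourings, and the weights multiply. -/
theorem Pre.stateSum_tensor (c : Pre S X Y) (d : Pre S X' Y') (b : (X.sum X').pts → K)
    (t : (Y.sum Y').pts → K) :
    (c.tensor d).stateSum w b t =
      c.stateSum w (fun x => b (.inl x)) (fun y => t (.inl y)) *
        d.stateSum w (fun x => b (.inr x)) (fun y => t (.inr y)) := by
  classical
  have := Fintype.ofFinite c.V
  have := Fintype.ofFinite c.E
  have := Fintype.ofFinite d.V
  have := Fintype.ofFinite d.E
  let _ : Fintype (c.tensor d).V := inferInstanceAs (Fintype (c.V ⊕ d.V))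
  let _ : Fintype (c.tensor d).E := inferInstanceAs (Fintype (c.E ⊕ d.E))
  let _ : Fintype ((c.tensor d).V → K × K) := inferInstanceAs (Fintype (c.V ⊕ d.V → K × K))
  rw [stateSum_apply, stateSum_apply, stateSum_apply, Fintype.sum_mul_sum,
    ← Fintype.sum_prod_type']
  refine Fintype.sum_equiv (Equiv.sumArrowEquivProdArrow c.V d.V (K × K)) _ _ fun F => ?_
  change weight w (c.tensor d) b t F = (_ * _) * (_ * _)
  rw [mul_mul_mul_comm]
  refine congrArg₂ _ ((Fintype.prod_sum_type _).trans (congrArg₂ _ ?_ ?_))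
    (Fintype.prod_sum_type _)
  · refine Finset.prod_congr rfl fun e _ => ?_
    exact congrArg₂ _ (Node.colour_map _ _ _ _ _ _ _) (Node.colour_map _ _ _ _ _ _ _)
  · refine Finset.prod_congr rfl fun e _ => ?_
    exact congrArg₂ _ (Node.colour_map _ _ _ _ _ _ _) (Node.colour_map _ _ _ _ _ _ _)

/-- The weight of a vertical strand over a point of the given sign. -/
def Weights.strand (s : Sgn) (i j : K) : R :=
  match s with
  | .pos => w.prop i j
  | .neg => w.prop j i

/-- With no interior vertices there is a single colouring. For the identity the value is a tensor
power of the edge matrix and its transpose, an idempotent that need not be the identity matrix. -/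
theorem Pre.stateSum_perm [Fintype X.pts] (f : SEquiv X Y) (b : X.pts → K) (t : Y.pts → K) :
    (Pre.perm S f).stateSum w b t = ∏ x, w.strand (X.sign x) (b x) (t (f.equiv x)) := by
  let _ : Fintype (Pre.perm S f).V := inferInstanceAs (Fintype Empty)
  let _ : Fintype (Pre.perm S f).E := inferInstanceAs (Fintype X.pts)
  let _ : Unique ((Pre.perm S f).V → K × K) := inferInstanceAs (Unique (Empty → K × K))
  rw [stateSum_apply, Fintype.sum_unique]
  unfold weight
  rw [show (∏ v : (Pre.perm S f).V, w.vert _ _ _) = 1 from Fintype.prod_empty (ι := Empty) _,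
    mul_one]
  refine Finset.prod_congr rfl fun (x : X.pts) _ => ?_
  change w.prop ((Node.strandSrc (X.sign x) x (f.equiv x)).colour _ _ _)
    ((Node.strandTgt (X.sign x) x (f.equiv x)).colour _ _ _) = _
  cases X.sign x <;> rfl

/-- The state sum of a cobordism. -/
noncomputable def Hom.stateSum (f : Hom S X Y) : Matrix (X.pts → K) (Y.pts → K) R :=
  Quot.lift (fun c => c.stateSum w) (fun _ _ h => Pre.stateSum_rel w h) f

end StateSum
end
end OneCob

/-! ### State spaces and the symmetric monoidal state sum functor -/

namespace OneCob
noncomputable section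
open CategoryTheory MonoidalCategory
open scoped TensorProduct

section StateSpace

variable {R : Type u} [CommSemiring R] {S : Type v} {K : Type} [Fintype K] [DecidableEq K]
variable (w : Weights R S K)

/-- The boundary colourings of a closed `0`-manifold form a finite set. -/
abbrev colouringFintype (X : ZeroMfd) : Fintype (X.pts → K) := Fintype.ofFinite _

attribute [local instance] colouringFintype

namespace Bord

variable {w} {X Y Z X' Y' : Bord S}

/-- The state sum of a morphism. -/
def stateSum (w : Weights R S K) (f : X ⟶ Y) : Matrix (X.mfd.pts → K) (Y.mfd.pts → K) R :=
  Hom.stateSum w f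

theorem stateSum_comp (f : X ⟶ Y) (g : Y ⟶ Z) :
    stateSum w (f ≫ g) = stateSum w f * stateSum w g := by
  obtain ⟨c⟩ := f
  obtain ⟨d⟩ := g
  exact Pre.stateSum_comp w c d

theorem stateSum_tensorHom (f : X ⟶ Y) (g : X' ⟶ Y') (b : (X.mfd.sum X'.mfd).pts → K)
    (t : (Y.mfd.sum Y'.mfd).pts → K) :
    stateSum w (f ⊗ₘ g) b t =
      stateSum w f (fun x => b (.inl x)) (fun y => t (.inl y)) *
        stateSum w g (fun x => b (.inr x)) (fun y => t (.inr y)) := by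
  obtain ⟨c⟩ := f
  obtain ⟨d⟩ := g
  exact Pre.stateSum_tensor w c d b t

/-- The signs at the two ends of each strand agree, so a permutation has the same strand weights as
the identity and only the indexing of the top colouring changes. -/
theorem stateSum_perm (f : SEquiv X.mfd Y.mfd) (b : X.mfd.pts → K) (t : Y.mfd.pts → K) :
    stateSum w (perm f : X ⟶ Y) b t = stateSum w (𝟙 X) b (fun x => t (f.equiv x)) := by
  have := Fintype.ofFinite X.mfd.pts
  exact (Pre.stateSum_perm w f b t).trans
    (Pre.stateSum_perm w (SEquiv.refl X.mfd) b fun x => t (f.equiv x)).symm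

theorem stateSum_id_tensor (b t : (X.mfd.sum Y.mfd).pts → K) :
    stateSum w (𝟙 (X ⊗ Y)) b t =
      stateSum w (𝟙 X) (fun x => b (.inl x)) (fun x => t (.inl x)) *
        stateSum w (𝟙 Y) (fun x => b (.inr x)) (fun x => t (.inr x)) := by
  rw [← id_tensorHom_id]
  exact stateSum_tensorHom _ _ _ _

variable (w)

/-- The state space of a `0`-manifold: the functions on its colourings that are fixed by the
state sum of the identity. -/
def stateSpace (X : Bord S) : Submodule R ((X.mfd.pts → K) → R) where
  carrier := {u | Matrix.vecMul u (stateSum w (𝟙 X)) = u}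
  add_mem' {u u'} h h' := by
    change Matrix.vecMul _ _ = _
    rw [Matrix.add_vecMul, h, h']
  zero_mem' := Matrix.zero_vecMul _
  smul_mem' r u h := by
    change Matrix.vecMul _ _ = _
    rw [Matrix.smul_vecMul, h]

variable {w}

theorem mem_stateSpace {u : (X.mfd.pts → K) → R} :
    u ∈ stateSpace w X ↔ Matrix.vecMul u (stateSum w (𝟙 X)) = u := Iff.rfl

/-- Since `f ≫ 𝟙 = f`, the idempotent of the target fixes everything that has passed through a
cobordism, whether or not `u` itself was fixed. -/
theorem vecMul_mem (u : (X.mfd.pts → K) → R) (f : X ⟶ Y) :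
    Matrix.vecMul u (stateSum w f) ∈ stateSpace w Y := by
  rw [mem_stateSpace, Matrix.vecMul_vecMul, ← stateSum_comp, Category.comp_id]

theorem row_mem (f : X ⟶ Y) (b : X.mfd.pts → K) : stateSum w f b ∈ stateSpace w Y := by
  classical
  have := vecMul_mem (w := w) (Pi.single b 1) f
  rwa [Matrix.single_one_vecMul] at this

/-- A vector of the state space absorbs the idempotent contained in the permutation, which leaves a
pure substitution. The associators, unitors and braidings of `Bord` are permutations, so the
coherence conditions become identities between products of values. -/
theorem vecMul_perm {u : (X.mfd.pts → K) → R} (hu : u ∈ stateSpace w X)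
    (f : SEquiv X.mfd Y.mfd) (t : Y.mfd.pts → K) :
    Matrix.vecMul u (stateSum w (perm f : X ⟶ Y)) t = u (fun x => t (f.equiv x)) := by
  conv_rhs => rw [← mem_stateSpace.1 hu]
  simp only [Matrix.vecMul, dotProduct, stateSum_perm]

/-- The exterior product of functions on colourings. -/
def boxProd (u : (X.mfd.pts → K) → R) (u' : (Y.mfd.pts → K) → R) :
    ((X ⊗ Y).mfd.pts → K) → R :=
  fun b => u (fun x => b (.inl x)) * u' (fun y => b (.inr y))

omit [DecidableEq K] in
theorem sum_tensor (F : ((X ⊗ Y).mfd.pts → K) → R) :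
    ∑ b, F b = ∑ b, ∑ b', F (Sum.elim b b') := by
  let _ : Fintype (X.mfd.pts ⊕ Y.mfd.pts → K) := colouringFintype (X.mfd.sum Y.mfd)
  rw [← Fintype.sum_prod_type' (f := fun b b' => F (Sum.elim b b'))]
  exact Fintype.sum_equiv (Equiv.sumArrowEquivProdArrow X.mfd.pts Y.mfd.pts K) _ _ fun b =>
    congrArg F (Sum.elim_comp_inl_inr b).symm

theorem boxProd_vecMul (u : (X.mfd.pts → K) → R) (u' : (X'.mfd.pts → K) → R) (f : X ⟶ Y)
    (g : X' ⟶ Y') :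
    Matrix.vecMul (boxProd u u') (stateSum w (f ⊗ₘ g)) =
      boxProd (Matrix.vecMul u (stateSum w f)) (Matrix.vecMul u' (stateSum w g)) := by
  ext t
  simp only [boxProd, Matrix.vecMul, dotProduct]
  rw [sum_tensor, Fintype.sum_mul_sum]
  refine Fintype.sum_congr _ _ fun b => Fintype.sum_congr _ _ fun b' => ?_
  rw [stateSum_tensorHom]
  exact mul_mul_mul_comm _ _ _ _

theorem boxProd_mem {u : (X.mfd.pts → K) → R} {u' : (Y.mfd.pts → K) → R}
    (hu : u ∈ stateSpace w X) (hu' : u' ∈ stateSpace w Y) : boxProd u u' ∈ stateSpace w (X ⊗ Y) := by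
  rw [mem_stateSpace, ← id_tensorHom_id, boxProd_vecMul, hu, hu']

variable (w X Y)

/-- The exterior product, on state spaces. -/
def boxProdLin : stateSpace w X ⊗[R] stateSpace w Y →ₗ[R] stateSpace w (X ⊗ Y) :=
  TensorProduct.lift (LinearMap.mk₂ R (fun u u' => ⟨boxProd u.1 u'.1, boxProd_mem u.2 u'.2⟩)
    (fun _ _ _ => Subtype.ext (funext fun _ => add_mul _ _ _))
    (fun _ _ _ => Subtype.ext (funext fun _ => mul_assoc _ _ _))
    (fun _ _ _ => Subtype.ext (funext fun _ => mul_add _ _ _))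
    (fun _ _ _ => Subtype.ext (funext fun _ => mul_left_comm _ _ _)))

/-- The inverse of the exterior product. -/
def boxProdInv : stateSpace w (X ⊗ Y) →ₗ[R] stateSpace w X ⊗[R] stateSpace w Y where
  -- The values of `z` serve as coefficients against the rows of the two idempotents; these rows
  -- generate the state spaces.
  toFun z := ∑ b, ∑ b', z.1 (Sum.elim b b') •
    ((⟨_, row_mem (𝟙 X) b⟩ : stateSpace w X) ⊗ₜ[R] (⟨_, row_mem (𝟙 Y) b'⟩ : stateSpace w Y))
  map_add' z z' := by
    simp only [Submodule.coe_add, Pi.add_apply, add_smul, Finset.sum_add_distrib]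
  map_smul' r z := by
    simp only [Submodule.coe_smul, Pi.smul_apply, smul_eq_mul, mul_smul, Finset.smul_sum,
      RingHom.id_apply]

variable {w X Y}

/-- This is the equation `u = u * E` for the idempotent `E`, read row by row. It replaces a basis,
which a state space need not have. -/
theorem sum_smul_row (u : stateSpace w X) :
    ∑ b, u.1 b • (⟨_, row_mem (𝟙 X) b⟩ : stateSpace w X) = u := by
  refine Subtype.ext (funext fun t => ?_)
  conv_rhs => rw [← mem_stateSpace.1 u.2]
  simp [Matrix.vecMul, dotProduct]

variable (w X Y)

/-- The tensor product of state spaces is the state space of the disjoint union. -/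
def boxProdEquiv : (stateSpace w X ⊗[R] stateSpace w Y) ≃ₗ[R] stateSpace w (X ⊗ Y) :=
  LinearEquiv.ofLinearMap (boxProdLin w X Y) (boxProdInv w X Y)
    (by
      refine LinearMap.ext fun z => Subtype.ext (funext fun t => ?_)
      -- The idempotent of `X ⊗ Y` is the product of the idempotents of `X` and `Y`, so its action
      -- on `z` is exactly the sum in `boxProdInv`.
      conv_rhs => rw [LinearMap.id_apply, ← mem_stateSpace.1 z.2]
      simp only [Matrix.vecMul, dotProduct]
      rw [sum_tensor]
      simp only [LinearMap.comp_apply, boxProdInv, LinearMap.coe_mk, AddHom.coe_mk, map_sum,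
        map_smul, Submodule.coe_sum, Finset.sum_apply, Submodule.coe_smul, Pi.smul_apply,
        smul_eq_mul]
      refine Fintype.sum_congr _ _ fun b => Fintype.sum_congr _ _ fun b' => ?_
      rw [stateSum_id_tensor]
      rfl)
    (by
      refine TensorProduct.ext' fun u u' => ?_
      -- Expanding both factors in rows turns `u ⊗ u'` into the double sum that defines the inverse.
      conv_rhs => rw [LinearMap.id_apply, ← sum_smul_row u, ← sum_smul_row u']
      simp only [TensorProduct.sum_tmul, TensorProduct.tmul_sum, TensorProduct.smul_tmul_smul]
      rw [Finset.sum_comm]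
      rfl)

/-- The state sum of the empty manifold. -/
def unitEquiv : R ≃ₗ[R] stateSpace w (𝟙_ (Bord S)) where
  toFun r := ⟨fun _ => r, by
    let _ : Unique ((𝟙_ (Bord S)).mfd.pts → K) := inferInstanceAs (Unique (Empty → K))
    rw [mem_stateSpace]
    ext t
    have h : stateSum w (𝟙 (𝟙_ (Bord S))) default t = 1 :=
      (Pre.stateSum_perm (X := ZeroMfd.empty) w (SEquiv.refl ZeroMfd.empty) _ t).trans
        (Fintype.prod_empty (ι := Empty) _)
    simp only [Matrix.vecMul, dotProduct]
    rw [Fintype.sum_unique, h, mul_one]⟩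
  invFun u := u.1 Empty.elim
  left_inv r := rfl
  right_inv u := Subtype.ext (funext fun t => congrArg u.1 (funext fun x => x.elim))
  map_add' _ _ := rfl
  map_smul' _ _ := rfl

/-- The state sum functor. -/
def stateFunctor (S : Type v) (w : Weights R S K) : Bord S ⥤ SemimoduleCat.{u} R where
  obj X := SemimoduleCat.of R (stateSpace w X)
  map f := SemimoduleCat.ofHom
    ((Matrix.vecMulLinear (stateSum w f)).restrict fun u _ => vecMul_mem u f)
  map_id X := by
    ext u : 2
    exact Subtype.ext u.2
  map_comp f g := by
    ext u : 2
    refine Subtype.ext ?_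
    change Matrix.vecMul u.1 (stateSum w (f ≫ g)) =
      Matrix.vecMul (Matrix.vecMul u.1 (stateSum w f)) (stateSum w g)
    rw [stateSum_comp, Matrix.vecMul_vecMul]

/-- The form in which the comparison maps of `Cob.incl`, which are permutations, are evaluated
later. -/
theorem stateFunctor_map_perm (f : SEquiv X.mfd Y.mfd) (u : stateSpace w X) :
    ((stateFunctor S w).map (perm f : X ⟶ Y)).hom u =
      (⟨fun t => u.1 fun x => t (f.equiv x), by
        have := vecMul_mem (w := w) u.1 (perm f : X ⟶ Y)
        rwa [funext (vecMul_perm u.2 f)] at this⟩ : stateSpace w Y) :=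
  Subtype.ext (funext (vecMul_perm u.2 f))

/-- The state sum functor is monoidal. -/
def stateFunctorCore (S : Type v) (w : Weights R S K) : (stateFunctor S w).CoreMonoidal where
  εIso := (unitEquiv w).toModuleIsoₛ
  μIso X Y := (boxProdEquiv w X Y).toModuleIsoₛ
  μIso_hom_natural_left f X' := by
    refine SemimoduleCat.MonoidalCategory.tensor_ext fun u u' => Subtype.ext ?_
    refine Eq.trans ?_ (boxProd_vecMul (w := w) u.1 u'.1 f (𝟙 X')).symm
    -- The factor on which the cobordism is the identity is fixed by its idempotent, so only the
    -- action of `f` remains.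
    rw [mem_stateSpace.1 u'.2]
    rfl
  μIso_hom_natural_right X' f := by
    refine SemimoduleCat.MonoidalCategory.tensor_ext fun u u' => Subtype.ext ?_
    refine Eq.trans ?_ (boxProd_vecMul (w := w) u.1 u'.1 (𝟙 X') f).symm
    rw [mem_stateSpace.1 u.2]
    rfl
  associativity X Y Z := by
    refine SemimoduleCat.MonoidalCategory.tensor_ext₃' fun x y z => Subtype.ext ?_
    refine (funext (vecMul_perm (w := w) (X := (X ⊗ Y) ⊗ Z) (Y := X ⊗ (Y ⊗ Z))
      (boxProd_mem (boxProd_mem x.2 y.2) z.2) (SEquiv.assoc X.mfd Y.mfd Z.mfd))).trans ?_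
    exact funext fun t => mul_assoc _ _ _
  left_unitality X := by
    refine SemimoduleCat.MonoidalCategory.tensor_ext fun (r : R) x => Subtype.ext ?_
    exact (funext (vecMul_perm (w := w) (X := 𝟙_ (Bord S) ⊗ X) (Y := X)
      (boxProd_mem (unitEquiv w r).2 x.2) (SEquiv.emptySum X.mfd))).symm
  right_unitality X := by
    refine SemimoduleCat.MonoidalCategory.tensor_ext fun x (r : R) => Subtype.ext ?_
    refine Eq.trans ?_ (funext (vecMul_perm (w := w) (X := X ⊗ 𝟙_ (Bord S)) (Y := X)
      (boxProd_mem x.2 (unitEquiv w r).2) (SEquiv.sumEmpty X.mfd))).symm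
    exact funext fun t => mul_comm _ _

instance : (stateFunctor S w).Monoidal := (stateFunctorCore S w).toMonoidal

instance : (stateFunctor S w).Braided where
  braided X Y := by
    refine SemimoduleCat.MonoidalCategory.tensor_ext fun x y => Subtype.ext ?_
    refine (funext (vecMul_perm (w := w) (X := X ⊗ Y) (Y := Y ⊗ X)
      (boxProd_mem x.2 y.2) (SEquiv.swap X.mfd Y.mfd))).trans ?_
    exact funext fun t => mul_comm _ _

end Bord

end StateSpace
end
end OneCob

/-! ### State sums of the generating cobordisms -/

namespace OneCob
noncomputable section
open CategoryTheory MonoidalCategory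
open scoped TensorProduct

section Generators

variable {R : Type u} [CommSemiring R] {S : Type v} {K : Type} [Fintype K] [DecidableEq K]
variable (w : Weights R S K)

/-- With one interior vertex, a colouring is just the pair of its incoming colour `i` and its
outgoing colour `j`. -/
theorem Pre.stateSum_unit_vertex {X Y : ZeroMfd} (c : Pre S X Y) (φ : c.V ≃ Unit) [Fintype c.E]
    (b : X.pts → K) (t : Y.pts → K) :
    c.stateSum w b t = ∑ i, ∑ j, (∏ e, w.prop ((c.src e).colour (fun _ => j) b t)
      ((c.tgt e).colour (fun _ => i) b t)) * w.vert (c.kind (φ.symm ())) i j := by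
  classical
  let _ : Unique c.V := φ.unique
  rw [stateSum_apply, ← Fintype.sum_prod_type' (f := fun i j =>
    (∏ e, w.prop ((c.src e).colour (fun _ => j) b t)
      ((c.tgt e).colour (fun _ => i) b t)) * w.vert (c.kind (φ.symm ())) i j)]
  refine Fintype.sum_equiv (Equiv.funUnique c.V (K × K)) _ _ fun f => ?_
  have hf : f = fun _ => f default := funext fun v => congrArg f (Subsingleton.elim _ _)
  unfold weight
  rw [Fintype.prod_unique (ι := c.V), Subsingleton.elim (φ.symm ()) default, hf]
  rfl

theorem Pre.stateSum_no_vertex {X Y : ZeroMfd} (c : Pre S X Y) [IsEmpty c.V] [Fintype c.E]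
    (b : X.pts → K) (t : Y.pts → K) :
    c.stateSum w b t = ∏ e, w.prop ((c.src e).colour isEmptyElim b t)
      ((c.tgt e).colour isEmptyElim b t) := by
  have := Fintype.ofFinite c.V
  rw [stateSum_apply, Fintype.sum_unique]
  unfold weight
  rw [Fintype.prod_empty (ι := c.V), mul_one]
  refine Finset.prod_congr rfl fun e _ => ?_
  congr 2 <;> exact Subsingleton.elim _ _

namespace Cob

theorem stateSum_capPre (b : Fin 2 → K) (t : Fin 0 → K) :
    (capPre S).stateSum w b t = w.prop (b 1) (b 0) := by
  let _ : IsEmpty (capPre S).V := inferInstanceAs (IsEmpty Empty)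
  let _ : Fintype (capPre S).E := inferInstanceAs (Fintype Unit)
  exact (Pre.stateSum_no_vertex w (capPre S) b t).trans (Fintype.prod_unique (ι := Unit) _)

theorem stateSum_cupPre (b : Fin 0 → K) (t : Fin 2 → K) :
    (cupPre S).stateSum w b t = w.prop (t 1) (t 0) := by
  let _ : IsEmpty (cupPre S).V := inferInstanceAs (IsEmpty Empty)
  let _ : Fintype (cupPre S).E := inferInstanceAs (Fintype Unit)
  exact (Pre.stateSum_no_vertex w (cupPre S) b t).trans (Fintype.prod_unique (ι := Unit) _)

theorem stateSum_halfInPre (b : Fin 0 → K) (t : Fin 1 → K) :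
    (halfInPre S).stateSum w b t = ∑ i, ∑ j, w.prop j (t 0) * w.vert .source i j := by
  let _ : Fintype (halfInPre S).E := inferInstanceAs (Fintype Unit)
  refine (Pre.stateSum_unit_vertex w (halfInPre S) (Equiv.refl _) b t).trans ?_
  exact Fintype.sum_congr _ _ fun i => Fintype.sum_congr _ _ fun j =>
    congrArg (· * _) (Fintype.prod_unique (ι := Unit) _)

theorem stateSum_halfOutPre (b : Fin 1 → K) (t : Fin 0 → K) :
    (halfOutPre S).stateSum w b t = ∑ i, ∑ j, w.prop (b 0) i * w.vert .sink i j := by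
  let _ : Fintype (halfOutPre S).E := inferInstanceAs (Fintype Unit)
  refine (Pre.stateSum_unit_vertex w (halfOutPre S) (Equiv.refl _) b t).trans ?_
  exact Fintype.sum_congr _ _ fun i => Fintype.sum_congr _ _ fun j =>
    congrArg (· * _) (Fintype.prod_unique (ι := Unit) _)

theorem stateSum_dotPre (a : S) (b t : Fin 1 → K) :
    (dotPre a).stateSum w b t =
      ∑ i, ∑ j, w.prop j (t 0) * w.prop (b 0) i * w.vert (.defect a) i j := by
  let _ : Fintype (dotPre a).E := inferInstanceAs (Fintype Bool)
  refine (Pre.stateSum_unit_vertex w (dotPre a) (Equiv.refl _) b t).trans ?_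
  exact Fintype.sum_congr _ _ fun i => Fintype.sum_congr _ _ fun j =>
    congrArg (· * _) (Fintype.prod_bool _)

end Cob

end Generators

/-! ### The state sum functor of a datum realizes the datum -/

section Realization

variable {R : Type u} [CommSemiring R] {S : Type v} {K : Type} [Fintype K] [DecidableEq K]

/-- A presentation of a datum: its module as a retract of a free module on a finite pointed set. -/
structure Presentation (D : Datum R S) (K : Type) [Fintype K] [DecidableEq K] where
  ι : D.P →ₗ[R] (K → R)
  p : (K → R) →ₗ[R] D.P
  retract : ∀ x, p (ι x) = x
  base : K

/-- A retract of a free module is generated by the images of the standard basis. -/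
theorem eq_sum_of_retract {R : Type u} [CommSemiring R] {P : Type u} [AddCommMonoid P] [Module R P]
    {k : ℕ} (ι : P →ₗ[R] (Fin k → R)) (p : (Fin k → R) →ₗ[R] P) (h : p ∘ₗ ι = LinearMap.id)
    (x : P) : x = ∑ i, ι x i • p (Pi.single i 1) := by
  conv_lhs => rw [← LinearMap.id_apply (R := R) x, ← h, LinearMap.comp_apply,
    ← Finset.univ_sum_single (ι x), map_sum]
  refine Fintype.sum_congr _ _ fun i => ?_
  rw [← map_smul, ← Pi.single_smul', smul_eq_mul, mul_one]

namespace Presentation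

variable {D : Datum R S} (r : Presentation D K)

theorem sum_smul (g : K → R) : ∑ j, g j • r.p (Pi.single j 1) = r.p g := by
  simp only [← map_smul, ← map_sum]
  congr 1
  ext i
  simp [Pi.single_apply]

/-- By linearity the left side is `h (p (ι x))`, and `p ∘ ι` is the identity. This identity gives
the idempotence of the edge weights and the values of the generators. -/
theorem sum_mul_map {M : Type*} [AddCommMonoid M] [Module R M] (h : D.P →ₗ[R] M) (x : D.P) :
    ∑ j, r.ι x j • h (r.p (Pi.single j 1)) = h x := by
  simp only [← map_smul, ← map_sum]
  rw [map_sum]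
  simp only [map_smul]
  rw [r.sum_smul, r.retract]

theorem sum_mul_ι (x : D.P) (l : K) :
    ∑ j, r.ι x j * r.ι (r.p (Pi.single j 1)) l = r.ι x l :=
  r.sum_mul_map (LinearMap.proj l ∘ₗ r.ι) x

/-- The local weights of a presented datum. -/
def weights : Weights R S K where
  prop i j := r.ι (r.p (Pi.single i 1)) j
  vert
    | .plain, i, j => if i = j then 1 else 0
    | .defect a, i, j => r.ι (D.op a (r.p (Pi.single i 1))) j
    -- An endpoint carries only one edge, while every vertex is coloured by a pair. The colour of
    -- the absent edge is pinned to `base`, so that it contributes one term instead of one for each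
    -- element of `K`.
    | .source, i, j => if i = r.base then r.ι D.vec j else 0
    | .sink, i, j => if j = r.base then D.covec (r.p (Pi.single i 1)) else 0
  prop_prop _ _ := r.sum_mul_ι _ _
  vert_plain _ _ := rfl

theorem weights_prop (i j : K) : r.weights.prop i j = r.ι (r.p (Pi.single i 1)) j := rfl

theorem halfIn_eq (b : Fin 0 → K) (t : Fin 1 → K) :
    (Cob.halfInPre S).stateSum r.weights b t = r.ι D.vec (t 0) := by
  rw [Cob.stateSum_halfInPre, Finset.sum_comm]
  conv_rhs => rw [← r.sum_mul_ι]
  refine Fintype.sum_congr _ _ fun j => ?_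
  simp only [weights, mul_ite, mul_zero, Finset.sum_ite_eq', Finset.mem_univ, if_true]
  exact mul_comm _ _

theorem halfOut_eq (b : Fin 1 → K) (t : Fin 0 → K) :
    (Cob.halfOutPre S).stateSum r.weights b t = D.covec (r.p (Pi.single (b 0) 1)) := by
  rw [Cob.stateSum_halfOutPre, ← r.sum_mul_map D.covec]
  refine Fintype.sum_congr _ _ fun j => ?_
  simp only [weights, mul_ite, mul_zero, Finset.sum_ite_eq', Finset.mem_univ, if_true, smul_eq_mul]

/-- The two edges contribute the idempotent `ι ∘ p` on either side of `ι ∘ m_a ∘ p`, and both copies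
are absorbed. -/
theorem dot_eq (a : S) (b t : Fin 1 → K) :
    (Cob.dotPre a).stateSum r.weights b t =
      r.ι (D.op a (r.p (Pi.single (b 0) 1))) (t 0) := by
  rw [Cob.stateSum_dotPre]
  have h := r.sum_mul_map (LinearMap.proj (t 0) ∘ₗ r.ι ∘ₗ D.op a) (r.p (Pi.single (b 0) 1))
  refine Eq.trans ?_ h
  refine Fintype.sum_congr _ _ fun i => ?_
  simp only [weights, LinearMap.comp_apply, LinearMap.proj_apply, smul_eq_mul]
  rw [← r.sum_mul_ι (D.op a _), Finset.mul_sum]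
  exact Fintype.sum_congr _ _ fun j => by ring

attribute [local instance] colouringFintype

omit [DecidableEq K] in
theorem vecMul_singleton {B : Type} (_ : Fintype (Fin 1 → K)) (u : (Fin 1 → K) → R)
    (M : Matrix (Fin 1 → K) B R) (t : B) :
    Matrix.vecMul u M t = ∑ i, u (fun _ => i) * M (fun _ => i) t := by
  refine Fintype.sum_equiv (Equiv.funUnique (Fin 1) K) _ _ fun b => ?_
  have hb : b = fun _ => b 0 := funext fun _ => congrArg b (Subsingleton.elim _ _)
  rw [hb]
  rfl

theorem stateSum_id_pos (b t : Fin 1 → K) :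
    Bord.stateSum r.weights (𝟙 (Cob.plus S).toBord) b t = r.ι (r.p (Pi.single (b 0) 1)) (t 0) := by
  refine (Pre.stateSum_perm r.weights (SEquiv.refl (ZeroMfd.ofSeq [Sgn.pos])) b t).trans ?_
  exact Fintype.prod_unique (ι := Fin 1) _

theorem stateSum_id_neg (b t : Fin 1 → K) :
    Bord.stateSum r.weights (𝟙 (Cob.minus S).toBord) b t = r.ι (r.p (Pi.single (t 0) 1)) (b 0) := by
  refine (Pre.stateSum_perm r.weights (SEquiv.refl (ZeroMfd.ofSeq [Sgn.neg])) b t).trans ?_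
  exact Fintype.prod_unique (ι := Fin 1) _

/-- The state space of the positive point is the module of the datum. -/
def posEquiv : Bord.stateSpace r.weights (Cob.plus S).toBord ≃ₗ[R] D.P where
  toFun u := r.p fun i => u.1 fun _ => i
  map_add' _ _ := map_add r.p _ _
  map_smul' a _ := map_smul r.p a _
  -- A vector in the image of `ι` is fixed by `ι ∘ p`.
  invFun x := ⟨fun b => r.ι x (b ⟨0, Nat.zero_lt_one⟩), by
    rw [Bord.mem_stateSpace]
    ext t
    refine (vecMul_singleton _ _ _ _).trans (Eq.trans (Fintype.sum_congr _ _ fun i => ?_) (r.sum_mul_ι _ _))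
    exact congrArg (r.ι x i * ·) (r.stateSum_id_pos (fun _ => i) t)⟩
  left_inv u := by
    refine Subtype.ext (funext fun t => ?_)
    conv_rhs => rw [← Bord.mem_stateSpace.1 u.2]
    refine Eq.trans ?_ (vecMul_singleton _ _ _ _).symm
    change r.ι (r.p _) _ = _
    -- `ι (p u)` is the row vector `u` times the idempotent, which fixes `u`.
    rw [← r.sum_smul, map_sum, Finset.sum_apply]
    refine Fintype.sum_congr _ _ fun i => ?_
    rw [map_smul]
    exact congrArg (u.1 (fun _ => i) * ·) (r.stateSum_id_pos (fun _ => i) t).symm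
  right_inv x := r.retract x

/-- The state space of the negative point is the dual of the module of the datum. -/
def negEquiv : Bord.stateSpace r.weights (Cob.minus S).toBord ≃ₗ[R] Module.Dual R D.P where
  -- The negative strand carries the transposed idempotent. A fixed vector is read as coefficients
  -- of the coordinate functionals of `ι`; conversely a functional is recorded by its values on the
  -- generators `p eᵢ`.
  toFun u := ∑ i, (u.1 fun _ => i) • (LinearMap.proj i ∘ₗ r.ι)
  map_add' u u' := by simp [add_smul, Finset.sum_add_distrib]
  map_smul' a u := by simp [mul_smul, Finset.smul_sum]
  invFun f := ⟨fun b => f (r.p (Pi.single (b ⟨0, Nat.zero_lt_one⟩) 1)), by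
    rw [Bord.mem_stateSpace]
    ext t
    refine (vecMul_singleton _ _ _ _).trans (Eq.trans (Fintype.sum_congr _ _ fun i => ?_) (r.sum_mul_map f _))
    refine (congrArg (f (r.p (Pi.single i 1)) * ·)
      (r.stateSum_id_neg (fun _ => i) t)).trans (mul_comm _ _)⟩
  left_inv u := by
    refine Subtype.ext (funext fun t => ?_)
    conv_rhs => rw [← Bord.mem_stateSpace.1 u.2]
    refine Eq.trans ?_ (vecMul_singleton _ _ _ _).symm
    change (∑ i, (u.1 fun _ => i) • (LinearMap.proj i ∘ₗ r.ι) : Module.Dual R D.P) _ = _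
    rw [LinearMap.sum_apply]
    refine Fintype.sum_congr _ _ fun i => ?_
    exact congrArg (u.1 (fun _ => i) * ·) (r.stateSum_id_neg (fun _ => i) t).symm
  right_inv f := by
    ext x
    rw [LinearMap.sum_apply, ← r.sum_mul_map f x]
    exact Fintype.sum_congr _ _ fun i => mul_comm _ _

/-- The state sum TQFT of a presented datum. -/
def tqft : TQFT R S where
  F := Cob.incl S ⋙ Bord.stateFunctor S r.weights

/-- The value of the state sum TQFT on the positive point. -/
def posIso : r.tqft.F.obj (Cob.plus S) ≅ SemimoduleCat.of R D.P := r.posEquiv.toModuleIsoₛ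

/-- The value of the state sum TQFT on the negative point. -/
def negIso : r.tqft.F.obj (Cob.minus S) ≅ SemimoduleCat.of R (Module.Dual R D.P) :=
  r.negEquiv.toModuleIsoₛ

open Functor.LaxMonoidal Functor.OplaxMonoidal

theorem ε_apply (a : R) (b : Fin 0 → K) :
    ((ε r.tqft.F).hom a : Bord.stateSpace r.weights (𝟙_ (Cob S)).toBord).1 b = a := by
  exact congrFun (congrArg Subtype.val (Bord.stateFunctor_map_perm (w := r.weights)
    (X := 𝟙_ (Bord S)) (Y := (𝟙_ (Cob S)).toBord) SEquiv.nil (Bord.unitEquiv _ a))) b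

/-- The tensor comparison of the composite functor is the exterior product followed by the
permutation that renumbers a disjoint union as a concatenation. -/
theorem μ_apply (X Y : Cob S) (x : Bord.stateSpace r.weights X.toBord)
    (y : Bord.stateSpace r.weights Y.toBord) (b : Fin (X.seq ++ Y.seq).length → K) :
    ((μ r.tqft.F X Y).hom (x ⊗ₜ[R] y) : Bord.stateSpace r.weights (X ⊗ Y).toBord).1 b =
      x.1 (fun i => b ((SEquiv.append X.seq Y.seq).equiv (.inl i))) *
        y.1 (fun i => b ((SEquiv.append X.seq Y.seq).equiv (.inr i))) := by
  exact congrFun (congrArg Subtype.val (Bord.stateFunctor_map_perm (w := r.weights)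
    (X := X.toBord ⊗ Y.toBord) (Y := (X ⊗ Y).toBord) (SEquiv.append X.seq Y.seq)
    ⟨_, Bord.boxProd_mem x.2 y.2⟩)) b

theorem map_apply {X Y : Cob S} (f : X ⟶ Y) (x : Bord.stateSpace r.weights X.toBord)
    [i : Fintype (Fin X.seq.length → K)] (t : Fin Y.seq.length → K) :
    ((r.tqft.F.map f).hom x : Bord.stateSpace r.weights Y.toBord).1 t =
      ∑ b : Fin X.seq.length → K, x.1 b * Hom.stateSum r.weights f b t := by
  obtain rfl : i = colouringFintype X.toBord.mfd := Subsingleton.elim _ _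
  rfl

/-- The sum over the two boundary colours is `∑ f (p eᵢ) ι(x)_j ι(p e_j)_i`, and two uses of the
retraction reduce it to `f x`. With `ε` on the right instead of `η` on the left, only structure maps
with explicit formulas occur. -/
theorem map_cap :
    (r.negIso.inv ⊗ₘ r.posIso.inv) ≫ μ r.tqft.F _ _ ≫
      r.tqft.F.map (Cob.cap S) = SemimoduleCat.ofHom (contractLeft R D.P) ≫ ε r.tqft.F := by
  refine SemimoduleCat.MonoidalCategory.tensor_ext
    fun (f : Module.Dual R D.P) (x : D.P) => Subtype.ext (funext fun t => ?_)
  refine Eq.trans ?_ (r.ε_apply (f x) t).symm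
  refine (r.map_apply (X := Cob.minus S ⊗ Cob.plus S) (Cob.cap S) _ t).trans ?_
  have h : ∀ b : Fin 2 → K, ((μ r.tqft.F (Cob.minus S) (Cob.plus S)).hom
      (r.negEquiv.symm f ⊗ₜ[R] r.posEquiv.symm x) : Bord.stateSpace r.weights _).1 b =
      f (r.p (Pi.single (b 0) 1)) * r.ι x (b 1) := fun b =>
    r.μ_apply (Cob.minus S) (Cob.plus S) (r.negEquiv.symm f) (r.posEquiv.symm x) b
  refine (Fintype.sum_congr (α := Fin 2 → K) _ _ fun b => congrArg₂ (· * ·) (h b)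
    (Cob.stateSum_capPre r.weights b t)).trans ?_
  refine (Fintype.sum_equiv (finTwoArrowEquiv K) _ (fun q => f (r.p (Pi.single q.1 1)) *
    r.ι x q.2 * r.weights.prop q.2 q.1) fun b => rfl).trans ?_
  rw [Fintype.sum_prod_type, ← r.sum_mul_map f x]
  refine Fintype.sum_congr _ _ fun i => ?_
  rw [← r.sum_mul_ι x i, smul_eq_mul, Finset.sum_mul]
  exact Fintype.sum_congr _ _ fun j => by rw [weights_prop]; ring

/-- The cup has state sum `ι (p e_{t 1})` at `t 0`. Expanding `p e_{t 1}` in the generators of an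
arbitrary second retraction `(ι', p')` produces the coevaluation formed from that retraction. -/
theorem map_cup {k : ℕ} (ι' : D.P →ₗ[R] (Fin k → R)) (p' : (Fin k → R) →ₗ[R] D.P)
    (h' : p' ∘ₗ ι' = LinearMap.id) :
    ε r.tqft.F ≫ r.tqft.F.map (Cob.cup S) = SemimoduleCat.ofHom (coev ι' p') ≫
      (r.posIso.inv ⊗ₘ r.negIso.inv) ≫ μ r.tqft.F _ _ := by
  refine SemimoduleCat.hom_ext (LinearMap.ext_ring (Subtype.ext (funext fun (t : Fin 2 → K) => ?_)))
  refine (r.map_apply (X := 𝟙_ (Cob S)) (Y := Cob.plus S ⊗ Cob.minus S) (Cob.cup S) _ t).trans ?_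
  refine (Fintype.sum_congr (α := Fin 0 → K) _ _ fun b => congrArg₂ (· * ·) (r.ε_apply 1 b)
    (Cob.stateSum_cupPre r.weights b t)).trans ?_
  rw [Fintype.sum_unique, one_mul]
  have h : ∀ (x : D.P) (f : Module.Dual R D.P),
      ((μ r.tqft.F (Cob.plus S) (Cob.minus S)).hom
        (r.posEquiv.symm x ⊗ₜ[R] r.negEquiv.symm f) : Bord.stateSpace r.weights _).1 t =
      r.ι x (t 0) * f (r.p (Pi.single (t 1) 1)) := fun x f =>
    r.μ_apply (Cob.plus S) (Cob.minus S) (r.posEquiv.symm x) (r.negEquiv.symm f) t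
  -- `Ψ` evaluates the right-hand side at the colouring `t`; being linear, it can be computed on the
  -- pure tensors of the coevaluation.
  let Ψ : D.P ⊗[R] Module.Dual R D.P →ₗ[R] R :=
    LinearMap.proj t ∘ₗ (Bord.stateSpace r.weights _).subtype ∘ₗ
      (μ r.tqft.F (Cob.plus S) (Cob.minus S)).hom ∘ₗ (r.posIso.inv ⊗ₘ r.negIso.inv).hom
  change _ = Ψ (coev ι' p' 1)
  have hΨ : ∀ (x : D.P) (f : Module.Dual R D.P), Ψ (x ⊗ₜ[R] f) =
      r.ι x (t 0) * f (r.p (Pi.single (t 1) 1)) := h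
  rw [coev, LinearMap.toSpanSingleton_apply, one_smul, map_sum]
  simp only [hΨ, weights_prop]
  have h₂ := eq_sum_of_retract ι' p' h'
  conv_lhs => rw [h₂ (r.p _)]
  simp only [map_sum, map_smul, Finset.sum_apply, Pi.smul_apply, smul_eq_mul]
  exact Fintype.sum_congr _ _ fun i => mul_comm _ _

theorem map_halfIn :
    ε r.tqft.F ≫ r.tqft.F.map (Cob.halfIn S) ≫ r.posIso.hom =
      SemimoduleCat.ofHom (LinearMap.toSpanSingleton R D.P D.vec) := by
  rw [← Category.assoc, ← Iso.eq_comp_inv]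
  refine SemimoduleCat.hom_ext (LinearMap.ext_ring (Subtype.ext (funext fun (t : Fin 1 → K) => ?_)))
  refine (r.map_apply (X := 𝟙_ (Cob S)) (Y := Cob.plus S) (Cob.halfIn S) _ t).trans ?_
  refine (Fintype.sum_congr (α := Fin 0 → K) _ _ fun b => congrArg₂ (· * ·) (r.ε_apply 1 b)
    (r.halfIn_eq b t)).trans ?_
  rw [Fintype.sum_unique, one_mul]
  exact congrArg (fun x => r.ι x (t 0)) (one_smul R D.vec).symm

theorem map_halfOut :
    r.posIso.inv ≫ r.tqft.F.map (Cob.halfOut S) =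
      SemimoduleCat.ofHom D.covec ≫ ε r.tqft.F := by
  refine SemimoduleCat.hom_ext (LinearMap.ext fun (x : D.P) =>
    Subtype.ext (funext fun (t : Fin 0 → K) => ?_))
  refine Eq.trans ?_ (r.ε_apply (D.covec x) t).symm
  refine (r.map_apply (X := Cob.plus S) (Y := 𝟙_ (Cob S)) (Cob.halfOut S) _ t).trans ?_
  rw [← r.sum_mul_map D.covec x]
  refine Fintype.sum_equiv (Equiv.funUnique (Fin 1) K) _ _ fun b => ?_
  exact congrArg₂ (· * ·) rfl (r.halfOut_eq b t)

theorem map_dot (a : S) :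
    r.posIso.inv ≫ r.tqft.F.map (Cob.dot a) ≫ r.posIso.hom =
      SemimoduleCat.ofHom (D.op a) := by
  rw [← Category.assoc, ← Iso.eq_comp_inv]
  refine SemimoduleCat.hom_ext (LinearMap.ext fun (x : D.P) =>
    Subtype.ext (funext fun (t : Fin 1 → K) => ?_))
  refine (r.map_apply (X := Cob.plus S) (Y := Cob.plus S) (Cob.dot a) _ t).trans ?_
  refine Eq.trans ?_ (r.sum_mul_map (LinearMap.proj (t 0) ∘ₗ r.ι ∘ₗ D.op a) x)
  refine Fintype.sum_equiv (Equiv.funUnique (Fin 1) K) _ _ fun b => ?_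
  exact congrArg₂ (· * ·) rfl (r.dot_eq a b t)

theorem realizes : Realizes r.tqft D := by
  refine ⟨r.posIso, r.negIso, ?_, fun k ι' p' h' => ?_,
    r.map_halfIn, ?_, r.map_dot⟩
  · have h := congrArg (· ≫ η r.tqft.F) r.map_cap
    simp only [Category.assoc] at h
    exact h.trans ((Category.assoc _ _ _).trans
      ((congrArg _ (Functor.Monoidal.ε_η _)).trans (Category.comp_id _)))
  · have h := congrArg (· ≫ δ r.tqft.F _ _ ≫ (r.posIso.hom ⊗ₘ r.negIso.hom)) (r.map_cup ι' p' h')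
    simp only [Category.assoc] at h
    refine h.trans (Eq.trans (congrArg (SemimoduleCat.ofHom (coev ι' p') ≫ ·) ?_)
      (Category.comp_id _))
    have h₂ : ((r.posIso.inv ⊗ₘ r.negIso.inv) ≫ μ r.tqft.F (Cob.plus S) (Cob.minus S)) ≫
        δ r.tqft.F (Cob.plus S) (Cob.minus S) ≫ (r.posIso.hom ⊗ₘ r.negIso.hom) = 𝟙 _ := by
      simp
    exact (Category.assoc _ _ _).symm.trans h₂
  · have h := congrArg (· ≫ η r.tqft.F) r.map_halfOut
    simp only [Category.assoc] at h
    exact h.trans ((congrArg _ (Functor.Monoidal.ε_η _)).trans (Category.comp_id _))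

end Presentation

/-- Every datum has a presentation. -/
theorem Datum.exists_presentation (D : Datum R S) :
    ∃ k : ℕ, Nonempty (Presentation D (Option (Fin k))) := by
  obtain ⟨k, ι, p, h⟩ := D.fgProjective
  -- The extra colour `none` carries the zero coordinate and is ignored by `p`; it supplies the base
  -- colour even when `k = 0`.
  refine ⟨k, ⟨⟨LinearMap.pi fun o => o.elim 0 fun i => LinearMap.proj i ∘ₗ ι,
    p ∘ₗ LinearMap.funLeft R R some, fun x => ?_, none⟩⟩⟩
  exact LinearMap.congr_fun h x

theorem exists_realizes_of_datum (D : Datum R S) : ∃ F : TQFT R S, Realizes F D := by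
  obtain ⟨k, ⟨r⟩⟩ := D.exists_presentation
  exact ⟨r.tqft, r.realizes⟩

end Realization
end
end OneCob

/-! ### Cutting out an interior vertex -/

namespace OneCob
noncomputable section
open CategoryTheory MonoidalCategory

instance : Finite Sgn :=
  Finite.of_surjective (fun b : Bool => bif b then Sgn.pos else Sgn.neg) (by
    rintro (_ | _)
    · exact ⟨true, rfl⟩
    · exact ⟨false, rfl⟩)

section CapOff

variable {S : Type v} {X Y Z X' Y' : ZeroMfd}

/-- Whether a vertex of the given kind has a flag of the given sign. -/
def Kind.HasFlag (κ : Kind S) : Sgn → Prop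
  | .pos => κ.Absorbs
  | .neg => κ.Emits

/-- The boundary of a small neighbourhood of a vertex of the given kind: a positive point if an
edge arrives at the vertex, and a negative point if an edge leaves it. -/
abbrev Kind.flags (κ : Kind S) : ZeroMfd := ⟨{s : Sgn // κ.HasFlag s}, Subtype.val⟩

/-- Attach the second part of the top boundary to a new interior vertex. -/
def Node.capOff {V A B C : Type} : Node V A (B ⊕ C) → Node (Option V) A B
  | .inner v => .inner (some v)
  | .bot x => .bot x
  | .top (.inl y) => .top y
  | .top (.inr _) => .inner none

namespace Node
variable {V V' A B C : Type}

@[simp] theorem capOff_inner (v : V) :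
    (inner v : Node V A (B ⊕ C)).capOff = inner (some v) := rfl
@[simp] theorem capOff_bot (x : A) : (bot x : Node V A (B ⊕ C)).capOff = bot x := rfl
@[simp] theorem capOff_top_inl (y : B) :
    (top (.inl y) : Node V A (B ⊕ C)).capOff = top y := rfl
@[simp] theorem capOff_top_inr (z : C) :
    (top (.inr z) : Node V A (B ⊕ C)).capOff = inner none := rfl

@[simp] theorem capOff_eq_some (n : Node V A (B ⊕ C)) (v : V) :
    n.capOff = inner (some v) ↔ n = inner v := by
  rcases n with _ | _ | _ | _ <;> simp
@[simp] theorem capOff_eq_none (n : Node V A (B ⊕ C)) :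
    n.capOff = inner none ↔ ∃ z, n = top (.inr z) := by
  rcases n with _ | _ | _ | _ <;> simp
@[simp] theorem capOff_eq_bot (n : Node V A (B ⊕ C)) (x : A) :
    n.capOff = bot x ↔ n = bot x := by
  rcases n with _ | _ | _ | _ <;> simp
@[simp] theorem capOff_eq_top (n : Node V A (B ⊕ C)) (y : B) :
    n.capOff = top y ↔ n = top (.inl y) := by
  rcases n with _ | _ | _ | _ <;> simp

theorem capOff_map (φ : V → V') (n : Node V A (B ⊕ C)) :
    (n.map φ id id).capOff = n.capOff.map (Option.map φ) id id := by
  rcases n with _ | _ | _ | _ <;> rfl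

/-- The only points that capping off can merge are those of the second part of the top boundary. -/
theorem eq_of_capOff_eq {n m : Node V A (B ⊕ C)} (h : n.capOff = m.capOff)
    (h' : ∀ z z', n = top (.inr z) → m = top (.inr z') → z = z') : n = m := by
  rcases n with _ | _ | _ | z <;> rcases m with _ | _ | _ | z' <;> simp_all

end Node

namespace Pre

/-- Attach the flags at the top boundary of a cobordism to a new vertex of the given kind. -/
def capOff {κ : Kind S} (a : Pre S X (Y.sum κ.flags)) : Pre S X Y where
  V := Option a.V
  E := a.E
  kind v := v.elim κ a.kind
  src e := (a.src e).capOff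
  tgt e := (a.tgt e).capOff
  src_inj := by
    intro e e' H
    -- An edge that starts at a flag starts at a negative one, and there is at most one negative
    -- flag; so at most one edge leaves the new vertex.
    refine a.src_inj (Node.eq_of_capOff_eq H fun z z' h h' => Subtype.ext ?_)
    exact ((a.src_iff _).1 ⟨e, h⟩).trans ((a.src_iff _).1 ⟨e', h'⟩).symm
  tgt_inj := by
    intro e e' H
    refine a.tgt_inj (Node.eq_of_capOff_eq H fun z z' h h' => Subtype.ext ?_)
    exact ((a.tgt_iff _).1 ⟨e, h⟩).trans ((a.tgt_iff _).1 ⟨e', h'⟩).symm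
  src_iff := by
    have h := a.src_iff
    rintro ((_ | v) | x | y)
    · simp only [Node.capOff_eq_none, Node.emits_inner, Option.elim]
      constructor
      · rintro ⟨e, ⟨s, hs⟩, he⟩
        obtain rfl : s = Sgn.neg := (h _).1 ⟨e, he⟩
        exact hs
      · intro hκ
        obtain ⟨e, he⟩ := (h (.top (.inr ⟨Sgn.neg, hκ⟩))).2 rfl
        exact ⟨e, _, he⟩
    · exact Iff.trans (by simp) (h (.inner v))
    · exact Iff.trans (by simp) (h (.bot x))
    · exact Iff.trans (by simp) (h (.top (.inl y)))
  tgt_iff := by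
    have h := a.tgt_iff
    rintro ((_ | v) | x | y)
    · simp only [Node.capOff_eq_none, Node.absorbs_inner, Option.elim]
      constructor
      · rintro ⟨e, ⟨s, hs⟩, he⟩
        obtain rfl : s = Sgn.pos := (h _).1 ⟨e, he⟩
        exact hs
      · intro hκ
        obtain ⟨e, he⟩ := (h (.top (.inr ⟨Sgn.pos, hκ⟩))).2 rfl
        exact ⟨e, _, he⟩
    · exact Iff.trans (by simp) (h (.inner v))
    · exact Iff.trans (by simp) (h (.bot x))
    · exact Iff.trans (by simp) (h (.top (.inl y)))

/-- Exchange two added elements. -/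
def optOptSwap (A : Type) : Option (Option A) ≃ Option (Option A) where
  toFun
    | none => some none
    | some none => none
    | some (some a) => some (some a)
  invFun
    | none => some none
    | some none => none
    | some (some a) => some (some a)
  left_inv := by rintro (_ | _ | _) <;> rfl
  right_inv := by rintro (_ | _ | _) <;> rfl

/-- Capping off thus descends to cobordisms. When a subdivision is involved, the cap vertex and the
subdivision vertex are added in opposite orders, and `optOptSwap` exchanges them. -/
theorem capOff_rel {κ : Kind S} {a a' : Pre S X (Y.sum κ.flags)} (h : Rel a a') :
    a.capOff.toHom = a'.capOff.toHom := by
  cases h with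
  | iso h =>
    obtain ⟨φ, ψ, hk, hs, ht⟩ := h
    refine Iso.toHom_eq ⟨Equiv.optionCongr φ, ψ, ?_, fun e => ?_, fun e => ?_⟩
    · rintro (_ | v)
      · rfl
      · exact hk v
    · exact (congrArg Node.capOff (hs e)).trans (Node.capOff_map _ _)
    · exact (congrArg Node.capOff (ht e)).trans (Node.capOff_map _ _)
  | subdivide _ e₀ =>
    have k : ∀ n : Node a'.V X.pts (Y.sum κ.flags).pts,
        (n.capOff.map some id id : Node (Option (Option a'.V)) X.pts Y.pts) =
          (n.map some id id).capOff.map (optOptSwap a'.V) id id := by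
      rintro (_ | _ | _ | _) <;> rfl
    suffices key : Iso (a'.subdivide e₀).capOff (a'.capOff.subdivide e₀) from
      key.toHom_eq.trans (subdivide_toHom a'.capOff e₀)
    refine ⟨optOptSwap a'.V, Equiv.refl _, ?_, ?_, ?_⟩
    · rintro (_ | _ | v) <;> rfl
    · rintro (_ | e)
      · rfl
      · exact k (a'.src e)
    · rintro (_ | e)
      · exact k (a'.tgt e₀)
      · by_cases h : e = e₀
        · subst h
          exact (subdivide_tgt_self a'.capOff e).trans (congrArg (fun n =>
            (Node.capOff n).map (optOptSwap a'.V) id id) (subdivide_tgt_self a' e)).symm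
        · exact (subdivide_tgt_of_ne a'.capOff h).trans ((k (a'.tgt e)).trans
            (congrArg (fun n => (Node.capOff n).map (optOptSwap a'.V) id id)
              (subdivide_tgt_of_ne a' h)).symm)

end Pre

namespace Node

/-- The initial vertex of the flag of the given sign at a vertex. -/
def flagSrc {A : Type} (s : Sgn) (x : A) : Node Unit A Empty :=
  match s with
  | .pos => bot x
  | .neg => inner ()

/-- The terminal vertex of the flag of the given sign at a vertex. -/
def flagTgt {A : Type} (s : Sgn) (x : A) : Node Unit A Empty :=
  match s with
  | .pos => inner ()
  | .neg => bot x

end Node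

namespace Pre

/-- A neighbourhood of a vertex of the given kind. -/
def star (κ : Kind S) : Pre S κ.flags ZeroMfd.empty where
  V := Unit
  E := κ.flags.pts
  kind _ := κ
  src z := Node.flagSrc z.1 z
  tgt z := Node.flagTgt z.1 z
  src_inj := by
    rintro ⟨_ | _, _⟩ ⟨_ | _, _⟩ h <;> simp_all [Node.flagSrc]
  tgt_inj := by
    rintro ⟨_ | _, _⟩ ⟨_ | _, _⟩ h <;> simp_all [Node.flagTgt]
  src_iff := by
    rintro (_ | ⟨_ | _, hs⟩ | y)
    · constructor
      · rintro ⟨⟨_ | _, hs⟩, h⟩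
        · cases h
        · exact hs
      · exact fun h => ⟨⟨Sgn.neg, h⟩, rfl⟩
    · exact iff_of_true ⟨⟨Sgn.pos, hs⟩, rfl⟩ rfl
    · refine iff_of_false ?_ fun h : Sgn.neg = Sgn.pos => nomatch h
      rintro ⟨⟨_ | _, hs⟩, h⟩ <;> cases h
    · exact y.elim
  tgt_iff := by
    rintro (_ | ⟨_ | _, hs⟩ | y)
    · constructor
      · rintro ⟨⟨_ | _, hs⟩, h⟩
        · exact hs
        · cases h
      · exact fun h => ⟨⟨Sgn.pos, h⟩, rfl⟩
    · refine iff_of_false ?_ fun h : Sgn.pos = Sgn.neg => nomatch h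
      rintro ⟨⟨_ | _, hs⟩, h⟩ <;> cases h
    · exact iff_of_true ⟨⟨Sgn.neg, hs⟩, rfl⟩ rfl
    · exact y.elim

/-- After an identity collar has been glued on, the collar strands over the flags are the edges of
the star. Capping off these strands and gluing the star therefore produce the same cells. -/
theorem capOff_comp_id {κ : Kind S} (a : Pre S X (Y.sum κ.flags)) :
    Iso (a.comp (perm S (SEquiv.refl _))).capOff
      ((a.comp ((perm S (SEquiv.refl Y)).tensor (star κ))).relabel (SEquiv.refl X)
        (SEquiv.sumEmpty Y)) := by
  let φ : Option (a.V ⊕ Empty ⊕ (Y.pts ⊕ κ.flags.pts)) ≃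
      a.V ⊕ (Empty ⊕ Unit) ⊕ (Y.pts ⊕ κ.flags.pts) :=
    { toFun
        | none => .inr (.inl (.inr ()))
        | some (.inl v) => .inl v
        | some (.inr (.inr y)) => .inr (.inr y)
      invFun
        | .inr (.inl (.inr ())) => none
        | .inl v => some (.inl v)
        | .inr (.inr y) => some (.inr (.inr y))
      left_inv := by rintro (_ | _ | v | _) <;> first | rfl | exact v.elim
      right_inv := by rintro (_ | (v | _) | _) <;> first | rfl | exact v.elim }
  have k : ∀ n : Node a.V X.pts (Y.sum κ.flags).pts,
      (lower n : Node (a.V ⊕ (Empty ⊕ Unit) ⊕ (Y.pts ⊕ κ.flags.pts)) X.pts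
        (Y.pts ⊕ Empty)).map id id (Equiv.sumEmpty _ Empty) =
      (lower n : Node (a.V ⊕ Empty ⊕ (Y.pts ⊕ κ.flags.pts)) X.pts
        (Y.pts ⊕ κ.flags.pts)).capOff.map φ id id := by
    rintro (_ | _ | _) <;> rfl
  refine ⟨φ, Equiv.refl _, ?_, ?_, ?_⟩
  · rintro (_ | _ | v | _) <;> first | rfl | exact v.elim
  · rintro (e | y | ⟨_ | _, hs⟩)
    · exact k (a.src e)
    · have k' : ∀ s, Node.map id id (Equiv.sumEmpty _ Empty) (upper (Node.map Sum.inl Sum.inl Sum.inl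
          (Node.strandSrc s y y : Node Empty Y.pts Y.pts)) : Node (a.V ⊕ (Empty ⊕ Unit) ⊕
            (Y.pts ⊕ κ.flags.pts)) X.pts (Y.pts ⊕ Empty)) =
          (upper (Node.strandSrc s (.inl y) (.inl y) : Node Empty _ _) :
            Node (a.V ⊕ Empty ⊕ (Y.pts ⊕ κ.flags.pts)) X.pts
              (Y.pts ⊕ κ.flags.pts)).capOff.map φ id id := by
        rintro (_ | _) <;> rfl
      exact k' (Y.sign y)
    · rfl
    · rfl
  · rintro (e | y | ⟨_ | _, hs⟩)
    · exact k (a.tgt e)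
    · have k' : ∀ s, Node.map id id (Equiv.sumEmpty _ Empty) (upper (Node.map Sum.inl Sum.inl Sum.inl
          (Node.strandTgt s y y : Node Empty Y.pts Y.pts)) : Node (a.V ⊕ (Empty ⊕ Unit) ⊕
            (Y.pts ⊕ κ.flags.pts)) X.pts (Y.pts ⊕ Empty)) =
          (upper (Node.strandTgt s (.inl y) (.inl y) : Node Empty _ _) :
            Node (a.V ⊕ Empty ⊕ (Y.pts ⊕ κ.flags.pts)) X.pts
              (Y.pts ⊕ κ.flags.pts)).capOff.map φ id id := by
        rintro (_ | _) <;> rfl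
      exact k' (Y.sign y)
    · rfl
    · rfl

/-- Attaching flags to a vertex is gluing a neighbourhood of the vertex. -/
theorem capOff_toHom {κ : Kind S} (a : Pre S X (Y.sum κ.flags)) :
    a.capOff.toHom = ((a.comp ((perm S (SEquiv.refl Y)).tensor (star κ))).comp
      (perm S (SEquiv.sumEmpty Y))).toHom := by
  -- Capping off is applied, as an operation on cobordisms, to the equation saying that the collar
  -- changes nothing.
  have h := congrArg (Quot.lift (fun a : Pre S X (Y.sum κ.flags) => a.capOff.toHom)
    fun _ _ h => capOff_rel h) (comp_id a)
  exact (h.symm.trans (capOff_comp_id a).toHom_eq).trans (comp_perm _ _).symm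

end Pre

namespace Node

variable {V V' : Type} {A B : ZeroMfd}

/-- Detach the outgoing edge of the added vertex. -/
def uncapSrc {kind : Option V → Kind S} :
    (n : Node (Option V) X.pts Y.pts) → n.Emits kind → Node V X.pts (Y.sum (kind none).flags).pts
  | .inner none, h => .top (.inr ⟨Sgn.neg, h⟩)
  | .inner (some v), _ => .inner v
  | .bot x, _ => .bot x
  | .top y, _ => .top (.inl y)

/-- Detach the incoming edge of the added vertex. -/
def uncapTgt {kind : Option V → Kind S} :
    (n : Node (Option V) X.pts Y.pts) → n.Absorbs kind → Node V X.pts (Y.sum (kind none).flags).pts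
  | .inner none, h => .top (.inr ⟨Sgn.pos, h⟩)
  | .inner (some v), _ => .inner v
  | .bot x, _ => .bot x
  | .top y, _ => .top (.inl y)

theorem capOff_uncapSrc {kind : Option V → Kind S} (n : Node (Option V) X.pts Y.pts)
    (h : n.Emits kind) : (n.uncapSrc h).capOff = n := by
  rcases n with (_ | _) | _ | _ <;> rfl

theorem capOff_uncapTgt {kind : Option V → Kind S} (n : Node (Option V) X.pts Y.pts)
    (h : n.Absorbs kind) : (n.uncapTgt h).capOff = n := by
  rcases n with (_ | _) | _ | _ <;> rfl

/-- Capping off loses the sign of a flag. The hypothesis `hm` recovers it: an emitting flag is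
negative. On emitting vertices the two operations are therefore inverse to each other. -/
theorem uncapSrc_eq_iff {kind : Option V → Kind S} (n : Node (Option V) X.pts Y.pts)
    (h : n.Emits kind) (m : Node V X.pts (Y.sum (kind none).flags).pts)
    (hm : m.Emits fun v => kind (some v)) : n.uncapSrc h = m ↔ n = m.capOff := by
  constructor
  · rintro rfl
    exact (capOff_uncapSrc n h).symm
  · rintro rfl
    rcases m with _ | _ | _ | ⟨s, hs⟩
    · rfl
    · rfl
    · rfl
    · obtain rfl : s = Sgn.neg := hm
      rfl

theorem uncapTgt_eq_iff {kind : Option V → Kind S} (n : Node (Option V) X.pts Y.pts)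
    (h : n.Absorbs kind) (m : Node V X.pts (Y.sum (kind none).flags).pts)
    (hm : m.Absorbs fun v => kind (some v)) : n.uncapTgt h = m ↔ n = m.capOff := by
  constructor
  · rintro rfl
    exact (capOff_uncapTgt n h).symm
  · rintro rfl
    rcases m with _ | _ | _ | ⟨s, hs⟩
    · rfl
    · rfl
    · rfl
    · obtain rfl : s = Sgn.pos := hm
      rfl

theorem uncapSrc_emits {kind : Option V → Kind S} (n : Node (Option V) X.pts Y.pts)
    (h : n.Emits kind) : (n.uncapSrc h).Emits fun v => kind (some v) := by
  rcases n with (_ | _) | _ | _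
  · rfl
  all_goals exact h

theorem uncapTgt_absorbs {kind : Option V → Kind S} (n : Node (Option V) X.pts Y.pts)
    (h : n.Absorbs kind) : (n.uncapTgt h).Absorbs fun v => kind (some v) := by
  rcases n with (_ | _) | _ | _
  · rfl
  all_goals exact h

theorem capOff_emits {kind : Option V → Kind S} {m : Node V X.pts (Y.sum (kind none).flags).pts}
    (hm : m.Emits fun v => kind (some v)) : m.capOff.Emits (X := X) (Y := Y) kind := by
  rcases m with _ | _ | _ | ⟨s, hs⟩
  · exact hm
  · exact hm
  · exact hm
  · obtain rfl : s = Sgn.neg := hm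
    exact hs

theorem capOff_absorbs {kind : Option V → Kind S}
    {m : Node V X.pts (Y.sum (kind none).flags).pts}
    (hm : m.Absorbs fun v => kind (some v)) : m.capOff.Absorbs (X := X) (Y := Y) kind := by
  rcases m with _ | _ | _ | ⟨s, hs⟩
  · exact hm
  · exact hm
  · exact hm
  · obtain rfl : s = Sgn.pos := hm
    exact hs

end Node

namespace Pre

/-- Rename the interior vertices. -/
def rename (c : Pre S X Y) {V' : Type} (φ : c.V ≃ V') : Pre S X Y where
  V := V'
  E := c.E
  finV := Finite.of_equiv _ φ
  kind v := c.kind (φ.symm v)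
  src e := (c.src e).map φ id id
  tgt e := (c.tgt e).map φ id id
  src_inj := (Node.map_injective φ.injective Function.injective_id
    Function.injective_id).comp c.src_inj
  tgt_inj := (Node.map_injective φ.injective Function.injective_id
    Function.injective_id).comp c.tgt_inj
  src_iff := by
    have h := c.src_iff
    rintro (v | x | y)
    · obtain ⟨v, rfl⟩ := φ.surjective v
      simpa using h (.inner v)
    · simpa using h (.bot x)
    · simpa using h (.top y)
  tgt_iff := by
    have h := c.tgt_iff
    rintro (v | x | y)
    · obtain ⟨v, rfl⟩ := φ.surjective v
      simpa using h (.inner v)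
    · simpa using h (.bot x)
    · simpa using h (.top y)

theorem rename_iso (c : Pre S X Y) {V' : Type} (φ : c.V ≃ V') : Iso c (c.rename φ) :=
  ⟨φ, Equiv.refl _, fun v => congrArg c.kind (φ.symm_apply_apply v), fun _ => rfl, fun _ => rfl⟩

/-- Cut out a vertex, adding its flags to the top boundary. -/
def uncap {V E : Type} [Finite V] [Finite E] (kind : Option V → Kind S)
    (src tgt : E → Node (Option V) X.pts Y.pts) (src_inj : Function.Injective src)
    (tgt_inj : Function.Injective tgt) (src_iff : ∀ p, (∃ e, src e = p) ↔ p.Emits kind)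
    (tgt_iff : ∀ p, (∃ e, tgt e = p) ↔ p.Absorbs kind) :
    Pre S X (Y.sum (kind none).flags) where
  V := V
  E := E
  kind v := kind (some v)
  src e := (src e).uncapSrc ((src_iff _).1 ⟨e, rfl⟩)
  tgt e := (tgt e).uncapTgt ((tgt_iff _).1 ⟨e, rfl⟩)
  src_inj e e' h := src_inj
    ((Node.capOff_uncapSrc _ _).symm.trans ((congrArg Node.capOff h).trans
      (Node.capOff_uncapSrc _ _)))
  tgt_inj e e' h := tgt_inj
    ((Node.capOff_uncapTgt _ _).symm.trans ((congrArg Node.capOff h).trans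
      (Node.capOff_uncapTgt _ _)))
  src_iff p := by
    constructor
    · rintro ⟨e, rfl⟩
      exact Node.uncapSrc_emits _ _
    · intro hp
      obtain ⟨e, he⟩ := (src_iff _).2 (Node.capOff_emits hp)
      exact ⟨e, (Node.uncapSrc_eq_iff _ _ _ hp).2 he⟩
  tgt_iff p := by
    constructor
    · rintro ⟨e, rfl⟩
      exact Node.uncapTgt_absorbs _ _
    · intro hp
      obtain ⟨e, he⟩ := (tgt_iff _).2 (Node.capOff_absorbs hp)
      exact ⟨e, (Node.uncapTgt_eq_iff _ _ _ hp).2 he⟩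

/-- A cobordism with a vertex is obtained by attaching flags to that vertex. -/
theorem exists_capOff (c : Pre S X Y) {V : Type} (φ : c.V ≃ Option V) :
    ∃ (κ : Kind S) (a : Pre S X (Y.sum κ.flags)), a.V = V ∧ a.capOff.toHom = c.toHom := by
  -- Renaming makes the vertex set equal to `Option V`, and the vertex `none` is the one cut out.
  let d := c.rename φ
  have : Finite V := Finite.of_injective (fun v => φ.symm (some v))
    (φ.symm.injective.comp (Option.some_injective _))
  let a : Pre S X (Y.sum _) :=
    uncap (V := V) d.kind d.src d.tgt d.src_inj d.tgt_inj d.src_iff d.tgt_iff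
  refine ⟨_, a, rfl, ?_⟩
  have h : Iso a.capOff d := by
    refine ⟨Equiv.refl _, Equiv.refl _, ?_, fun e => ?_, fun e => ?_⟩
    · rintro (_ | v) <;> rfl
    · exact (Node.capOff_uncapSrc (d.src e) _).symm.trans (Node.map_id _).symm
    · exact (Node.capOff_uncapTgt (d.tgt e) _).symm.trans (Node.map_id _).symm
  exact h.toHom_eq.trans (rename_iso c φ).toHom_eq.symm

end Pre
end CapOff
end
end OneCob

/-! ### Splitting a cobordism into unions of components -/

namespace OneCob
noncomputable section
open CategoryTheory MonoidalCategory

section Restrict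

variable {S : Type v} {X Y Z X' Y' : ZeroMfd}

namespace Node

variable {V A B : Type}

/-- A vertex with a property, as a vertex of the part with this property. -/
def restrict (p : Node V A B → Prop) : (n : Node V A B) → p n →
    Node {v // p (.inner v)} {x // p (.bot x)} {y // p (.top y)}
  | .inner v, h => .inner ⟨v, h⟩
  | .bot x, h => .bot ⟨x, h⟩
  | .top y, h => .top ⟨y, h⟩

/-- A vertex of a part, as a vertex. -/
def unrestrict {p : Node V A B → Prop} :
    Node {v // p (.inner v)} {x // p (.bot x)} {y // p (.top y)} → Node V A B :=
  map Subtype.val Subtype.val Subtype.val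

theorem unrestrict_restrict {p : Node V A B → Prop} (n : Node V A B) (h : p n) :
    (n.restrict p h).unrestrict = n := by
  cases n <;> rfl

theorem unrestrict_injective {p : Node V A B → Prop} :
    Function.Injective (unrestrict (p := p)) :=
  map_injective Subtype.val_injective Subtype.val_injective Subtype.val_injective

theorem unrestrict_prop {p : Node V A B → Prop}
    (q : Node {v // p (.inner v)} {x // p (.bot x)} {y // p (.top y)}) : p q.unrestrict := by
  rcases q with q | q | q <;> exact q.2

end Node

/-- The points of a `0`-manifold with a property. -/
abbrev ZeroMfd.restrict (X : ZeroMfd) (p : X.pts → Prop) : ZeroMfd :=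
  ⟨{x // p x}, fun x => X.sign x.1⟩

/-- A `0`-manifold is the disjoint union of a part and its complement. -/
def SEquiv.compl (X : ZeroMfd) (p : X.pts → Prop) :
    SEquiv ((X.restrict p).sum (X.restrict fun x => ¬ p x)) X :=
  letI := Classical.decPred p
  ⟨Equiv.sumCompl p, by rintro (x | x) <;> rfl⟩

namespace Pre

/-- The part of a cobordism formed by some of its components. -/
def restrict (c : Pre S X Y) (p : Node c.V X.pts Y.pts → Prop)
    (hp : ∀ e, p (c.src e) ↔ p (c.tgt e)) :
    Pre S (X.restrict fun x => p (.bot x)) (Y.restrict fun y => p (.top y)) where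
  V := {v // p (.inner v)}
  E := {e // p (c.src e)}
  kind v := c.kind v.1
  src e := (c.src e.1).restrict p e.2
  tgt e := (c.tgt e.1).restrict p ((hp e.1).1 e.2)
  src_inj e e' h := Subtype.ext (c.src_inj ((Node.unrestrict_restrict _ _).symm.trans
    ((congrArg Node.unrestrict h).trans (Node.unrestrict_restrict _ _))))
  tgt_inj e e' h := Subtype.ext (c.tgt_inj ((Node.unrestrict_restrict _ _).symm.trans
    ((congrArg Node.unrestrict h).trans (Node.unrestrict_restrict _ _))))
  src_iff q := by
    refine Iff.trans ?_ ((c.src_iff q.unrestrict).trans (by cases q <;> rfl))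
    constructor
    · rintro ⟨e, he⟩
      exact ⟨e.1, (Node.unrestrict_restrict _ _).symm.trans (congrArg Node.unrestrict he)⟩
    · rintro ⟨e, he⟩
      exact ⟨⟨e, he ▸ Node.unrestrict_prop q⟩,
        Node.unrestrict_injective ((Node.unrestrict_restrict _ _).trans he)⟩
  tgt_iff q := by
    refine Iff.trans ?_ ((c.tgt_iff q.unrestrict).trans (by cases q <;> rfl))
    constructor
    · rintro ⟨e, he⟩
      exact ⟨e.1, (Node.unrestrict_restrict _ _).symm.trans (congrArg Node.unrestrict he)⟩
    · rintro ⟨e, he⟩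
      exact ⟨⟨e, (hp e).2 (he ▸ Node.unrestrict_prop q)⟩,
        Node.unrestrict_injective ((Node.unrestrict_restrict _ _).trans he)⟩

/-- A cobordism is the disjoint union of a part and its complement. -/
theorem restrict_tensor_restrict (c : Pre S X Y) (p : Node c.V X.pts Y.pts → Prop)
    (hp : ∀ e, p (c.src e) ↔ p (c.tgt e)) :
    (((c.restrict p hp).tensor (c.restrict (fun n => ¬ p n) fun e => not_congr (hp e))).comp
      (perm S (SEquiv.compl Y fun y => p (.top y)))).toHom =
    ((perm S (SEquiv.compl X fun x => p (.bot x))).comp c).toHom := by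
  classical
  have k₁ : ∀ n h, n = ((Node.restrict p n h).map .inl .inl .inl).map
      (Equiv.sumCompl fun v => p (.inner v)) (SEquiv.compl X fun x => p (.bot x)).equiv
        (SEquiv.compl Y fun y => p (.top y)).equiv := by
    rintro (_ | _ | _) h <;> rfl
  have k₂ : ∀ n h, n = ((Node.restrict (fun n => ¬ p n) n h).map .inr .inr .inr).map
      (Equiv.sumCompl fun v => p (.inner v)) (SEquiv.compl X fun x => p (.bot x)).equiv
        (SEquiv.compl Y fun y => p (.top y)).equiv := by
    rintro (_ | _ | _) h <;> rfl
  refine square _ _ (Equiv.sumCompl fun v => p (.inner v)) (Equiv.sumCompl fun e => p (c.src e))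
    ?_ ?_ ?_
  · rintro (v | v) <;> rfl
  · rintro (e | e)
    · exact k₁ (c.src e.1) e.2
    · exact k₂ (c.src e.1) e.2
  · rintro (e | e)
    · exact k₁ (c.tgt e.1) ((hp e.1).1 e.2)
    · exact k₂ (c.tgt e.1) (mt (hp e.1).2 e.2)

end Pre

end Restrict

/-! ### Generating cobordisms without interior vertices -/

namespace Bord

variable {S : Type v}

/-- The morphism presented by a cell decomposition. -/
abbrev ofPre {X Y : ZeroMfd} (c : Pre S X Y) : (⟨X⟩ : Bord S) ⟶ ⟨Y⟩ := c.toHom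

/-- A property of cobordisms that holds for permutations and for the generating cobordisms, and
that is preserved by gluing and by disjoint union. -/
structure Generating (W : MorphismProperty (Bord S)) : Prop where
  comp : ∀ {X Y Z : Bord S} (f : X ⟶ Y) (g : Y ⟶ Z), W f → W g → W (f ≫ g)
  tensor : ∀ {X Y X' Y' : Bord S} (f : X ⟶ Y) (g : X' ⟶ Y'), W f → W g → W (f ⊗ₘ g)
  perm : ∀ {X Y : Bord S} (f : SEquiv X.mfd Y.mfd), W (perm f : X ⟶ Y)
  cup : W (X := (𝟙_ (Cob S)).toBord) (Y := (Cob.plus S ⊗ Cob.minus S).toBord) (Cob.cup S)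
  cap : W (X := (Cob.minus S ⊗ Cob.plus S).toBord) (Y := (𝟙_ (Cob S)).toBord) (Cob.cap S)
  halfIn : W (X := (𝟙_ (Cob S)).toBord) (Y := (Cob.plus S).toBord) (Cob.halfIn S)
  halfOut : W (X := (Cob.plus S).toBord) (Y := (𝟙_ (Cob S)).toBord) (Cob.halfOut S)
  dot : ∀ a : S, W (X := (Cob.plus S).toBord) (Y := (Cob.plus S).toBord) (Cob.dot a)

namespace Generating

variable {W : MorphismProperty (Bord S)} (hW : Generating W) {X Y X' Y' : ZeroMfd}
include hW

/-- The square expresses `d` as `c` between two permutation cobordisms. The boundary may thus be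
relabelled freely. -/
theorem of_square {c : Pre S X Y} {d : Pre S X' Y'} (f : SEquiv X X') (g : SEquiv Y Y')
    (h : (c.comp (Pre.perm S g)).toHom = ((Pre.perm S f).comp d).toHom)
    (hc : W (ofPre c)) : W (ofPre d) := by
  have e : ofPre d = (permIso (X := ⟨X⟩) (Y := ⟨X'⟩) f).inv ≫ ofPre c ≫
      Bord.perm (X := ⟨Y⟩) (Y := ⟨Y'⟩) g :=
    (Iso.eq_inv_comp (permIso (X := ⟨X⟩) (Y := ⟨X'⟩) f)).2 h.symm
  rw [e]
  exact hW.comp _ _ (hW.perm _) (hW.comp _ _ hc (hW.perm _))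

/-- A single strand has every generating property. -/
theorem of_unique_edge (d : Pre S X Y) [IsEmpty d.V] [Unique d.E] : W (ofPre d) := by
  -- Every boundary point is an end of some edge, hence of the only edge.
  have hbot : ∀ x, d.src default = .bot x ∨ d.tgt default = .bot x := fun x => by
    rcases Pre.bd_or d (.inl x) with ⟨⟨e, he⟩, -⟩ | ⟨⟨e, he⟩, -⟩
    · exact .inl (Subsingleton.elim e default ▸ he)
    · exact .inr (Subsingleton.elim e default ▸ he)
  have htop : ∀ y, d.src default = .top y ∨ d.tgt default = .top y := fun y => by
    rcases Pre.bd_or d (.inr y) with ⟨⟨e, he⟩, -⟩ | ⟨⟨e, he⟩, -⟩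
    · exact .inl (Subsingleton.elim e default ▸ he)
    · exact .inr (Subsingleton.elim e default ▸ he)
  have hs := (d.src_iff _).1 ⟨default, rfl⟩
  have ht := (d.tgt_iff _).1 ⟨default, rfl⟩
  -- The positions of the two ends decide the type: both at the bottom is a cap, both at the top is
  -- a cup, bottom to top is a positive strand, top to bottom a negative one.
  rcases h₁ : d.src default with v | x | y
  · exact isEmptyElim v
  · rcases h₂ : d.tgt default with v | x' | y
    · exact isEmptyElim v
    · rw [h₁] at hs
      rw [h₂] at ht
      have : IsEmpty Y.pts := ⟨fun y => by simpa [h₁, h₂] using htop y⟩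
      -- The two ends have opposite signs, so they are different points.
      have hne : x' ≠ x := by
        rintro rfl
        simp_all
      -- The terminal, negative end `x'` is listed before the initial end `x`, in the order of the
      -- standard cap.
      let f : SEquiv (ZeroMfd.ofSeq ([Sgn.neg] ++ [Sgn.pos])) X :=
        ⟨Equiv.ofBijective (![x', x] : Fin 2 → X.pts) (by
          constructor
          · intro i j
            fin_cases i <;> fin_cases j <;> simp [hne, hne.symm]
          · intro z
            rcases hbot z with h | h
            · exact ⟨(1 : Fin 2), by simpa [h₁, eq_comm] using h⟩
            · exact ⟨(0 : Fin 2), by simpa [h₂, eq_comm] using h⟩), by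
          intro (i : Fin 2)
          fin_cases i
          · exact ht
          · exact hs⟩
      let g : SEquiv (ZeroMfd.ofSeq []) Y :=
        ⟨Equiv.equivOfIsEmpty (Fin 0) _, fun i => i.elim0⟩
      refine hW.of_square f g (Pre.square (c := Cob.capPre S) f g (Equiv.equivOfIsEmpty Empty _)
        (Equiv.ofUnique Unit _) (fun v => v.elim) (fun e => h₁) (fun e => h₂)) hW.cap
    · rw [h₁] at hs
      rw [h₂] at ht
      let f : SEquiv (ZeroMfd.ofSeq [Sgn.pos]) X :=
        ⟨Equiv.ofBijective (fun _ : Fin 1 => x) ⟨fun (i j : Fin 1) _ => Subsingleton.elim i j, fun z =>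
          ⟨(0 : Fin 1), by simpa [h₁, h₂] using hbot z⟩⟩, by
          intro (i : Fin 1)
          fin_cases i
          exact hs⟩
      let g : SEquiv (ZeroMfd.ofSeq [Sgn.pos]) Y :=
        ⟨Equiv.ofBijective (fun _ : Fin 1 => y) ⟨fun (i j : Fin 1) _ => Subsingleton.elim i j, fun z =>
          ⟨(0 : Fin 1), by simpa [h₁, h₂] using htop z⟩⟩, by
          intro (i : Fin 1)
          fin_cases i
          exact ht⟩
      exact hW.of_square f g (Pre.square (c := Pre.perm S (SEquiv.refl (ZeroMfd.ofSeq [Sgn.pos])))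
        f g (Equiv.equivOfIsEmpty Empty _) (Equiv.ofUnique (Fin 1) _) (fun v => v.elim)
        (by intro (i : Fin 1); fin_cases i; exact h₁)
        (by intro (i : Fin 1); fin_cases i; exact h₂)) (hW.perm _)
  · rcases h₂ : d.tgt default with v | x | y'
    · exact isEmptyElim v
    · rw [h₁] at hs
      rw [h₂] at ht
      let f : SEquiv (ZeroMfd.ofSeq [Sgn.neg]) X :=
        ⟨Equiv.ofBijective (fun _ : Fin 1 => x) ⟨fun (i j : Fin 1) _ => Subsingleton.elim i j, fun z =>
          ⟨(0 : Fin 1), by simpa [h₁, h₂] using hbot z⟩⟩, by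
          intro (i : Fin 1)
          fin_cases i
          exact ht⟩
      let g : SEquiv (ZeroMfd.ofSeq [Sgn.neg]) Y :=
        ⟨Equiv.ofBijective (fun _ : Fin 1 => y) ⟨fun (i j : Fin 1) _ => Subsingleton.elim i j, fun z =>
          ⟨(0 : Fin 1), by simpa [h₁, h₂] using htop z⟩⟩, by
          intro (i : Fin 1)
          fin_cases i
          exact hs⟩
      exact hW.of_square f g (Pre.square (c := Pre.perm S (SEquiv.refl (ZeroMfd.ofSeq [Sgn.neg])))
        f g (Equiv.equivOfIsEmpty Empty _) (Equiv.ofUnique (Fin 1) _) (fun v => v.elim)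
        (by intro (i : Fin 1); fin_cases i; exact h₁)
        (by intro (i : Fin 1); fin_cases i; exact h₂)) (hW.perm _)
    · rw [h₁] at hs
      rw [h₂] at ht
      have : IsEmpty X.pts := ⟨fun x => by simpa [h₁, h₂] using hbot x⟩
      have hne : y' ≠ y := by
        rintro rfl
        simp_all
      let f : SEquiv (ZeroMfd.ofSeq []) X :=
        ⟨Equiv.equivOfIsEmpty (Fin 0) _, fun i => i.elim0⟩
      let g : SEquiv (ZeroMfd.ofSeq ([Sgn.pos] ++ [Sgn.neg])) Y :=
        ⟨Equiv.ofBijective (![y', y] : Fin 2 → Y.pts) (by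
          constructor
          · intro i j
            fin_cases i <;> fin_cases j <;> simp [hne, hne.symm]
          · intro z
            rcases htop z with h | h
            · exact ⟨(1 : Fin 2), by simpa [h₁, eq_comm] using h⟩
            · exact ⟨(0 : Fin 2), by simpa [h₂, eq_comm] using h⟩), by
          intro (i : Fin 2)
          fin_cases i
          · exact ht
          · exact hs⟩
      exact hW.of_square f g (Pre.square (c := Cob.cupPre S) f g (Equiv.equivOfIsEmpty Empty _)
        (Equiv.ofUnique Unit _) (fun v => v.elim) (fun e => h₁) (fun e => h₂)) hW.cup

/-- A cobordism without interior vertices has every generating property. -/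
theorem of_isEmpty (c : Pre S X Y) [IsEmpty c.V] : W (ofPre c) := by
  obtain ⟨n, hn⟩ : ∃ n, Nat.card c.E = n := ⟨_, rfl⟩
  induction n using Nat.strong_induction_on generalizing X Y with
  | _ n ih =>
  rcases isEmpty_or_nonempty c.E with hE | ⟨⟨e₀⟩⟩
  · have hX : IsEmpty X.pts := ⟨fun x => by
      rcases Pre.bd_or c (.inl x) with ⟨⟨e, _⟩, -⟩ | ⟨⟨e, _⟩, -⟩ <;> exact isEmptyElim e⟩
    have hY : IsEmpty Y.pts := ⟨fun x => by
      rcases Pre.bd_or c (.inr x) with ⟨⟨e, _⟩, -⟩ | ⟨⟨e, _⟩, -⟩ <;> exact isEmptyElim e⟩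
    have h : Pre.Iso (Pre.perm S (X := X) (Y := Y)
        ⟨Equiv.equivOfIsEmpty _ _, fun x => isEmptyElim x⟩) c :=
      ⟨Equiv.equivOfIsEmpty Empty _, Equiv.equivOfIsEmpty X.pts _, fun v => v.elim,
        fun (e : X.pts) => isEmptyElim e, fun (e : X.pts) => isEmptyElim e⟩
    have e : ofPre c = Bord.perm (X := ⟨X⟩) (Y := ⟨Y⟩) _ := h.toHom_eq.symm
    rw [e]
    exact hW.perm _
  -- The part consisting of the ends of `e₀` is split off; its complement has fewer edges.
  · let p : Node c.V X.pts Y.pts → Prop := fun n => n = c.src e₀ ∨ n = c.tgt e₀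
    -- A boundary point is never both initial and terminal. Without interior vertices, different
    -- edges therefore share no ends.
    have hst : ∀ e e', c.src e ≠ c.tgt e' := fun e e' h => by
      rcases h' : c.src e with v | x | y
      · exact isEmptyElim v
      · rcases Pre.bd_or c (.inl x) with ⟨-, h₁⟩ | ⟨-, h₁⟩
        · exact h₁ ⟨e', h ▸ h'⟩
        · exact h₁ ⟨e, h'⟩
      · rcases Pre.bd_or c (.inr y) with ⟨-, h₁⟩ | ⟨-, h₁⟩
        · exact h₁ ⟨e', h ▸ h'⟩
        · exact h₁ ⟨e, h'⟩
    have hps : ∀ e, p (c.src e) ↔ e = e₀ := fun e =>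
      ⟨fun h => h.elim (fun h => c.src_inj h) fun h => absurd h (hst _ _), fun h => .inl (h ▸ rfl)⟩
    have hpt : ∀ e, p (c.tgt e) ↔ e = e₀ := fun e =>
      ⟨fun h => h.elim (fun h => absurd h.symm (hst _ _)) fun h => c.tgt_inj h,
        fun h => .inr (h ▸ rfl)⟩
    have hp : ∀ e, p (c.src e) ↔ p (c.tgt e) := fun e => (hps e).trans (hpt e).symm
    have i₁ : IsEmpty (c.restrict p hp).V := ⟨fun v => isEmptyElim v.1⟩
    have i₂ : IsEmpty (c.restrict (fun n => ¬ p n) fun e => not_congr (hp e)).V :=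
      ⟨fun v => isEmptyElim v.1⟩
    let u : Unique (c.restrict p hp).E :=
      { default := ⟨e₀, (hps e₀).2 rfl⟩
        uniq := fun e => Subtype.ext ((hps e.1).1 e.2) }
    refine hW.of_square _ _ (Pre.restrict_tensor_restrict c p hp)
      (hW.tensor (ofPre _) (ofPre _) (hW.of_unique_edge _) (ih _ ?_ _ rfl))
    rw [← hn]
    exact Finite.card_subtype_lt (x := e₀) fun h => h ((hps e₀).2 rfl)

end Generating
end Bord
end
end OneCob

/-! ### Neighbourhoods of vertices and generation of all cobordisms -/

namespace OneCob
noncomputable section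
open CategoryTheory MonoidalCategory

namespace Pre

variable {S : Type v}

/-- A neighbourhood of an unmarked point, without a subdivision. -/
def strand (S : Type v) : Pre S (Kind.plain (S := S)).flags ZeroMfd.empty where
  V := Empty
  E := Unit
  kind v := v.elim
  src _ := .bot ⟨Sgn.pos, trivial⟩
  tgt _ := .bot ⟨Sgn.neg, trivial⟩
  src_inj _ _ _ := rfl
  tgt_inj _ _ _ := rfl
  src_iff := by
    rintro (v | ⟨_ | _, hs⟩ | y)
    · exact v.elim
    · exact iff_of_true ⟨(), rfl⟩ rfl
    · exact iff_of_false (by rintro ⟨_, h⟩; cases h) fun h : Sgn.neg = Sgn.pos => nomatch h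
    · exact y.elim
  tgt_iff := by
    rintro (v | ⟨_ | _, hs⟩ | y)
    · exact v.elim
    · exact iff_of_false (by rintro ⟨_, h⟩; cases h) fun h : Sgn.pos = Sgn.neg => nomatch h
    · exact iff_of_true ⟨(), rfl⟩ rfl
    · exact y.elim

/-- The flags of a vertex that has both. -/
def flagsEquiv {κ : Kind S} (h₁ : κ.HasFlag .pos) (h₂ : κ.HasFlag .neg) :
    SEquiv ((ZeroMfd.ofSeq [Sgn.pos]).sum (ZeroMfd.ofSeq [Sgn.neg])) κ.flags where
  equiv :=
    { toFun := Sum.elim (fun _ : Fin 1 => ⟨.pos, h₁⟩) fun _ : Fin 1 => ⟨.neg, h₂⟩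
      invFun
        | ⟨.pos, _⟩ => .inl (0 : Fin 1)
        | ⟨.neg, _⟩ => .inr (0 : Fin 1)
      left_inv := by
        rintro (i | i)
        · exact congrArg Sum.inl (Subsingleton.elim (α := Fin 1) _ _)
        · exact congrArg Sum.inr (Subsingleton.elim (α := Fin 1) _ _)
      right_inv := by rintro ⟨_ | _, _⟩ <;> rfl }
  sign_eq := by
    rintro (i | i)
    · have : i = (0 : Fin 1) := Subsingleton.elim (α := Fin 1) _ _
      subst this
      rfl
    · have : i = (0 : Fin 1) := Subsingleton.elim (α := Fin 1) _ _
      subst this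
      rfl

/-- Subdividing the bent strand once puts an unmarked vertex on it, with one edge arriving and one
leaving. -/
theorem strand_iso : Iso ((strand S).subdivide ()) (star Kind.plain) := by
  let φ : Option Empty ≃ Unit :=
    { toFun := fun _ => (), invFun := fun _ => none
      left_inv := by rintro (_ | v) <;> [rfl; exact v.elim]
      right_inv := fun _ => rfl }
  let ψ : Option Unit ≃ (Kind.plain (S := S)).flags.pts :=
    { toFun := fun e => e.elim ⟨.neg, trivial⟩ fun _ => ⟨.pos, trivial⟩
      invFun
        | ⟨.pos, _⟩ => some ()
        | ⟨.neg, _⟩ => none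
      left_inv := by rintro (_ | _) <;> rfl
      right_inv := by rintro ⟨_ | _, _⟩ <;> rfl }
  refine ⟨φ, ψ, ?_, ?_, ?_⟩
  · rintro (_ | v) <;> [rfl; exact v.elim]
  · rintro (_ | _) <;> rfl
  · rintro (_ | _)
    · rfl
    · exact (congrArg (Node.map φ id id) (subdivide_tgt_self (strand S) ())).symm

/-- The flag of a vertex that has only one. -/
def flagEquiv {κ : Kind S} (s : Sgn) (h : κ.HasFlag s) (h' : ∀ t, κ.HasFlag t → t = s) :
    SEquiv (ZeroMfd.ofSeq [s]) κ.flags where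
  equiv :=
    { toFun := fun _ : Fin 1 => ⟨s, h⟩
      invFun := fun _ => (0 : Fin 1)
      left_inv := fun _ => Subsingleton.elim (α := Fin 1) _ _
      right_inv := fun t => Subtype.ext (h' t.1 t.2).symm }
  sign_eq := by
    intro (i : Fin 1)
    fin_cases i
    rfl

/-- A defect is an interval with one dot, bent by an unmarked point. -/
theorem star_defect_iso (a : S) :
    Iso (capOff (κ := Kind.plain)
      (((Cob.dotPre a).tensor (perm S (.refl (.ofSeq [Sgn.neg])))).relabel
        (flagsEquiv (κ := Kind.defect a) trivial trivial)
          ((flagsEquiv (κ := Kind.plain) trivial trivial).trans (SEquiv.emptySum _).symm)))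
      ((star (Kind.defect a)).subdivide ⟨.neg, trivial⟩) := by
  let φ : Option (Unit ⊕ Empty) ≃ Option Unit := Equiv.optionCongr (Equiv.sumEmpty _ _)
  -- The edge before the dot is the positive flag. The negative flag has been subdivided: its first
  -- half is the edge after the dot, its second half, `none`, is the negative strand that leads back
  -- to the bottom.
  let ψ : Bool ⊕ Fin 1 ≃ Option (Kind.defect a).flags.pts :=
    { toFun
        | .inl false => some ⟨.pos, trivial⟩
        | .inl true => some ⟨.neg, trivial⟩
        | .inr _ => none
      invFun
        | some ⟨.pos, _⟩ => .inl false
        | some ⟨.neg, _⟩ => .inl true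
        | none => .inr 0
      left_inv := by
        rintro ((_ | _) | _)
        · rfl
        · rfl
        · exact congrArg Sum.inr (Subsingleton.elim _ _)
      right_inv := by rintro (_ | ⟨_ | _, _⟩) <;> rfl }
  refine ⟨φ, ψ, ?_, ?_, ?_⟩
  · rintro (_ | _ | v) <;> [rfl; rfl; exact v.elim]
  · rintro ((_ | _) | (i : Fin 1))
    · rfl
    · rfl
    · fin_cases i
      rfl
  · rintro ((_ | _) | (i : Fin 1))
    · refine (subdivide_tgt_of_ne (star (Kind.defect a)) ?_).trans rfl
      exact fun h => nomatch congrArg Subtype.val h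
    · exact subdivide_tgt_self (star (Kind.defect a)) _
    · fin_cases i
      rfl

/-- An initial inner endpoint is the half-interval that begins at it, bent by an unmarked point. -/
theorem star_source_iso :
    Iso (capOff (κ := Kind.plain)
      (((Cob.halfInPre S).tensor (perm S (.refl (.ofSeq [Sgn.neg])))).relabel
        (((SEquiv.nil.symm.sum (.refl _)).trans (SEquiv.emptySum _)).trans
          (flagEquiv (κ := Kind.source) .neg trivial (by rintro (_ | _) h <;> [exact h.elim; rfl])))
          ((flagsEquiv (κ := Kind.plain) trivial trivial).trans (SEquiv.emptySum _).symm)))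
      ((star Kind.source).subdivide ⟨.neg, trivial⟩) := by
  let φ : Option (Unit ⊕ Empty) ≃ Option Unit := Equiv.optionCongr (Equiv.sumEmpty _ _)
  let ψ : Unit ⊕ Fin 1 ≃ Option (Kind.source (S := S)).flags.pts :=
    { toFun
        | .inl _ => some ⟨.neg, trivial⟩
        | .inr _ => none
      invFun
        | some _ => .inl ()
        | none => .inr 0
      left_inv := by
        rintro (_ | _)
        · rfl
        · exact congrArg Sum.inr (Subsingleton.elim _ _)
      right_inv := by
        rintro (_ | ⟨_ | _, h⟩)
        · rfl
        · exact h.elim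
        · rfl }
  refine ⟨φ, ψ, ?_, ?_, ?_⟩
  · rintro (_ | _ | v) <;> [rfl; rfl; exact v.elim]
  · rintro (_ | (i : Fin 1))
    · rfl
    · fin_cases i
      rfl
  · rintro (_ | (i : Fin 1))
    · exact subdivide_tgt_self (star (Kind.source (S := S))) _
    · fin_cases i
      rfl

/-- A final inner endpoint is the half-interval that ends at it. -/
theorem star_sink_iso :
    Iso ((Cob.halfOutPre S).relabel (flagEquiv (κ := Kind.sink) .pos trivial
        (by rintro (_ | _) h <;> [rfl; exact h.elim])) SEquiv.nil.symm) (star Kind.sink) := by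
  let ψ : Unit ≃ (Kind.sink (S := S)).flags.pts :=
    { toFun := fun _ => ⟨.pos, trivial⟩
      invFun := fun _ => ()
      left_inv := fun _ => rfl
      right_inv := by rintro ⟨_ | _, h⟩ <;> [rfl; exact h.elim] }
  exact ⟨Equiv.refl _, ψ, fun _ => rfl, fun _ => rfl, fun _ => rfl⟩

end Pre

namespace Bord.Generating

variable {S : Type v} {W : MorphismProperty (Bord S)} (hW : Generating W) {X Y X' Y' : ZeroMfd}
include hW

theorem of_relabel {c : Pre S X Y} (f : SEquiv X X') (g : SEquiv Y Y') (hc : W (ofPre c)) :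
    W (ofPre (c.relabel f g)) :=
  hW.of_square f g (Pre.square f g (Equiv.refl _) (Equiv.refl _) (fun _ => rfl) (fun _ => rfl)
    fun _ => rfl) hc

/-- By `Pre.capOff_toHom`, capping off is gluing with an identity beside a star, up to a
permutation. -/
theorem of_capOff {κ : Kind S} (hκ : W (ofPre (Pre.star κ))) {a : Pre S X (Y.sum κ.flags)}
    (ha : W (ofPre a)) : W (ofPre a.capOff) := by
  have e : ofPre a.capOff = (ofPre a ≫ (Bord.perm (X := ⟨Y⟩) (Y := ⟨Y⟩) (SEquiv.refl Y) ⊗ₘ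
      ofPre (Pre.star κ))) ≫ Bord.perm (SEquiv.sumEmpty Y) := a.capOff_toHom
  rw [e]
  exact hW.comp _ _ (hW.comp _ _ ha (hW.tensor _ _ (hW.perm _) hκ)) (hW.perm _)

/-- A star has its whole boundary at the bottom. For a defect or an initial endpoint the outgoing
edge of the standard generator has to be bent down, which uses the star of an unmarked vertex. That
star is a strand without interior vertices, and a final endpoint needs no bending. -/
theorem of_star (κ : Kind S) : W (ofPre (Pre.star κ)) := by
  have hp : W (ofPre (Pre.star (Kind.plain (S := S)))) := by
    have : IsEmpty (Pre.strand S).V := inferInstanceAs (IsEmpty Empty)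
    have e : ofPre (Pre.star (Kind.plain (S := S))) = ofPre (Pre.strand S) :=
      Pre.strand_iso.toHom_eq.symm.trans (Pre.subdivide_toHom _ _)
    rw [e]
    exact hW.of_isEmpty _
  cases κ with
  | plain => exact hp
  | defect a =>
    have e : ofPre (Pre.star (Kind.defect a)) = _ :=
      (Pre.subdivide_toHom _ _).symm.trans (Pre.star_defect_iso a).toHom_eq.symm
    rw [e]
    exact hW.of_capOff hp
      (hW.of_relabel _ _ (hW.tensor (ofPre _) (ofPre _) (hW.dot a) (hW.perm _)))
  | source =>
    have e : ofPre (Pre.star (Kind.source (S := S))) = _ :=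
      (Pre.subdivide_toHom _ _).symm.trans Pre.star_source_iso.toHom_eq.symm
    rw [e]
    exact hW.of_capOff hp
      (hW.of_relabel _ _ (hW.tensor (ofPre _) (ofPre _) hW.halfIn (hW.perm _)))
  | sink =>
    have e : ofPre (Pre.star (Kind.sink (S := S))) = _ := Pre.star_sink_iso.toHom_eq.symm
    rw [e]
    exact hW.of_relabel _ _ hW.halfOut

/-- Every cobordism is generated by permutations, the cup, the cap, the half-intervals and the
intervals with one dot. -/
theorem all {X Y : Bord S} (f : X ⟶ Y) : W f := by
  -- The induction removes one interior vertex at a time. The boundary has to vary, since cutting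
  -- out a vertex adds its flags to the top.
  suffices H : ∀ (V : Type) [Finite V] {X Y : ZeroMfd} (c : Pre S X Y), (c.V ≃ V) →
      W (ofPre c) by
    rcases f with ⟨c⟩
    exact H c.V c (Equiv.refl _)
  intro V _
  induction V using Finite.induction_empty_option with
  | of_equiv e ih => exact fun c φ => ih c (φ.trans e.symm)
  | h_empty =>
    intro X Y c φ
    have : IsEmpty c.V := φ.isEmpty
    exact hW.of_isEmpty c
  | h_option ih =>
    intro X Y c φ
    obtain ⟨κ, a, rfl, h⟩ := c.exists_capOff φ
    have e : ofPre c = ofPre a.capOff := h.symm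
    rw [e]
    exact hW.of_capOff (hW.of_star κ) (ih a (Equiv.refl _))

end Bord.Generating
end
end OneCob

/-! ### Crossings generate permutations; transfer to sign sequences -/

namespace OneCob
noncomputable section
open CategoryTheory MonoidalCategory

namespace SEquiv

@[simp] theorem append_inl_val (l l' : List Sgn) (i : Fin l.length) :
    ((append l l').equiv (.inl i) : Fin _).val = i.val := by
  simp [append]

@[simp] theorem append_inr_val (l l' : List Sgn) (i : Fin l'.length) :
    ((append l l').equiv (.inr i) : Fin _).val = l.length + i.val := by
  simp [append]

/-- The disjoint union of sign-preserving bijections of sign sequences. -/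
def appendMap {l₁ l₂ l₁' l₂' : List Sgn} (f : SEquiv (ZeroMfd.ofSeq l₁) (ZeroMfd.ofSeq l₁'))
    (g : SEquiv (ZeroMfd.ofSeq l₂) (ZeroMfd.ofSeq l₂')) :
    SEquiv (ZeroMfd.ofSeq (l₁ ++ l₂)) (ZeroMfd.ofSeq (l₁' ++ l₂')) :=
  (append l₁ l₂).symm.trans ((f.sum g).trans (append l₁' l₂'))

section
variable {l₁ l₂ l₁' l₂' : List Sgn} (f : SEquiv (ZeroMfd.ofSeq l₁) (ZeroMfd.ofSeq l₁'))
    (g : SEquiv (ZeroMfd.ofSeq l₂) (ZeroMfd.ofSeq l₂'))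

theorem appendMap_inl (i : Fin l₁.length) :
    (appendMap f g).equiv ((append l₁ l₂).equiv (.inl i)) =
      (append l₁' l₂').equiv (.inl (f.equiv i)) :=
  congrArg (fun x => (append l₁' l₂').equiv ((f.sum g).equiv x))
    ((append l₁ l₂).equiv.symm_apply_apply (.inl i))

theorem appendMap_inr (i : Fin l₂.length) :
    (appendMap f g).equiv ((append l₁ l₂).equiv (.inr i)) =
      (append l₁' l₂').equiv (.inr (g.equiv i)) :=
  congrArg (fun x => (append l₁' l₂').equiv ((f.sum g).equiv x))
    ((append l₁ l₂).equiv.symm_apply_apply (.inr i))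

end

theorem append_singleton_inl (s : Sgn) (l : List Sgn) (i : Fin 1) :
    (append [s] l).equiv (.inl i) = (0 : Fin (l.length + 1)) :=
  Fin.ext ((append_inl_val _ _ _).trans (by simp))

theorem append_singleton_inr (s : Sgn) (l : List Sgn) (i : Fin l.length) :
    (append [s] l).equiv (.inr i) = i.succ :=
  Fin.ext ((append_inr_val _ _ _).trans (by simp [Nat.add_comm]))

/-- The disjoint union with one more strand in front. -/
def cons (s : Sgn) {l l' : List Sgn} (f : SEquiv (ZeroMfd.ofSeq l) (ZeroMfd.ofSeq l')) :
    SEquiv (ZeroMfd.ofSeq (s :: l)) (ZeroMfd.ofSeq (s :: l')) :=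
  appendMap (refl (ZeroMfd.ofSeq [s])) f

theorem cons_zero (s : Sgn) {l l' : List Sgn} (f : SEquiv (ZeroMfd.ofSeq l) (ZeroMfd.ofSeq l')) :
    (cons s f).equiv (0 : Fin (l.length + 1)) = (0 : Fin (l'.length + 1)) := by
  rw [← append_singleton_inl s l 0, ← append_singleton_inl s l' 0]
  exact appendMap_inl _ _ _

theorem cons_succ (s : Sgn) {l l' : List Sgn} (f : SEquiv (ZeroMfd.ofSeq l) (ZeroMfd.ofSeq l'))
    (i : Fin l.length) : (cons s f).equiv i.succ = (f.equiv i : Fin _).succ := by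
  rw [← append_singleton_inr s l i, ← append_singleton_inr s l' _]
  exact appendMap_inr _ _ _

/-- A bijection that preserves the first point permutes the remaining ones, so the first strand
stands apart from a permutation of the rest. -/
theorem exists_eq_cons {s : Sgn} {l l' : List Sgn}
    (f : SEquiv (ZeroMfd.ofSeq (s :: l)) (ZeroMfd.ofSeq (s :: l')))
    (h : f.equiv (0 : Fin (l.length + 1)) = (0 : Fin (l'.length + 1))) :
    ∃ f', f = cons s f' := by
  have h' : ∀ i : Fin l.length, f.equiv i.succ ≠ (0 : Fin (l'.length + 1)) := fun i hi =>
    Fin.succ_ne_zero i (f.equiv.injective (hi.trans h.symm))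
  let f' : SEquiv (ZeroMfd.ofSeq l) (ZeroMfd.ofSeq l') :=
    ⟨Equiv.ofBijective (fun i : Fin l.length => (f.equiv i.succ : Fin _).pred (h' i)) (by
      constructor
      · exact fun i j hij => Fin.succ_injective _ (f.equiv.injective (Fin.pred_inj.1 hij))
      · intro j
        obtain ⟨x, hx⟩ := f.equiv.surjective (Fin.succ (n := l'.length) j)
        induction x using Fin.cases (n := l.length) with
        | zero => exact absurd (hx.symm.trans h) (Fin.succ_ne_zero _)
        | succ i => exact ⟨i, by simp [hx]⟩), fun i =>
      (congrArg (s :: l').get (Fin.succ_pred (f.equiv i.succ : Fin (l'.length + 1)) (h' i))).trans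
        (f.sign_eq (Fin.succ (n := l.length) i))⟩
  refine ⟨f', SEquiv.ext fun x => ?_⟩
  induction x using Fin.cases (n := l.length) with
  | zero => exact h.trans (cons_zero s f').symm
  | succ i =>
    exact (Fin.succ_pred (f.equiv i.succ : Fin (l'.length + 1)) (h' i)).symm.trans
      (cons_succ s f' i).symm

end SEquiv

/-- Every oriented `0`-manifold is that of a sign sequence. -/
theorem ZeroMfd.exists_ofSeq (X : ZeroMfd) : ∃ l, Nonempty (SEquiv (ZeroMfd.ofSeq l) X) := by
  obtain ⟨n, ⟨e⟩⟩ := Finite.exists_equiv_fin X.pts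
  refine ⟨List.ofFn fun i => X.sign (e.symm i), ⟨⟨(finCongr (List.length_ofFn)).trans e.symm,
    fun i => ?_⟩⟩⟩
  exact (List.get_ofFn (fun i => X.sign (e.symm i)) i).symm

namespace Cob

variable {S : Type v}

theorem permIso_comp {X Y Z : Cob S} (f : SEquiv (ZeroMfd.ofSeq X.seq) (ZeroMfd.ofSeq Y.seq))
    (g : SEquiv (ZeroMfd.ofSeq Y.seq) (ZeroMfd.ofSeq Z.seq)) :
    (permIso f : X ≅ Y).hom ≫ (permIso g : Y ≅ Z).hom = (permIso (f.trans g) : X ≅ Z).hom :=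
  Bord.perm_comp_perm f g

theorem permIso_tensor {X Y X' Y' : Cob S}
    (f : SEquiv (ZeroMfd.ofSeq X.seq) (ZeroMfd.ofSeq Y.seq))
    (g : SEquiv (ZeroMfd.ofSeq X'.seq) (ZeroMfd.ofSeq Y'.seq)) :
    (permIso f : X ≅ Y).hom ⊗ₘ (permIso g : X' ≅ Y').hom =
      (permIso (SEquiv.appendMap f g) : X ⊗ X' ≅ Y ⊗ Y').hom := by
  change Bord.perm (SEquiv.append _ _).symm ≫ (Bord.perm _ ⊗ₘ Bord.perm _) ≫
    Bord.perm (SEquiv.append _ _) = Bord.perm _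
  rw [Bord.perm_tensor_perm, Bord.perm_comp_perm, Bord.perm_comp_perm]
  rfl

/-- A property of cobordisms that holds for the generating cobordisms, and that is preserved by
gluing and by disjoint union. -/
structure Generating (W : MorphismProperty (Cob S)) : Prop where
  id : ∀ X : Cob S, W (𝟙 X)
  comp : ∀ {X Y Z : Cob S} (f : X ⟶ Y) (g : Y ⟶ Z), W f → W g → W (f ≫ g)
  tensor : ∀ {X Y X' Y' : Cob S} (f : X ⟶ Y) (g : X' ⟶ Y'), W f → W g → W (f ⊗ₘ g)
  braiding : ∀ X Y : Cob S, W (β_ X Y).hom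
  cup : W (cup S)
  cap : W (cap S)
  halfIn : W (halfIn S)
  halfOut : W (halfOut S)
  dot : ∀ a : S, W (dot a)

namespace Generating

variable {W : MorphismProperty (Cob S)} (hW : Generating W)
include hW

theorem of_cons (s : Sgn) {l l' : List Sgn} {f : SEquiv (ZeroMfd.ofSeq l) (ZeroMfd.ofSeq l')}
    (h : W (X := ⟨l⟩) (Y := ⟨l'⟩) (permIso f).hom) :
    W (X := ⟨s :: l⟩) (Y := ⟨s :: l'⟩) (permIso (SEquiv.cons s f)).hom := by
  have e : (permIso (X := ⟨s :: l⟩) (Y := ⟨s :: l'⟩) (SEquiv.cons s f)).hom =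
      𝟙 (⟨[s]⟩ : Cob S) ⊗ₘ (permIso (X := (⟨l⟩ : Cob S)) (Y := ⟨l'⟩) f).hom :=
    (permIso_tensor (X := ⟨[s]⟩) (Y := ⟨[s]⟩) (SEquiv.refl _) f).symm
  rw [e]
  exact hW.tensor _ _ (hW.id _) h

/-- This is one pass of insertion sort: the point `y` is removed from `l`, placed in front, and
carried back to its position by crossing its left neighbours one at a time. -/
theorem exists_insert (s : Sgn) (l : List Sgn) (y : Fin l.length) (hy : l.get y = s) :
    ∃ (l' : List Sgn) (k : SEquiv (ZeroMfd.ofSeq (s :: l')) (ZeroMfd.ofSeq l)),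
      k.equiv (0 : Fin (l'.length + 1)) = y ∧
        W (X := ⟨s :: l'⟩) (Y := ⟨l⟩) (permIso k).hom := by
  induction l with
  | nil => exact y.elim0
  | cons t l ih =>
    induction y using Fin.cases (n := l.length) with
    | zero =>
      obtain rfl : t = s := hy
      exact ⟨l, SEquiv.refl _, rfl, hW.id _⟩
    | succ y =>
      obtain ⟨l', k, hk, hWk⟩ := ih y hy
      let σ : SEquiv (ZeroMfd.ofSeq ([s] ++ [t])) (ZeroMfd.ofSeq ([t] ++ [s])) :=
        ((SEquiv.append [s] [t]).symm.trans (SEquiv.swap _ _)).trans (SEquiv.append [t] [s])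
      -- `τ` crosses the first two strands; behind the strand `t` the induction hypothesis carries
      -- `s` the rest of the way.
      let τ : SEquiv (ZeroMfd.ofSeq (s :: t :: l')) (ZeroMfd.ofSeq (t :: s :: l')) :=
        SEquiv.appendMap σ (SEquiv.refl (ZeroMfd.ofSeq l'))
      have e : (permIso (X := (⟨s :: t :: l'⟩ : Cob S)) (Y := ⟨t :: l⟩)
          (τ.trans (SEquiv.cons t k))).hom =
          ((β_ (⟨[s]⟩ : Cob S) ⟨[t]⟩).hom ⊗ₘ 𝟙 (⟨l'⟩ : Cob S)) ≫
            (permIso (X := (⟨t :: s :: l'⟩ : Cob S)) (Y := ⟨t :: l⟩) (SEquiv.cons t k)).hom :=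
        (permIso_comp _ _).symm.trans (congrArg (· ≫ (permIso _).hom)
          (permIso_tensor (X := ⟨[s] ++ [t]⟩) (Y := ⟨[t] ++ [s]⟩) (X' := ⟨l'⟩) (Y' := ⟨l'⟩)
            σ (SEquiv.refl _)).symm)
      refine ⟨t :: l', τ.trans (SEquiv.cons t k), ?_, ?_⟩
      · have hσ : σ.equiv (0 : Fin 2) = (1 : Fin 2) := by
          have h₀ : (0 : Fin 2) = (SEquiv.append [s] [t]).equiv (.inl (0 : Fin 1)) :=
            (SEquiv.append_singleton_inl s [t] 0).symm
          rw [h₀]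
          exact (congrArg (fun x => (SEquiv.append [t] [s]).equiv ((SEquiv.swap _ _).equiv x))
            ((SEquiv.append [s] [t]).equiv.symm_apply_apply (.inl (0 : Fin 1)))).trans
              (SEquiv.append_singleton_inr t [s] (0 : Fin 1))
        have hτ : τ.equiv (0 : Fin (l'.length + 2)) = Fin.succ (0 : Fin (l'.length + 1)) := by
          have h₀ : (0 : Fin (l'.length + 2)) = (SEquiv.append [s, t] l').equiv (.inl (0 : Fin 2)) :=
            Fin.ext (SEquiv.append_inl_val [s, t] l' (0 : Fin 2)).symm
          rw [h₀]
          refine (SEquiv.appendMap_inl σ _ (0 : Fin 2)).trans ?_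
          rw [hσ]
          exact Fin.ext (SEquiv.append_inl_val [t, s] l' (1 : Fin 2))
        refine (congrArg (SEquiv.cons t k).equiv hτ).trans ?_
        refine (SEquiv.cons_succ t k _).trans (congrArg _ hk)
      · rw [e]
        exact hW.comp _ _ (hW.tensor _ _ (hW.braiding _ _) (hW.id _)) (hW.of_cons t hWk)

/-- Let `k` be the insertion that carries the front point to the image of the first point under `f`.
Then `f` followed by the inverse of `k` fixes the first point, and induction applies to the rest. -/
theorem of_perm {l l' : List Sgn} (f : SEquiv (ZeroMfd.ofSeq l) (ZeroMfd.ofSeq l')) :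
    W (X := ⟨l⟩) (Y := ⟨l'⟩) (permIso f).hom := by
  induction l generalizing l' with
  | nil =>
    have : l' = [] := List.length_eq_zero_iff.1 (by simpa using Fintype.card_congr f.equiv.symm)
    subst this
    obtain rfl : f = SEquiv.refl _ := SEquiv.ext fun i => i.elim0
    exact hW.id _
  | cons s l ih =>
    obtain ⟨m, k, hk, hWk⟩ := hW.exists_insert s l' (f.equiv (0 : Fin (l.length + 1)))
      (f.sign_eq (0 : Fin (l.length + 1)))
    obtain ⟨f', hf'⟩ := SEquiv.exists_eq_cons (f.trans k.symm)
      ((k.equiv.symm_apply_eq).2 hk.symm)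
    have e : (permIso (X := (⟨s :: l⟩ : Cob S)) (Y := ⟨l'⟩) f).hom =
        (permIso (X := (⟨s :: l⟩ : Cob S)) (Y := ⟨s :: m⟩) (SEquiv.cons s f')).hom ≫
          (permIso (X := (⟨s :: m⟩ : Cob S)) (Y := ⟨l'⟩) k).hom := by
      rw [← hf']
      refine Eq.trans (congrArg (Bord.perm ·) ?_) (Bord.perm_comp_perm _ _).symm
      exact SEquiv.ext fun x => (k.equiv.apply_symm_apply _).symm
    rw [e]
    exact hW.comp _ _ (hW.of_cons s (ih f')) hWk

/-- The property of a cobordism that all its identifications with cobordisms between sign sequences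
have a given property. -/
def _root_.OneCob.Cob.extend (W : MorphismProperty (Cob S)) : MorphismProperty (Bord S) :=
  fun X Y f => ∀ (L M : Cob S) (g : SEquiv (ZeroMfd.ofSeq L.seq) X.mfd)
    (h : SEquiv Y.mfd (ZeroMfd.ofSeq M.seq)),
      W (X := L) (Y := M) (ofBord ((Bord.perm g : L.toBord ⟶ X) ≫ f ≫ (Bord.perm h : Y ⟶ M.toBord)))

theorem extend_of {X Y : Cob S} {f : X ⟶ Y} (hf : W f) :
    Cob.extend W (X := X.toBord) (Y := Y.toBord) f :=
  fun _ _ g h => hW.comp _ _ (hW.of_perm g) (hW.comp _ _ hf (hW.of_perm h))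

/-- Every `0`-manifold can be numbered as a sign sequence. Different numberings differ by
permutations, which have the property by `of_perm`. -/
theorem extend : Bord.Generating (Cob.extend W) where
  comp := by
    intro X Y Z f f' hf hf' L M g h
    obtain ⟨l, ⟨k⟩⟩ := Y.mfd.exists_ofSeq
    -- The intermediate manifold is identified with a sign sequence, so that the gluing takes place
    -- in `Cob`.
    have e : (Bord.perm g : L.toBord ⟶ X) ≫ (f ≫ f') ≫ (Bord.perm h : Z ⟶ M.toBord) =
        (Bord.perm g ≫ f ≫ (Bord.permIso (X := ⟨ZeroMfd.ofSeq l⟩) (Y := Y) k).inv) ≫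
          (Bord.permIso (X := ⟨ZeroMfd.ofSeq l⟩) (Y := Y) k).hom ≫ f' ≫ Bord.perm h := by
      simp
    rw [e]
    exact hW.comp (Y := ⟨l⟩) _ _ (hf L ⟨l⟩ g k.symm) (hf' ⟨l⟩ M k h)
  tensor := by
    intro X Y X' Y' f f' hf hf' L M g h
    obtain ⟨l₁, ⟨k₁⟩⟩ := X.mfd.exists_ofSeq
    obtain ⟨l₂, ⟨k₂⟩⟩ := X'.mfd.exists_ofSeq
    obtain ⟨m₁, ⟨k₃⟩⟩ := Y.mfd.exists_ofSeq
    obtain ⟨m₂, ⟨k₄⟩⟩ := Y'.mfd.exists_ofSeq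
    let i₁ := Bord.permIso (X := ⟨ZeroMfd.ofSeq l₁⟩) (Y := X) k₁
    let i₂ := Bord.permIso (X := ⟨ZeroMfd.ofSeq l₂⟩) (Y := X') k₂
    let i₃ := Bord.permIso (X := ⟨ZeroMfd.ofSeq m₁⟩) (Y := Y) k₃
    let i₄ := Bord.permIso (X := ⟨ZeroMfd.ofSeq m₂⟩) (Y := Y') k₄
    let j₁ := μIso (⟨l₁⟩ : Cob S) ⟨l₂⟩
    let j₂ := μIso (⟨m₁⟩ : Cob S) ⟨m₂⟩
    -- The middle factor is the tensor product of `Cob` for numbered versions of `f` and `f'`; the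
    -- outer factors are permutations.
    have e : (Bord.perm g : L.toBord ⟶ X ⊗ X') ≫ (f ⊗ₘ f') ≫ (Bord.perm h : Y ⊗ Y' ⟶ M.toBord) =
        (Bord.perm g ≫ (i₁.inv ⊗ₘ i₂.inv) ≫ j₁.hom) ≫
          (j₁.inv ≫ ((i₁.hom ≫ f ≫ i₃.inv) ⊗ₘ (i₂.hom ≫ f' ≫ i₄.inv)) ≫ j₂.hom) ≫
            (j₂.inv ≫ (i₃.hom ⊗ₘ i₄.hom) ≫ Bord.perm h) := by
      have : (f ⊗ₘ f') = (i₁.inv ⊗ₘ i₂.inv) ≫ ((i₁.hom ≫ f ≫ i₃.inv) ⊗ₘ (i₂.hom ≫ f' ≫ i₄.inv)) ≫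
          (i₃.hom ⊗ₘ i₄.hom) := by
        simp
      rw [this]
      simp only [Category.assoc, Iso.hom_inv_id_assoc]
    rw [e]
    refine hW.comp (Y := ⟨l₁ ++ l₂⟩) _ _ ?_ (hW.comp (Y := ⟨m₁ ++ m₂⟩) _ _
      (hW.tensor (X := ⟨l₁⟩) (X' := ⟨l₂⟩) (Y := ⟨m₁⟩) (Y' := ⟨m₂⟩) _ _
        (hf _ _ k₁ k₃.symm) (hf' _ _ k₂ k₄.symm)) ?_)
    · have e₁ : Bord.perm g ≫ (i₁.inv ⊗ₘ i₂.inv) ≫ j₁.hom = Bord.perm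
          (g.trans ((k₁.symm.sum k₂.symm).trans (SEquiv.append l₁ l₂))) := by
        change Bord.perm g ≫ (Bord.perm k₁.symm ⊗ₘ Bord.perm k₂.symm) ≫
          Bord.perm (SEquiv.append _ _) = _
        rw [Bord.perm_tensor_perm, Bord.perm_comp_perm, Bord.perm_comp_perm]
      rw [e₁]
      exact hW.of_perm _
    · have e₂ : j₂.inv ≫ (i₃.hom ⊗ₘ i₄.hom) ≫ Bord.perm h = Bord.perm
          ((SEquiv.append m₁ m₂).symm.trans ((k₃.sum k₄).trans h)) := by
        change Bord.perm (SEquiv.append _ _).symm ≫ (Bord.perm k₃ ⊗ₘ Bord.perm k₄) ≫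
          Bord.perm h = _
        rw [Bord.perm_tensor_perm, Bord.perm_comp_perm, Bord.perm_comp_perm]
      rw [e₂]
      exact hW.of_perm _
  perm := by
    intro X Y f L M g h
    rw [Bord.perm_comp_perm, Bord.perm_comp_perm]
    exact hW.of_perm _
  cup := hW.extend_of hW.cup
  cap := hW.extend_of hW.cap
  halfIn := hW.extend_of hW.halfIn
  halfOut := hW.extend_of hW.halfOut
  dot a := hW.extend_of (hW.dot a)

/-- Every cobordism between sign sequences is generated by crossings, the cup, the cap, the
half-intervals and the intervals with one dot. -/
theorem all {X Y : Cob S} (f : X ⟶ Y) : W f := by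
  -- The extended property is specialized to the trivial numberings of both ends.
  have h := hW.extend.all (X := X.toBord) (Y := Y.toBord) f X Y (SEquiv.refl _) (SEquiv.refl _)
  have e : (𝟙 X : X ⟶ X) ≫ f ≫ 𝟙 Y = f := by simp
  rw [← e]
  exact h

end Generating
end Cob
end
end OneCob

-- Comparison of two monoidal functors with given values on points

universe w₁ w₂
namespace OneCob
noncomputable section
open CategoryTheory MonoidalCategory

section Coherence

variable {D : Type w₁} [Category.{w₂} D] [MonoidalCategory D]

/-- The base case for the monoidality of the comparison, with `e` and `e'` the counits of the two
functors and `i` the unit of the second. -/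
theorem leftUnitor_comp_of_retract {A B P Q : D} (e : A ⟶ 𝟙_ D) (i : 𝟙_ D ⟶ B) (e' : B ⟶ 𝟙_ D)
    (h : i ≫ e' = 𝟙 _) (c : P ⟶ Q) :
    ((e ▷ P) ≫ (λ_ P).hom) ≫ c = ((e ≫ i) ⊗ₘ c) ≫ (e' ▷ Q) ≫ (λ_ Q).hom := by
  rw [Category.assoc, ← leftUnitor_naturality, ← tensorHom_id, ← tensorHom_id, ← id_tensorHom,
    tensorHom_comp_tensorHom_assoc, tensorHom_comp_tensorHom_assoc, Category.assoc, h]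
  simp

theorem rightUnitor_comp_of_retract {A B P Q : D} (e : A ⟶ 𝟙_ D) (i : 𝟙_ D ⟶ B) (e' : B ⟶ 𝟙_ D)
    (h : i ≫ e' = 𝟙 _) (c : P ⟶ Q) :
    ((P ◁ e) ≫ (ρ_ P).hom) ≫ c = (c ⊗ₘ (e ≫ i)) ≫ (Q ◁ e') ≫ (ρ_ Q).hom := by
  rw [Category.assoc, ← rightUnitor_naturality, ← tensorHom_id, ← id_tensorHom, ← id_tensorHom,
    tensorHom_comp_tensorHom_assoc, tensorHom_comp_tensorHom_assoc, Category.assoc, h]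
  simp

/-- The inductive step for monoidality. Compatibility with the products of the pairs `(A, P)`, `(P,
Q)` and `(A, K)` implies compatibility with the product of `(M, Q)`, because both families of
products are associative. -/
theorem comp_tensor_of_assoc {A A' P P' Q Q' M M' N N' K K' : D}
    {μ₁ : A ⊗ P ⟶ M} {μ₂ : M ⊗ Q ⟶ N} {μ₃ : P ⊗ Q ⟶ K} {μ₄ : A ⊗ K ⟶ N}
    {ν₁ : A' ⊗ P' ⟶ M'} {ν₂ : M' ⊗ Q' ⟶ N'} {ν₃ : P' ⊗ Q' ⟶ K'} {ν₄ : A' ⊗ K' ⟶ N'}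
    (hμ : (μ₁ ▷ Q) ≫ μ₂ = (α_ _ _ _).hom ≫ (A ◁ μ₃) ≫ μ₄)
    (hν : (ν₁ ▷ Q') ≫ ν₂ = (α_ _ _ _).hom ≫ (A' ◁ ν₃) ≫ ν₄)
    {a : A ⟶ A'} {p : P ⟶ P'} {q : Q ⟶ Q'} {m : M ⟶ M'} {n : N ⟶ N'} {k : K ⟶ K'}
    (h₁ : μ₁ ≫ m = (a ⊗ₘ p) ≫ ν₁) (h₃ : μ₃ ≫ k = (p ⊗ₘ q) ≫ ν₃)
    (h₄ : μ₄ ≫ n = (a ⊗ₘ k) ≫ ν₄) :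
    (μ₁ ▷ Q) ≫ μ₂ ≫ n = (μ₁ ▷ Q) ≫ (m ⊗ₘ q) ≫ ν₂ := by
  rw [← Category.assoc, hμ, Category.assoc, Category.assoc, h₄, ← id_tensorHom,
    tensorHom_comp_tensorHom_assoc, h₃, ← tensorHom_id, tensorHom_comp_tensorHom_assoc, h₁]
  have e₁ : (𝟙 A ≫ a) ⊗ₘ ((p ⊗ₘ q) ≫ ν₃) = (a ⊗ₘ (p ⊗ₘ q)) ≫ (A' ◁ ν₃) := by
    rw [← id_tensorHom, tensorHom_comp_tensorHom]
    simp
  have e₂ : ((a ⊗ₘ p) ≫ ν₁) ⊗ₘ (𝟙 Q ≫ q) = ((a ⊗ₘ p) ⊗ₘ q) ≫ (ν₁ ▷ Q') := by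
    rw [← tensorHom_id, tensorHom_comp_tensorHom]
    simp
  rw [e₁, e₂, Category.assoc, Category.assoc, hν, ← associator_naturality_assoc]

end Coherence

namespace Cob

variable {S : Type v} {D : Type w₁} [Category.{w₂} D] [MonoidalCategory D]

open Functor.LaxMonoidal Functor.OplaxMonoidal

section

variable (F : Cob S ⥤ D) [F.Monoidal]

/-- Concatenation is strict: the left unitor at `X` is an identity. Unitality of `F` therefore
determines this component of `μ`. The next two lemmas use the right unitor at a single point and the
associator with a single point in front in the same way. -/
theorem μ_nil (X : Cob S) : μ F (𝟙_ _) X = (η F ▷ F.obj X) ≫ (λ_ (F.obj X)).hom := by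
  have h := Functor.LaxMonoidal.left_unitality F X
  have e : F.map (λ_ X).hom = 𝟙 (F.obj X) := F.map_id X
  rw [h, e]
  refine Eq.trans ?_ (Functor.Monoidal.whiskerRight_η_ε_assoc F (F.obj X) _).symm
  exact (Category.comp_id _).symm

theorem μ_singleton (s : Sgn) : μ F ⟨[s]⟩ (𝟙_ _) =
    (F.obj ⟨[s]⟩ ◁ η F) ≫ (ρ_ (F.obj ⟨[s]⟩)).hom := by
  have h := Functor.LaxMonoidal.right_unitality F ⟨[s]⟩
  have e : F.map (ρ_ ⟨[s]⟩).hom = 𝟙 (F.obj ⟨[s]⟩) := F.map_id _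
  rw [h, e]
  refine Eq.trans ?_ (Functor.Monoidal.whiskerLeft_η_ε_assoc F (F.obj _) _).symm
  exact (Category.comp_id _).symm

theorem μ_cons (s : Sgn) (X Y : Cob S) :
    (μ F ⟨[s]⟩ X ▷ F.obj Y) ≫ μ F (⟨[s]⟩ ⊗ X) Y =
      (α_ _ _ _).hom ≫ (F.obj ⟨[s]⟩ ◁ μ F X Y) ≫ μ F ⟨[s]⟩ (X ⊗ Y) := by
  have h := Functor.LaxMonoidal.associativity F ⟨[s]⟩ X Y
  have e : F.map (α_ ⟨[s]⟩ X Y).hom = 𝟙 (F.obj (⟨[s]⟩ ⊗ X ⊗ Y)) := F.map_id _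
  rw [← h, e]
  exact (congrArg (_ ≫ ·) (Category.comp_id (μ F (⟨[s]⟩ ⊗ X) Y))).symm

end

section Comparison

variable (F G : Cob S ⥤ D) [F.Monoidal] [G.Monoidal]
  (t : ∀ s : Sgn, F.obj ⟨[s]⟩ ≅ G.obj ⟨[s]⟩)

/-- The comparison of two monoidal functors that is determined by its values on points. -/
def comparisonSeq : ∀ l : List Sgn, F.obj ⟨l⟩ ≅ G.obj ⟨l⟩
  | [] => (Functor.Monoidal.εIso F).symm ≪≫ Functor.Monoidal.εIso G
  | s :: l => (Functor.Monoidal.μIso F ⟨[s]⟩ ⟨l⟩).symm ≪≫ (t s ⊗ᵢ comparisonSeq l) ≪≫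
      Functor.Monoidal.μIso G ⟨[s]⟩ ⟨l⟩

/-- The comparison of two monoidal functors that is determined by its values on points. -/
abbrev comparison (X : Cob S) : F.obj X ≅ G.obj X := comparisonSeq F G t X.seq

theorem comparison_unit : ε F ≫ (comparison F G t (𝟙_ _)).hom = ε G := by
  change ε F ≫ η F ≫ ε G = ε G
  simp

theorem comparison_cons (s : Sgn) (X : Cob S) :
    μ F ⟨[s]⟩ X ≫ (comparison F G t (⟨[s]⟩ ⊗ X)).hom =
      ((t s).hom ⊗ₘ (comparison F G t X).hom) ≫ μ G ⟨[s]⟩ X := by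
  change μ F ⟨[s]⟩ X ≫ δ F ⟨[s]⟩ X ≫ ((t s).hom ⊗ₘ (comparison F G t X).hom) ≫ μ G ⟨[s]⟩ X = _
  simp

/-- Induction on the length of `X`. The comparison is defined by splitting off the first point, and
associativity moves this splitting past `Y`. -/
theorem comparison_tensor (X Y : Cob S) :
    μ F X Y ≫ (comparison F G t (X ⊗ Y)).hom =
      ((comparison F G t X).hom ⊗ₘ (comparison F G t Y).hom) ≫ μ G X Y := by
  obtain ⟨l⟩ := X
  induction l with
  | nil =>
    refine (congrArg (· ≫ (comparison F G t Y).hom) (μ_nil F Y)).trans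
      (Eq.trans ?_ (congrArg (_ ≫ ·) (μ_nil G Y)).symm)
    exact leftUnitor_comp_of_retract _ _ _ (Functor.Monoidal.ε_η G) _
  | cons s l ih =>
    rw [← cancel_epi (μ F ⟨[s]⟩ ⟨l⟩ ▷ F.obj Y)]
    exact comp_tensor_of_assoc (μ_cons F s ⟨l⟩ Y) (μ_cons G s ⟨l⟩ Y)
      (comparison_cons F G t s ⟨l⟩) ih (comparison_cons F G t s (⟨l⟩ ⊗ Y))

/-- A single point is split as itself and the empty sequence, where the comparison is `η F ≫ ε G`;
the unit constraints remove this factor. -/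
theorem comparison_point (s : Sgn) : comparison F G t ⟨[s]⟩ = t s := by
  apply Iso.ext
  rw [← cancel_epi (μ F ⟨[s]⟩ (𝟙_ _))]
  refine (comparison_cons F G t s (𝟙_ _)).trans ?_
  refine (congrArg (_ ≫ ·) (μ_singleton G s)).trans
    (Eq.trans ?_ (congrArg (· ≫ _) (μ_singleton F s)).symm)
  exact (rightUnitor_comp_of_retract _ _ _ (Functor.Monoidal.ε_η G) _).symm

/-- The cobordisms for which the comparison is natural. -/
def naturalFor : MorphismProperty (Cob S) := fun X Y f =>
  F.map f ≫ (comparison F G t Y).hom = (comparison F G t X).hom ≫ G.map f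

end Comparison

section Braided

variable [BraidedCategory D] (F G : Cob S ⥤ D) [F.Braided] [G.Braided]
  (t : ∀ s : Sgn, F.obj ⟨[s]⟩ ≅ G.obj ⟨[s]⟩)

/-- Tensor products are handled by naturality of `μ` and monoidality of the comparison, crossings by
the compatibility of both functors with the braidings. -/
theorem generating_naturalFor (hcup : naturalFor F G t (cup S)) (hcap : naturalFor F G t (cap S))
    (hin : naturalFor F G t (halfIn S)) (hout : naturalFor F G t (halfOut S))
    (hdot : ∀ a : S, naturalFor F G t (dot a)) : Generating (naturalFor F G t) where
  id X := by simp [naturalFor]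
  comp f g hf hg := by
    simp only [naturalFor] at *
    rw [F.map_comp, Category.assoc, hg, reassoc_of% hf, G.map_comp]
  tensor {X Y X' Y'} f g hf hg := by
    simp only [naturalFor] at *
    rw [← cancel_epi (μ F X X'), ← Functor.LaxMonoidal.μ_natural_assoc, comparison_tensor,
      tensorHom_comp_tensorHom_assoc, hf, hg, ← tensorHom_comp_tensorHom_assoc,
      Functor.LaxMonoidal.μ_natural, ← Category.assoc, ← comparison_tensor, Category.assoc]
  braiding X Y := by
    simp only [naturalFor]
    rw [← cancel_epi (μ F X Y), Functor.LaxBraided.braided_assoc, comparison_tensor,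
      ← BraidedCategory.braiding_naturality_assoc, ← Functor.LaxBraided.braided,
      ← Category.assoc, ← comparison_tensor, Category.assoc]
  cup := hcup
  cap := hcap
  halfIn := hin
  halfOut := hout
  dot := hdot

/-- Two symmetric monoidal functors that agree on the generators are isomorphic. -/
theorem exists_iso (hcup : naturalFor F G t (cup S)) (hcap : naturalFor F G t (cap S))
    (hin : naturalFor F G t (halfIn S)) (hout : naturalFor F G t (halfOut S))
    (hdot : ∀ a : S, naturalFor F G t (dot a)) : ∃ e : F ≅ G, NatTrans.IsMonoidal e.hom :=
  ⟨NatIso.ofComponents (comparison F G t)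
      fun f => (generating_naturalFor F G t hcup hcap hin hout hdot).all f,
    { unit := comparison_unit F G t
      tensor := comparison_tensor F G t }⟩

end Braided
end Cob
end
end OneCob

/-! ### Functors that realize the same datum are isomorphic -/

namespace OneCob
noncomputable section
open CategoryTheory MonoidalCategory
open scoped TensorProduct
open Functor.LaxMonoidal Functor.OplaxMonoidal

variable {R : Type u} [CommSemiring R] {S : Type v}

/-- A functor is determined up to isomorphism by a datum that it realizes. -/
theorem Realizes.equiv {F G : TQFT R S} {D : Datum R S} (hF : Realizes F D) (hG : Realizes G D) :
    F ≈ G := by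
  obtain ⟨α, β, hcap, hcup, hin, hout, hdot⟩ := hF
  obtain ⟨α', β', hcap', hcup', hin', hout', hdot'⟩ := hG
  -- The values at the two points are identified through `P` and its dual.
  let t : ∀ s : Sgn, F.F.obj ⟨[s]⟩ ≅ G.F.obj ⟨[s]⟩
    | .pos => α ≪≫ α'.symm
    | .neg => β ≪≫ β'.symm
  have hp : Cob.comparison F.F G.F t (Cob.plus S) = α ≪≫ α'.symm :=
    Cob.comparison_point F.F G.F t .pos
  have hn : Cob.comparison F.F G.F t (Cob.minus S) = β ≪≫ β'.symm :=
    Cob.comparison_point F.F G.F t .neg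
  have hu : (Cob.comparison F.F G.F t (𝟙_ _)).hom = η F.F ≫ ε G.F := rfl
  obtain ⟨k, ι, p, hιp⟩ := D.fgProjective
  have ht : ∀ X Y : Cob S, (Cob.comparison F.F G.F t (X ⊗ Y)).hom ≫ δ G.F X Y =
      δ F.F X Y ≫ ((Cob.comparison F.F G.F t X).hom ⊗ₘ (Cob.comparison F.F G.F t Y).hom) := by
    intro X Y
    rw [← cancel_epi (μ F.F X Y), ← Category.assoc, Cob.comparison_tensor]
    simp
  refine Cob.exists_iso F.F G.F t ?_ ?_ ?_ ?_ fun a => ?_ <;> unfold Cob.naturalFor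
  -- Both functors send the cup to the same coevaluation. Composition with the structure maps turns
  -- this equality into the naturality square; the other generators are treated alike.
  · have h := congrArg (η F.F ≫ · ≫ (α'.inv ⊗ₘ β'.inv))
      ((hcup k ι p hιp).trans (hcup' k ι p hιp).symm)
    rw [hu, ← cancel_mono (δ G.F (Cob.plus S) (Cob.minus S)), Category.assoc, ht, hp, hn]
    simpa using h
  · have h := congrArg ((β.hom ⊗ₘ α.hom) ≫ · ≫ ε G.F) (hcap.trans hcap'.symm)
    rw [hu, ← cancel_epi (μ F.F (Cob.minus S) (Cob.plus S)),
      ← Category.assoc (μ F.F _ _) _ (G.F.map _), Cob.comparison_tensor, hp, hn]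
    simpa using h
  · have h := congrArg (η F.F ≫ · ≫ α'.inv) (hin.trans hin'.symm)
    rw [hu, hp]
    simpa using h
  · have h := congrArg (α.hom ≫ · ≫ ε G.F) (hout.trans hout'.symm)
    rw [hu, hp]
    simpa using h
  · have h := congrArg (α.hom ≫ · ≫ α'.inv) ((hdot a).trans (hdot' a).symm)
    rw [hp]
    simpa using h

end
end OneCob

/-! ### The zigzags as cell decompositions -/

namespace OneCob
noncomputable section
open CategoryTheory MonoidalCategory

namespace Pre

variable {S : Type v}

/-- The ends of the cap are the flags of an unmarked point. -/
abbrev capFlags (S : Type v) :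
    SEquiv ((ZeroMfd.ofSeq [Sgn.neg]).sum (ZeroMfd.ofSeq [Sgn.pos])) (Kind.plain (S := S)).flags :=
  (SEquiv.swap _ _).trans (flagsEquiv trivial trivial)

theorem strand_iso_relabel_capPre :
    Iso (strand S) ((Cob.capPre S).relabel
      ((SEquiv.append [Sgn.neg] [Sgn.pos]).symm.trans (capFlags S)) SEquiv.nil.symm) := by
  refine ⟨Equiv.refl _, Equiv.refl _, fun v => v.elim, fun _ => ?_, fun _ => ?_⟩
  · rfl
  · rfl

/-- The first zigzag, with the last bend replaced by the boundary of an unmarked point. -/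
abbrev zigzagPos (S : Type v) :
    Pre S (ZeroMfd.ofSeq [Sgn.pos]) ((ZeroMfd.ofSeq [Sgn.pos]).sum (Kind.plain (S := S)).flags) :=
  ((Cob.cupPre S).tensor (perm S (.refl (.ofSeq [Sgn.pos])))).relabel
    ((SEquiv.nil.symm.sum (.refl _)).trans (SEquiv.emptySum _))
    ((((SEquiv.append [Sgn.pos] [Sgn.neg]).symm.sum (.refl _)).trans (SEquiv.assoc _ _ _)).trans
      ((SEquiv.refl _).sum (capFlags S)))

/-- The second zigzag, with the last bend replaced by the boundary of an unmarked point. -/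
abbrev zigzagNeg (S : Type v) :
    Pre S (ZeroMfd.ofSeq [Sgn.neg]) ((ZeroMfd.ofSeq [Sgn.neg]).sum (Kind.plain (S := S)).flags) :=
  ((perm S (.refl (.ofSeq [Sgn.neg]))).tensor (Cob.cupPre S)).relabel
    (((SEquiv.refl _).sum SEquiv.nil.symm).trans (SEquiv.sumEmpty _))
    (((((SEquiv.refl _).sum (SEquiv.append [Sgn.pos] [Sgn.neg]).symm).trans
      (SEquiv.assoc _ _ _).symm).trans (SEquiv.swap _ _)).trans
        ((SEquiv.refl _).sum (capFlags S)))

/-- Closing the open zigzag at an unmarked vertex yields a strand subdivided once: the incoming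
strand is its first half, the edge of the cup its second half. -/
theorem zigzagPos_iso : Iso (zigzagPos S).capOff
    ((perm S (SEquiv.refl (.ofSeq [Sgn.pos]))).subdivide (0 : Fin 1)) := by
  let φ : Option (Empty ⊕ Empty) ≃ Option Empty := Equiv.optionCongr (Equiv.sumEmpty _ _)
  let ψ : Unit ⊕ Fin 1 ≃ Option (Fin 1) :=
    { toFun
        | .inl _ => none
        | .inr _ => some 0
      invFun
        | none => .inl ()
        | some _ => .inr 0
      left_inv := by
        rintro (_ | i)
        · rfl
        · exact congrArg Sum.inr (Subsingleton.elim _ _)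
      right_inv := by
        rintro (_ | i)
        · rfl
        · exact congrArg some (Subsingleton.elim _ _) }
  refine ⟨φ, ψ, ?_, ?_, ?_⟩
  · rintro (_ | v | v) <;> [rfl; exact v.elim; exact v.elim]
  · rintro (_ | (i : Fin 1))
    · rfl
    · fin_cases i
      rfl
  · rintro (_ | (i : Fin 1))
    · rfl
    · fin_cases i
      exact subdivide_tgt_self (perm S (SEquiv.refl (.ofSeq [Sgn.pos]))) (0 : Fin 1)

/-- On a negative strand the orientation runs downwards, so here the edge of the cup is the first
half. -/
theorem zigzagNeg_iso : Iso (zigzagNeg S).capOff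
    ((perm S (SEquiv.refl (.ofSeq [Sgn.neg]))).subdivide (0 : Fin 1)) := by
  let φ : Option (Empty ⊕ Empty) ≃ Option Empty := Equiv.optionCongr (Equiv.sumEmpty _ _)
  let ψ : Fin 1 ⊕ Unit ≃ Option (Fin 1) :=
    { toFun
        | .inr _ => some 0
        | .inl _ => none
      invFun
        | none => .inl 0
        | some _ => .inr ()
      left_inv := by
        rintro (i | _)
        · exact congrArg Sum.inl (Subsingleton.elim _ _)
        · rfl
      right_inv := by
        rintro (_ | i)
        · rfl
        · exact congrArg some (Subsingleton.elim _ _) }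
  refine ⟨φ, ψ, ?_, ?_, ?_⟩
  · rintro (_ | v | v) <;> [rfl; exact v.elim; exact v.elim]
  · rintro ((i : Fin 1) | _)
    · fin_cases i
      rfl
    · rfl
  · rintro ((i : Fin 1) | _)
    · fin_cases i
      rfl
    · exact subdivide_tgt_self (perm S (SEquiv.refl (.ofSeq [Sgn.neg]))) (0 : Fin 1)

end Pre

end
end OneCob

/-! ### Duality of the positive and the negative point -/

namespace OneCob
noncomputable section
open CategoryTheory MonoidalCategory

namespace Bord

variable {S : Type v}

theorem ofPre_relabel {X Y X' Y' : ZeroMfd} (c : Pre S X Y) (f : SEquiv X X') (g : SEquiv Y Y') :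
    ofPre (c.relabel f g) = (perm f.symm : (⟨X'⟩ : Bord S) ⟶ ⟨X⟩) ≫ ofPre c ≫
      (perm g : (⟨Y⟩ : Bord S) ⟶ ⟨Y'⟩) :=
  (Iso.eq_inv_comp (permIso (X := (⟨X⟩ : Bord S)) (Y := ⟨X'⟩) f)).2
    (Pre.square f g (Equiv.refl _) (Equiv.refl _) (fun _ => rfl) (fun _ => rfl) fun _ => rfl).symm

/-- By `Pre.capOff_toHom`, the hypothesis says that gluing the star gives the identity up to the
right unitor, which is then moved to the other side. -/
theorem ofPre_comp_star {X : ZeroMfd} {κ : Kind S} (a : Pre S X (X.sum κ.flags)) {e}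
    (h : Pre.Iso a.capOff ((Pre.perm S (SEquiv.refl X)).subdivide e)) :
    ofPre a ≫ ((perm (SEquiv.refl X) : (⟨X⟩ : Bord S) ⟶ ⟨X⟩) ⊗ₘ ofPre (Pre.star κ)) =
      (perm (SEquiv.sumEmpty X).symm : (⟨X⟩ : Bord S) ⟶ ⟨X.sum ZeroMfd.empty⟩) := by
  have h₁ : (ofPre a ≫ ((perm (SEquiv.refl X) : (⟨X⟩ : Bord S) ⟶ ⟨X⟩) ⊗ₘ ofPre (Pre.star κ))) ≫
      (perm (SEquiv.sumEmpty X) : (⟨X.sum ZeroMfd.empty⟩ : Bord S) ⟶ ⟨X⟩) = 𝟙 (⟨X⟩ : Bord S) :=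
    a.capOff_toHom.symm.trans (h.toHom_eq.trans (Pre.subdivide_toHom _ e))
  refine (Iso.eq_comp_inv
    (permIso (X := (⟨X.sum ZeroMfd.empty⟩ : Bord S)) (Y := ⟨X⟩) (SEquiv.sumEmpty X))).2 h₁ |>.trans ?_
  exact Category.id_comp _

variable (S)

/-- The positive point. -/
abbrev pos : Bord S := ⟨ZeroMfd.ofSeq [Sgn.pos]⟩

/-- The negative point. -/
abbrev neg : Bord S := ⟨ZeroMfd.ofSeq [Sgn.neg]⟩

/-- The cup, from the empty `0`-manifold to a disjoint union. -/
def cup : 𝟙_ (Bord S) ⟶ pos S ⊗ neg S :=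
  perm SEquiv.nil ≫ ofPre (Cob.cupPre S) ≫ perm (SEquiv.append _ _).symm

/-- The cap, from a disjoint union to the empty `0`-manifold. -/
def cap : neg S ⊗ pos S ⟶ 𝟙_ (Bord S) :=
  perm (SEquiv.append _ _) ≫ ofPre (Cob.capPre S) ≫ perm SEquiv.nil.symm

/-- The cap is a bent strand, and subdividing it shows the star of an unmarked vertex. The last bend
of a zigzag thereby becomes an instance of capping off. -/
theorem cap_eq : cap S = (perm (Pre.capFlags S) : neg S ⊗ pos S ⟶ ⟨Kind.plain.flags⟩) ≫
    ofPre (Pre.star Kind.plain) := by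
  have e : ofPre (Pre.star (Kind.plain (S := S))) = _ :=
    (Pre.strand_iso.toHom_eq.symm.trans (Pre.subdivide_toHom _ _)).trans
      (Pre.strand_iso_relabel_capPre.toHom_eq.trans (ofPre_relabel _ _ _))
  rw [e, ← Category.assoc, perm_comp_perm]
  refine congrArg (fun f => perm f ≫ ofPre (Cob.capPre S) ≫ perm SEquiv.nil.symm)
    (SEquiv.ext fun x => ?_)
  exact (congrArg (SEquiv.append _ _).equiv ((Pre.capFlags S).equiv.symm_apply_apply x)).symm

/-- The geometric content is `Pre.zigzagPos_iso`. All other morphisms involved are permutations, and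
these are compared point by point. -/
theorem zigzagPos : cup S ▷ pos S ≫ (α_ _ _ _).hom ≫ pos S ◁ cap S =
    (λ_ (pos S)).hom ≫ (ρ_ (pos S)).inv := by
  let f : SEquiv ((ZeroMfd.ofSeq []).sum (ZeroMfd.ofSeq [Sgn.pos])) (ZeroMfd.ofSeq [Sgn.pos]) :=
    (SEquiv.nil.symm.sum (.refl _)).trans (SEquiv.emptySum _)
  have h := ofPre_comp_star (Pre.zigzagPos S) Pre.zigzagPos_iso
  have e : ofPre (Pre.zigzagPos S) = (permIso (X := (⟨_⟩ : Bord S)) (Y := pos S) f).inv ≫ _ :=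
    ofPre_relabel _ _ _
  rw [e, Category.assoc, Iso.inv_comp_eq] at h
  have h₁ := congrArg ((perm (SEquiv.nil.sum (SEquiv.refl (ZeroMfd.ofSeq [Sgn.pos]))) :
    𝟙_ (Bord S) ⊗ pos S ⟶ ⟨_⟩) ≫ ·) h
  have h₂ : (perm (SEquiv.nil.sum (SEquiv.refl (ZeroMfd.ofSeq [Sgn.pos]))) :
      𝟙_ (Bord S) ⊗ pos S ⟶ ⟨_⟩) ≫ (permIso (X := (⟨_⟩ : Bord S)) (Y := pos S) f).hom ≫
        perm (SEquiv.sumEmpty _).symm = (λ_ (pos S)).hom ≫ (ρ_ (pos S)).inv := by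
    change perm _ ≫ perm _ ≫ perm _ = perm _ ≫ perm _
    rw [perm_comp_perm, perm_comp_perm, perm_comp_perm]
    refine congrArg (fun f => perm f) (SEquiv.ext ?_)
    rintro (x | x)
    · exact x.elim
    · rfl
  refine Eq.trans ?_ (h₁.trans h₂)
  have h₃ : (perm (SEquiv.append [Sgn.pos] [Sgn.neg]).symm ▷ pos S) ≫
      (α_ (pos S) (neg S) (pos S)).hom ≫ (pos S ◁ perm (Pre.capFlags S)) =
        perm ((((SEquiv.append [Sgn.pos] [Sgn.neg]).symm.sum (SEquiv.refl (ZeroMfd.ofSeq [Sgn.pos]))).trans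
          (SEquiv.assoc _ _ _)).trans ((SEquiv.refl (ZeroMfd.ofSeq [Sgn.pos])).sum
            (Pre.capFlags S))) := by
    change (perm _ ⊗ₘ perm (SEquiv.refl _)) ≫ perm _ ≫ (perm (SEquiv.refl _) ⊗ₘ perm _) = _
    rw [perm_tensor_perm, perm_tensor_perm, perm_comp_perm, perm_comp_perm]
    rfl
  have h₄ : (perm SEquiv.nil : 𝟙_ (Bord S) ⟶ ⟨ZeroMfd.ofSeq []⟩) ▷ pos S =
    perm (SEquiv.nil.sum (SEquiv.refl (ZeroMfd.ofSeq [Sgn.pos]))) := perm_tensor_perm _ _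
  rw [cap_eq, MonoidalCategory.whiskerLeft_comp]
  unfold cup
  rw [comp_whiskerRight, comp_whiskerRight, h₄]
  simp only [Category.assoc]
  refine congrArg (perm _ ≫ ·) (congrArg (ofPre ((Cob.cupPre S).tensor (Pre.perm S
    (SEquiv.refl (ZeroMfd.ofSeq [Sgn.pos])))) ≫ ·) ?_)
  have h₅ := congrArg (· ≫ (pos S ◁ ofPre (Pre.star Kind.plain))) h₃
  simp only [Category.assoc] at h₅
  exact h₅

theorem zigzagNeg : neg S ◁ cup S ≫ (α_ _ _ _).inv ≫ cap S ▷ neg S =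
    (ρ_ (neg S)).hom ≫ (λ_ (neg S)).inv := by
  let f : SEquiv ((ZeroMfd.ofSeq [Sgn.neg]).sum (ZeroMfd.ofSeq [])) (ZeroMfd.ofSeq [Sgn.neg]) :=
    ((SEquiv.refl _).sum SEquiv.nil.symm).trans (SEquiv.sumEmpty _)
  have h := ofPre_comp_star (Pre.zigzagNeg S) Pre.zigzagNeg_iso
  have e : ofPre (Pre.zigzagNeg S) = (permIso (X := (⟨_⟩ : Bord S)) (Y := neg S) f).inv ≫ _ :=
    ofPre_relabel _ _ _
  rw [e, Category.assoc, Iso.inv_comp_eq] at h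
  have h₁ := congrArg ((perm ((SEquiv.refl (ZeroMfd.ofSeq [Sgn.neg])).sum SEquiv.nil) :
    neg S ⊗ 𝟙_ (Bord S) ⟶ ⟨_⟩) ≫ ·) h
  have h₂ : (perm ((SEquiv.refl (ZeroMfd.ofSeq [Sgn.neg])).sum SEquiv.nil) :
      neg S ⊗ 𝟙_ (Bord S) ⟶ ⟨_⟩) ≫ (permIso (X := (⟨_⟩ : Bord S)) (Y := neg S) f).hom ≫
        perm (SEquiv.sumEmpty _).symm = 𝟙 (neg S ⊗ 𝟙_ (Bord S)) := by
    change perm _ ≫ perm _ ≫ perm _ = perm (SEquiv.refl _)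
    rw [perm_comp_perm, perm_comp_perm]
    refine congrArg (fun f => perm f) (SEquiv.ext ?_)
    rintro (x | x)
    · rfl
    · exact x.elim
  -- The star is glued on the right in `ofPre_comp_star`, so the cap is moved from the left of the
  -- strand to its right by a crossing.
  have hcap : cap S ▷ neg S = (β_ (neg S ⊗ pos S) (neg S)).hom ≫ (neg S ◁ cap S) ≫
      (ρ_ (neg S)).hom ≫ (λ_ (neg S)).inv := by
    rw [← BraidedCategory.braiding_naturality_left_assoc]
    simp
  rw [hcap]
  suffices H : neg S ◁ cup S ≫ (α_ _ _ _).inv ≫ (β_ (neg S ⊗ pos S) (neg S)).hom ≫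
      (neg S ◁ cap S) = 𝟙 _ by
    have H' := congrArg (· ≫ (ρ_ (neg S)).hom ≫ (λ_ (neg S)).inv) H
    simpa only [Category.assoc, Category.id_comp] using H'
  refine Eq.trans ?_ (h₁.trans h₂)
  have h₃ : (neg S ◁ perm (SEquiv.append [Sgn.pos] [Sgn.neg]).symm) ≫
      (α_ (neg S) (pos S) (neg S)).inv ≫ (β_ (neg S ⊗ pos S) (neg S)).hom ≫
        (neg S ◁ perm (Pre.capFlags S)) =
        perm (((((SEquiv.refl (ZeroMfd.ofSeq [Sgn.neg])).sum
          (SEquiv.append [Sgn.pos] [Sgn.neg]).symm).trans (SEquiv.assoc _ _ _).symm).trans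
            (SEquiv.swap _ _)).trans
              ((SEquiv.refl (ZeroMfd.ofSeq [Sgn.neg])).sum (Pre.capFlags S))) := by
    change (perm (SEquiv.refl _) ⊗ₘ perm _) ≫ perm _ ≫ perm _ ≫
      (perm (SEquiv.refl _) ⊗ₘ perm _) = _
    rw [perm_tensor_perm, perm_tensor_perm, perm_comp_perm, perm_comp_perm, perm_comp_perm]
    rfl
  have h₄ : neg S ◁ (perm SEquiv.nil : 𝟙_ (Bord S) ⟶ ⟨ZeroMfd.ofSeq []⟩) =
    perm ((SEquiv.refl (ZeroMfd.ofSeq [Sgn.neg])).sum SEquiv.nil) := perm_tensor_perm _ _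
  rw [cap_eq, MonoidalCategory.whiskerLeft_comp]
  unfold cup
  rw [MonoidalCategory.whiskerLeft_comp, MonoidalCategory.whiskerLeft_comp, h₄]
  simp only [Category.assoc]
  refine congrArg (perm _ ≫ ·) (congrArg (ofPre ((Pre.perm S
    (SEquiv.refl (ZeroMfd.ofSeq [Sgn.neg]))).tensor (Cob.cupPre S)) ≫ ·) ?_)
  have h₅ := congrArg (· ≫ (neg S ◁ ofPre (Pre.star Kind.plain))) h₃
  simp only [Category.assoc] at h₅
  exact h₅

/-- The negative point is dual to the positive point. -/
instance exactPairing : ExactPairing (pos S) (neg S) where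
  coevaluation' := cup S
  evaluation' := cap S
  coevaluation_evaluation' := zigzagNeg S
  evaluation_coevaluation' := zigzagPos S

end Bord

namespace Cob

open Functor.LaxMonoidal Functor.OplaxMonoidal

variable (S : Type v)

/-- The negative point is dual to the positive point. -/
instance exactPairing : ExactPairing (plus S) (minus S) :=
  letI : ExactPairing ((incl S).obj (plus S)) ((incl S).obj (minus S)) := Bord.exactPairing S
  ExactPairing.ofFaithful (incl S) (cap S) (cup S)
    (by
      -- The cap of `Bord` is the cap of `Cob` composed with the comparison maps of `incl`, and
      -- these cancel.
      have h : (incl S).map (cap S) = δ (incl S) (minus S) (plus S) ≫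
          (μ (incl S) (minus S) (plus S) ≫ (incl S).map (cap S) ≫ η (incl S)) ≫ ε (incl S) := by
        simp
      exact h)
    (by
      have h : (incl S).map (cup S) = η (incl S) ≫
          (ε (incl S) ≫ (incl S).map (cup S) ≫ δ (incl S) (plus S) (minus S)) ≫
            μ (incl S) (plus S) (minus S) := by
        simp
      exact h)

end Cob
end
end OneCob

-- Dual objects among semimodules

universe w₃ w₄
namespace OneCob
noncomputable section
open CategoryTheory MonoidalCategory
open scoped TensorProduct

section MapExactPairing

open Functor.LaxMonoidal Functor.OplaxMonoidal

variable {C : Type w₁} {D : Type w₂} [Category.{w₃} C] [Category.{w₄} D] [MonoidalCategory C]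
  [MonoidalCategory D]

/-- Strong monoidal functors preserve duals. -/
abbrev mapExactPairing (F : C ⥤ D) [F.Monoidal] (X Y : C) [ExactPairing X Y] :
    ExactPairing (F.obj X) (F.obj Y) where
  coevaluation' := ε F ≫ F.map (ExactPairing.coevaluation X Y) ≫ δ F X Y
  evaluation' := μ F Y X ≫ F.map (ExactPairing.evaluation X Y) ≫ η F
  coevaluation_evaluation' := by
    have h := congrArg F.map (ExactPairing.coevaluation_evaluation X Y)
    simp only [Functor.map_comp, Functor.Monoidal.map_whiskerLeft,
      Functor.Monoidal.map_whiskerRight, Functor.Monoidal.map_associator_inv,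
      Functor.Monoidal.map_rightUnitor, Functor.Monoidal.map_leftUnitor_inv, Category.assoc,
      Functor.Monoidal.μ_δ_assoc, cancel_epi] at h
    -- The image of the zigzag still has the value of `F` at the unit object at its ends; `ε` on one
    -- side and `δ`, `η` on the other replace it by the unit object of `D`.
    have h' := congrArg (fun f => F.obj Y ◁ ε F ≫ f ≫ δ F _ _ ≫ η F ▷ F.obj Y) h
    simp only [Category.assoc, Functor.Monoidal.μ_δ_assoc] at h'
    simpa [-Functor.LaxMonoidal.μ_natural_left_assoc] using h'
  evaluation_coevaluation' := by
    have h := congrArg F.map (ExactPairing.evaluation_coevaluation X Y)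
    simp only [Functor.map_comp, Functor.Monoidal.map_whiskerLeft,
      Functor.Monoidal.map_whiskerRight, Functor.Monoidal.map_associator,
      Functor.Monoidal.map_leftUnitor, Functor.Monoidal.map_rightUnitor_inv, Category.assoc,
      Functor.Monoidal.μ_δ_assoc, cancel_epi] at h
    have h' := congrArg (fun f => ε F ▷ F.obj X ≫ f ≫ δ F _ _ ≫ F.obj X ◁ η F) h
    simp only [Category.assoc, Functor.Monoidal.μ_δ_assoc] at h'
    simpa [-Functor.LaxMonoidal.μ_natural_left_assoc] using h'

end MapExactPairing

section Dual

variable {R : Type u} [CommSemiring R]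

/-- The coevaluation of a retract of a free module does not depend on the retraction. -/
theorem coev_one_eq_sum {P : Type u} [AddCommMonoid P] [Module R P] {k n : ℕ}
    (ι : P →ₗ[R] (Fin k → R)) (p : (Fin k → R) →ₗ[R] P) (h : p ∘ₗ ι = LinearMap.id)
    (x : Fin n → P) (f : Fin n → Module.Dual R P) (hxf : ∀ y, ∑ i, f i y • x i = y) :
    coev ι p 1 = ∑ i, x i ⊗ₜ[R] f i := by
  have h₂ := eq_sum_of_retract ι p h
  -- By the dual family property, each coordinate functional of `ι` is a combination of the `f i`.
  -- The scalars can then be moved across the tensor sign and reassemble `x i`.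
  have h₃ : ∀ j, LinearMap.proj j ∘ₗ ι = ∑ i, ι (x i) j • f i := fun j => by
    refine LinearMap.ext fun y => ?_
    conv_lhs => rw [← hxf y]
    simp [mul_comm]
  rw [coev, LinearMap.toSpanSingleton_apply, one_smul]
  simp only [h₃]
  conv_rhs => enter [2, i]; rw [h₂ (x i)]
  simp only [TensorProduct.tmul_sum, TensorProduct.sum_tmul, TensorProduct.smul_tmul]
  exact Finset.sum_comm

variable (P N : SemimoduleCat.{u} R) [ExactPairing P N]

/-- The pairing of a module with its categorical dual. -/
def pairing (n : N) (x : P) : R := (ExactPairing.evaluation P N).hom (n ⊗ₜ[R] x)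

/-- Every tensor is a finite sum of pure tensors. For the coevaluation of `1`, the two zigzag
identities evaluated on a vector are the two reproducing formulas. -/
theorem exists_dual_family : ∃ (k : ℕ) (x : Fin k → P) (n : Fin k → N),
    (ExactPairing.coevaluation P N).hom (1 : R) = ∑ i, x i ⊗ₜ[R] n i ∧
      (∀ y : P, ∑ i, pairing P N (n i) y • x i = y) ∧
        ∀ m : N, ∑ i, pairing P N m (x i) • n i = m := by
  obtain ⟨s, hs⟩ := TensorProduct.exists_finset
    (R := R) ((ExactPairing.coevaluation P N).hom (1 : R) : P ⊗[R] N)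
  let e := s.equivFin.symm
  have hz : (ExactPairing.coevaluation P N).hom (1 : R) =
      ∑ i, (e i).1.1 ⊗ₜ[R] (e i).1.2 := by
    rw [hs, ← Finset.sum_coe_sort]
    exact (Equiv.sum_comp e fun z : s => z.1.1 ⊗ₜ[R] z.1.2).symm
  refine ⟨_, fun i => (e i).1.1, fun i => (e i).1.2, hz, fun y => ?_, fun m => ?_⟩
  -- `Ψ` sends `x ⊗ n` to `⟨n, y⟩ x`; its value at the coevaluation of `1` is the zigzag applied to
  -- `y`.
  · let Ψ : P ⊗[R] N →ₗ[R] P := (TensorProduct.rid R P).toLinearMap ∘ₗ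
      (P ◁ ExactPairing.evaluation P N).hom ∘ₗ (α_ P N P).hom.hom ∘ₗ
        (TensorProduct.mk R (P ⊗[R] N) P).flip y
    have hΨ : Ψ ((ExactPairing.coevaluation P N).hom (1 : R)) = (1 : R) • (1 : R) • y :=
      congrArg (fun f => TensorProduct.rid R P (f.hom ((1 : R) ⊗ₜ[R] y)))
        (ExactPairing.evaluation_coevaluation P N)
    rw [hz, map_sum, one_smul, one_smul] at hΨ
    exact hΨ
  -- Here `x ⊗ n` is sent to `⟨m, x⟩ n`.
  · let Ψ : P ⊗[R] N →ₗ[R] N := (TensorProduct.lid R N).toLinearMap ∘ₗ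
      (ExactPairing.evaluation P N ▷ N).hom ∘ₗ (α_ N P N).inv.hom ∘ₗ
        TensorProduct.mk R N (P ⊗[R] N) m
    have hΨ : Ψ ((ExactPairing.coevaluation P N).hom (1 : R)) = (1 : R) • (1 : R) • m :=
      congrArg (fun f => TensorProduct.lid R N (f.hom (m ⊗ₜ[R] (1 : R))))
        (ExactPairing.coevaluation_evaluation P N)
    rw [hz, map_sum, one_smul, one_smul] at hΨ
    exact hΨ

end Dual
end
end OneCob

namespace OneCob
noncomputable section
open CategoryTheory MonoidalCategory
open scoped TensorProduct

section DualEquiv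

variable {R : Type u} [CommSemiring R]

/-- The dual family gives the retraction: `ι` pairs with the `n i`, and `p` sends the basis vectors
to the `x i`. -/
theorem isFGProjective_of_exactPairing (P N : SemimoduleCat.{u} R) [ExactPairing P N] :
    IsFGProjective R P := by
  obtain ⟨k, x, n, -, hx, -⟩ := exists_dual_family P N
  refine ⟨k, LinearMap.pi fun i => TensorProduct.curry (ExactPairing.evaluation P N).hom (n i),
    ∑ i, (LinearMap.toSpanSingleton R P (x i)) ∘ₗ LinearMap.proj i, LinearMap.ext fun y => ?_⟩
  refine Eq.trans ?_ (hx y)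
  simp only [LinearMap.comp_apply, LinearMap.sum_apply]
  rfl

variable (P N : SemimoduleCat.{u} R) [ExactPairing P N]

/-- The categorical dual of a module is its dual. -/
def dualEquiv : N ≃ₗ[R] Module.Dual R P :=
  LinearEquiv.ofBijective (TensorProduct.curry (ExactPairing.evaluation P N).hom) (by
    obtain ⟨k, x, n, -, hx, hn⟩ := exists_dual_family P N
    constructor
    · intro m m' h
      -- An element of `N` is recovered from its pairings with the `x i`.
      have h' : ∀ y, pairing P N m y = pairing P N m' y := LinearMap.congr_fun h
      rw [← hn m, ← hn m']
      simp only [h']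
    · intro f
      -- The preimage of `f` is dictated by the reproducing formula on `N`.
      refine ⟨∑ i, f (x i) • n i, LinearMap.ext fun y => ?_⟩
      rw [map_sum, LinearMap.sum_apply]
      conv_rhs => rw [← hx y, map_sum]
      refine Finset.sum_congr rfl fun i _ => ?_
      rw [map_smul, map_smul, LinearMap.smul_apply, smul_eq_mul, smul_eq_mul]
      exact mul_comm _ _)

theorem evaluation_dualEquiv_symm :
    ((dualEquiv P N).toModuleIsoₛ.inv ▷ P) ≫ ExactPairing.evaluation P N =
      SemimoduleCat.ofHom (contractLeft R P) := by
  refine SemimoduleCat.MonoidalCategory.tensor_ext fun (f : Module.Dual R P) x => ?_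
  exact LinearMap.congr_fun ((dualEquiv P N).apply_symm_apply f) x

/-- The coevaluation of `1` is `∑ xᵢ ⊗ nᵢ`, and by `coev_one_eq_sum` every retraction gives this
same element. -/
theorem coevaluation_dualEquiv {k : ℕ} (ι : P →ₗ[R] (Fin k → R)) (p : (Fin k → R) →ₗ[R] P)
    (h : p ∘ₗ ι = LinearMap.id) :
    ExactPairing.coevaluation P N ≫ (P ◁ (dualEquiv P N).toModuleIsoₛ.hom) =
      SemimoduleCat.ofHom (coev ι p) := by
  refine SemimoduleCat.hom_ext (LinearMap.ext_ring ?_)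
  obtain ⟨m, x, n, hz, hx, -⟩ := exists_dual_family P N
  refine Eq.trans ?_ (coev_one_eq_sum ι p h x (fun i => dualEquiv P N (n i)) hx).symm
  refine (congrArg (LinearMap.lTensor P (dualEquiv P N).toLinearMap) hz).trans ?_
  rw [map_sum]
  rfl

end DualEquiv

/-! ### Passing between functors and data -/

section

variable {R : Type u} [CommSemiring R] {S : Type v}

open Functor.LaxMonoidal Functor.OplaxMonoidal

/-- Every functor realizes a datum. -/
theorem exists_datum_of_tqft (F : TQFT R S) : ∃ D : Datum R S, Realizes F D := by
  -- The duality of the two points is transported by `F`; its evaluation and coevaluation are the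
  -- images of the cap and the cup.
  let _ := mapExactPairing F.F (Cob.plus S) (Cob.minus S)
  let e := (dualEquiv (F.F.obj (Cob.plus S)) (F.F.obj (Cob.minus S))).toModuleIsoₛ
  refine ⟨⟨F.F.obj (Cob.plus S), isFGProjective_of_exactPairing _ (F.F.obj (Cob.minus S)),
    (ε F.F ≫ F.F.map (Cob.halfIn S)).hom (1 : R), (F.F.map (Cob.halfOut S) ≫ η F.F).hom,
    fun a => (F.F.map (Cob.dot a)).hom⟩, Iso.refl _, e, ?_, fun k ι p h => ?_, ?_, ?_, fun a => ?_⟩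
  · refine Eq.trans ?_ (evaluation_dualEquiv_symm (F.F.obj (Cob.plus S)) (F.F.obj (Cob.minus S)))
    exact congrArg (· ≫ _) (tensorHom_id _ _)
  · refine Eq.trans ?_ (coevaluation_dualEquiv (F.F.obj (Cob.plus S)) (F.F.obj (Cob.minus S)) ι p h)
    refine Eq.trans ?_ (congrArg (_ ≫ ·) (id_tensorHom _ _))
    exact ((Category.assoc _ _ _).trans (congrArg (ε F.F ≫ ·) (Category.assoc _ _ _))).symm
  · refine SemimoduleCat.hom_ext (LinearMap.ext_ring ?_)
    exact (one_smul R ((ε F.F ≫ F.F.map (Cob.halfIn S)).hom (1 : R))).symm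
  · exact Category.id_comp _
  · exact (Category.id_comp _).trans (Category.comp_id _)

/-- A functor determines the datum that it realizes up to isomorphism. -/
theorem Realizes.datum_equiv {F : TQFT R S} {D D' : Datum R S} (h : Realizes F D)
    (h' : Realizes F D') : D ≈ D' := by
  obtain ⟨α, β, -, -, hin, hout, hdot⟩ := h
  obtain ⟨α', β', -, -, hin', hout', hdot'⟩ := h'
  -- Passing through the value of the functor at the positive point identifies the two modules and
  -- matches all the structure.
  let e := α.symm ≪≫ α'
  have h₁ : SemimoduleCat.ofHom (LinearMap.toSpanSingleton R D.P D.vec) ≫ e.hom =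
      SemimoduleCat.ofHom (LinearMap.toSpanSingleton R D'.P D'.vec) := by
    refine ((congrArg (· ≫ e.hom) hin).symm.trans ?_).trans hin'
    simp [e]
  have h₂ : e.hom ≫ SemimoduleCat.ofHom D'.covec = SemimoduleCat.ofHom D.covec := by
    rw [← hout, ← hout']
    simp [e]
  have h₃ : ∀ a, SemimoduleCat.ofHom (D.op a) ≫ e.hom = e.hom ≫ SemimoduleCat.ofHom (D'.op a) := by
    intro a
    rw [← hdot, ← hdot']
    simp [e]
  refine ⟨e.toLinearEquivₛ, ?_, fun x => ?_, fun a x => ?_⟩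
  · have h : e.hom.hom ((1 : R) • D.vec) = (1 : R) • D'.vec :=
      congrArg (fun f => f.hom (1 : R)) h₁
    rwa [one_smul, one_smul] at h
  · exact congrArg (fun f => f.hom x) h₂
  · exact congrArg (fun f => f.hom x) (h₃ a)

/-- The identifications are precomposed with the components of the isomorphism at the two points.
Its compatibility with `η` and `δ` follows from that with `ε` and `μ`, by inverting. -/
theorem Realizes.of_equiv_left {F G : TQFT R S} {D : Datum R S} (h : F ≈ G) (hG : Realizes G D) :
    Realizes F D := by
  obtain ⟨e, he⟩ := h
  obtain ⟨α, β, hcap, hcup, hin, hout, hdot⟩ := hG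
  have hη : e.inv.app (𝟙_ _) ≫ η F.F = η G.F := by
    have h : ε G.F ≫ e.inv.app (𝟙_ _) = ε F.F := by
      rw [← NatTrans.IsMonoidal.unit (τ := e.hom)]
      simp
    rw [← cancel_epi (ε G.F), reassoc_of% h]
    simp
  have hμ : ∀ X Y, (e.inv.app X ⊗ₘ e.inv.app Y) ≫ μ F.F X Y = μ G.F X Y ≫ e.inv.app (X ⊗ Y) :=
    fun X Y => (NatTrans.IsMonoidal.tensor (τ := e.inv) X Y).symm
  have hδ : ∀ X Y, δ F.F X Y ≫ (e.hom.app X ⊗ₘ e.hom.app Y) = e.hom.app (X ⊗ Y) ≫ δ G.F X Y := by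
    intro X Y
    rw [← cancel_epi (μ F.F X Y), ← Category.assoc (μ F.F X Y) (e.hom.app _),
      NatTrans.IsMonoidal.tensor]
    simp
  refine ⟨e.app _ ≪≫ α, e.app _ ≪≫ β, ?_, fun k ι p h => ?_, ?_, ?_, fun a => ?_⟩
  · rw [← hcap]
    simp only [Iso.trans_inv, Iso.app_inv, ← tensorHom_comp_tensorHom, Category.assoc]
    rw [reassoc_of% hμ, ← e.inv.naturality_assoc]
    exact congrArg (fun f => _ ≫ μ G.F _ _ ≫ G.F.map _ ≫ f) hη
  · refine Eq.trans ?_ (hcup k ι p h)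
    simp only [Iso.trans_hom, Iso.app_hom, ← tensorHom_comp_tensorHom]
    rw [reassoc_of% hδ, e.hom.naturality_assoc]
    have hε := NatTrans.IsMonoidal.unit (τ := e.hom)
    exact (Category.assoc _ _ _).symm.trans (congrArg (· ≫ _) hε)
  · refine Eq.trans ?_ hin
    simp
  · rw [← hout]
    simp only [Iso.trans_inv, Iso.app_inv, Category.assoc]
    rw [← e.inv.naturality_assoc]
    exact congrArg (fun f => _ ≫ G.F.map _ ≫ f) hη
  · rw [← hdot]
    simp

/-- The identification of the negative point changes by the inverse transpose of `f`, which
preserves the evaluation. -/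
theorem Realizes.of_equiv_right {F : TQFT R S} {D D' : Datum R S} (hD : D ≈ D')
    (hF : Realizes F D) : Realizes F D' := by
  obtain ⟨f, hv, hc, hm⟩ := hD
  obtain ⟨α, β, hcap, hcup, hin, hout, hdot⟩ := hF
  refine ⟨α ≪≫ f.toModuleIsoₛ, β ≪≫ f.symm.dualMap.toModuleIsoₛ, ?_, fun k ι p h => ?_, ?_, ?_,
    fun a => ?_⟩
  · have h₁ : (f.symm.dualMap.toModuleIsoₛ.inv ⊗ₘ f.toModuleIsoₛ.inv) ≫
        SemimoduleCat.ofHom (contractLeft R D.P) = SemimoduleCat.ofHom (contractLeft R D'.P) :=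
      SemimoduleCat.MonoidalCategory.tensor_ext fun (φ : Module.Dual R D'.P) (x : D'.P) =>
        congrArg φ (f.apply_symm_apply x)
    refine Eq.trans ?_ h₁
    rw [← hcap, tensorHom_comp_tensorHom_assoc]
    rfl
  · have h₁ : SemimoduleCat.ofHom (coev (ι ∘ₗ f.toLinearMap) (f.symm.toLinearMap ∘ₗ p)) ≫
        (f.toModuleIsoₛ.hom ⊗ₘ f.symm.dualMap.toModuleIsoₛ.hom) =
          SemimoduleCat.ofHom (coev ι p) := by
      refine SemimoduleCat.hom_ext (LinearMap.ext_ring ?_)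
      change TensorProduct.map f.toLinearMap f.symm.dualMap.toLinearMap
        (coev (ι ∘ₗ f.toLinearMap) (f.symm.toLinearMap ∘ₗ p) 1) = coev ι p 1
      simp only [coev, LinearMap.toSpanSingleton_apply, one_smul, map_sum, TensorProduct.map_tmul]
      refine Finset.sum_congr rfl fun i _ => congrArg₂ (· ⊗ₜ[R] ·) ?_ ?_
      · exact f.apply_symm_apply _
      · exact LinearMap.ext fun x => congrArg (fun y => ι y i) (f.apply_symm_apply x)
    refine Eq.trans ?_ h₁
    -- A retraction onto the new module is transported along `f` to one onto the old module, where
    -- the hypothesis on the cup applies.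
    have h₂ := hcup k (ι ∘ₗ f.toLinearMap) (f.symm.toLinearMap ∘ₗ p) (LinearMap.ext fun x =>
      (congrArg f.symm (LinearMap.congr_fun h (f x))).trans (f.symm_apply_apply x))
    refine Eq.trans ?_ (congrArg (· ≫ _) h₂)
    simp only [Iso.trans_hom, ← tensorHom_comp_tensorHom]
    exact ((Category.assoc _ _ _).trans (congrArg (ε F.F ≫ ·) ((Category.assoc _ _ _).trans
      (congrArg (F.F.map (Cob.cup S) ≫ ·) (Category.assoc _ _ _))))).symm
  · have h₁ : SemimoduleCat.ofHom (LinearMap.toSpanSingleton R D.P D.vec) ≫ f.toModuleIsoₛ.hom =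
        SemimoduleCat.ofHom (LinearMap.toSpanSingleton R D'.P D'.vec) := by
      refine SemimoduleCat.hom_ext (LinearMap.ext_ring ?_)
      change f ((1 : R) • D.vec) = (1 : R) • D'.vec
      rw [one_smul, one_smul, hv]
    refine Eq.trans ?_ ((congrArg (· ≫ _) hin).trans h₁)
    simp
  · have h₁ : f.toModuleIsoₛ.inv ≫ SemimoduleCat.ofHom D.covec = SemimoduleCat.ofHom D'.covec :=
      SemimoduleCat.hom_ext (LinearMap.ext fun x =>
        (hc (f.symm x)).symm.trans (congrArg D'.covec (f.apply_symm_apply x)))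
    rw [← h₁, ← hout]
    simp
  · have h₁ : f.toModuleIsoₛ.inv ≫ SemimoduleCat.ofHom (D.op a) ≫ f.toModuleIsoₛ.hom =
        SemimoduleCat.ofHom (D'.op a) :=
      SemimoduleCat.hom_ext (LinearMap.ext fun x =>
        (hm a (f.symm x)).trans (congrArg (D'.op a) (f.apply_symm_apply x)))
    rw [← h₁, ← hdot]
    simp

end

end
end OneCob

/-! ### The bijection -/

theorem mainTheorem2 (R : Type u) [CommSemiring R] (S : Type v) :
    ∃ Φ : Quotient (OneCob.TQFT.setoid R S) ≃ Quotient (OneCob.Datum.setoid R S),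
      ∀ (F : OneCob.TQFT R S) (D : OneCob.Datum R S),
        Φ (Quotient.mk (OneCob.TQFT.setoid R S) F) = Quotient.mk (OneCob.Datum.setoid R S) D ↔
          OneCob.Realizes F D := by
  choose d hd using OneCob.exists_datum_of_tqft (R := R) (S := S)
  let φ : Quotient (OneCob.TQFT.setoid R S) → Quotient (OneCob.Datum.setoid R S) :=
    Quotient.map d fun F G h => (hd F).datum_equiv (.of_equiv_left h (hd G))
  -- Equality of classes means that the chosen datum of `F` is isomorphic to `D`. Invariance of
  -- `Realizes` in the datum gives one direction, uniqueness of the realized datum the other.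
  have hφ : ∀ F D, φ (Quotient.mk _ F) = Quotient.mk _ D ↔ OneCob.Realizes F D := fun F D =>
    Quotient.eq.trans ⟨fun h => (hd F).of_equiv_right h, fun h => (hd F).datum_equiv h⟩
  refine ⟨Equiv.ofBijective φ ⟨?_, ?_⟩, hφ⟩
  -- Injectivity is the uniqueness of the functor that realizes a given datum; surjectivity is the
  -- state sum construction.
  · rintro ⟨F⟩ ⟨G⟩ h
    exact Quotient.sound (((hφ F (d G)).1 h).equiv (hd G))
  · rintro ⟨D⟩
    obtain ⟨F, hF⟩ := OneCob.exists_realizes_of_datum D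
    exact ⟨Quotient.mk _ F, (hφ F D).2 hF⟩
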